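/- **Setting.** Fix a set $\Sigma$ of generators (of variable arity), an infinite set of edge names and an infinite set of !-box names. A directed edge is an input $\check a$ or an output $\hat a$ with $a$ an edge name. *Edgeterms* are given by $e ::= \epsilon \mid \check a \mid \hat a \mid [e\rangle A \mid \langle e]A \mid e\,e$ with $A$ a !-box name (the brackets are clockwise and anticlockwise edge groups), and *!-pretensor expressions* by $G ::= 1 \mid 1_{\hat a\check b} \mid \phi_e \mid [G]A \mid G\,G$ with $\phi\in\Sigma$. For an occurrence of a directed edge $x$ in $G$, the *edge context* $\mathrm{ectx}_G(x)$ is the list of the names of the edge groups around it, the *node context* $\mathrm{nctx}_G(x)$ the list of the !-boxes around its node, both from the inside out, and $\mathrm{ctx}_G(x)=\mathrm{ectx}_G(x).\mathrm{nctx}_G(x)$. Write $A\prec_G B$ if the !-box $A$ is nested immediately inside the !-box $B$ in $G$. A *!-tensor expression* is a !-pretensor expression such that: - every directed edge occurs at most once, and $[\dots]A$ occurs at most once for each $A$; - $\mathrm{ectx}_G(x)\cap\mathrm{nctx}_G(x)=\varnothing$ for every directed edge $x$ in $G$; - if $\mathrm{ectx}_G(x)=[B_1,\dots,B_n]$, then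 all $B_i$ are !-boxes of $G$, $B_1\prec_G\dots\prec_G B_n$, and if $n\ge 1$ and $B_n\prec_G C$, then $C\in\mathrm{nctx}_G(x)$; - whenever $\check a,\hat a$ both occur in $G$ (a bound edge), there are lists $es,bs$ with $es.\mathrm{nctx}_G(\check a)=\mathrm{ectx}_G(\hat a).bs$ and $es.\mathrm{nctx}_G(\hat a)=\mathrm{ectx}_G(\check a).bs$. A directed edge is *free* in $G$ if it occurs in $G$ and the same name with the opposite direction does not. A *!-tensor equation* $G=H$ is a pair of !-tensor expressions with the same free directed edges, the same !-boxes, the same relation $\prec$, and $\mathrm{ctx}_G(x)=\mathrm{ctx}_H(x)$ for all free $x$. **Operations.** A freshness function $\mathrm{fr}$ for given expressions is a pair of bijections, of the edge names and of the !-box names, that sends each name occurring in these expressions to a name not occurring in them. The operations on a !-box $B$ commute with products, concatenation, generators, and !-boxes and edge groups with names $A\ne B$, fix $1$, $1_{\hat a\check b}$, $\check a$, $\hat a$ and $\epsilon$, and are given on $B$ by $$\begin{array}{llll} & [G]B\mapsto & [e\rangle B\mapsto & \langle e]B\mapsto\\ \mathrm{Exp}_{B,\mathrm{fr}}: & [G]B\;\mathrm{fr}(G)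 & [e\rangle B\;\mathrm{fr}(e) & \mathrm{fr}(e)\,\langle e]B\\ \mathrm{Kill}_B: & 1 & \epsilon & \epsilon\\ \mathrm{Copy}_{B,\mathrm{fr}}: & [G]B\,[\mathrm{fr}(G)]\mathrm{fr}(B) & [e\rangle B\,[\mathrm{fr}(e)\rangle\mathrm{fr}(B) & \langle\mathrm{fr}(e)]\mathrm{fr}(B)\,\langle e]B\\ \mathrm{Drop}_B: & G & e & e \end{array}$$ Here $\mathrm{fr}(e)$ renames all names in $e$, and $\mathrm{fr}(G)$ renames all edge names in $G$ and the names of all !-boxes $[\dots]C$ occurring in $G$ (also where they label edge groups in $G$); edge groups in $G$ that belong to !-boxes not inside $G$ keep their label. The weakening $\mathrm{Wk}_A^K(G)$ replaces the !-box $[G']A$ in $G$ by $[G'K]A$ and leaves the rest unchanged. **Semantics.** $\llbracket G=H\rrbracket$, the set of *concrete instances* of $G=H$, is the set of all equations without !-box names that are obtained from $G=H$ by a finite sequence of operations $\mathrm{Exp}$ and $\mathrm{Kill}$, applied to both sides, each $\mathrm{Exp}$ with the same freshness function (for the two current expressions) on both sides. A concrete equation *follows* from a set of concrete equations if it lies in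 the smallest symmetric and transitive relation on concrete tensor expressions (!-tensor expressions without !-box names) that contains the set and the equivalence $\equiv$, and contains $XK=YK$ whenever it contains $X=Y$ and $XK,YK$ are concrete tensor expressions. Here $\equiv$ is the equivalence that is closed under products and generated by associativity, commutativity and unit of the product, the equivalence of edgeterms (associativity and unit of concatenation, empty edge groups equal $\epsilon$), renaming of a bound edge to a name not in use, and $G\,1_{\hat b\check a}\equiv G[\check b\mapsto\check a]$, $G\,1_{\hat a\check b}\equiv G[\hat b\mapsto\hat a]$ for $\check b$, respectively $\hat b$, free in $G$. **Theorem.** Let $G=H$ be a !-tensor equation. Every concrete instance of each of the following equations follows from the set $\llbracket G=H\rrbracket$ of concrete instances of $G=H$: - (Prod) $GK=HK$, for every $K$ such that $GK$ and $HK$ are !-tensor expressions; - (Box) $[G]A=[H]A$, for every $A$ such that $[G]A$ and $[H]A$ are !-tensor expressions; - (Weaken) $\mathrm{Wk}_A^K(G)=\mathrm{Wk}_A^K(H)$, for all $A$, $K$ such that both sides are !-tensor expressions; - ($\mathrm{Exp}_B$) $\mathrm{Exp}_{B,\mathrm{fr}}(G)=\mathrm{Exp}_{B,\mathrm{fr}}(H)$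 and ($\mathrm{Copy}_B$) $\mathrm{Copy}_{B,\mathrm{fr}}(G)=\mathrm{Copy}_{B,\mathrm{fr}}(H)$, for every $B$ and every freshness function $\mathrm{fr}$ for $G,H$; - ($\mathrm{Kill}_B$) $\mathrm{Kill}_B(G)=\mathrm{Kill}_B(H)$ and ($\mathrm{Drop}_B$) $\mathrm{Drop}_B(G)=\mathrm{Drop}_B(H)$, for every $B$; - (EdgeRename) $G[a\mapsto b]=H[a\mapsto b]$, for $a$ the name of a free edge of $G$ and every $b$ such that both sides are !-tensor expressions; - (BoxRename) $G[A\mapsto B]=H[A\mapsto B]$, for every !-box $A$ of $G$ and every $B$ such that both sides are !-tensor expressions. -/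

import Mathlib

/-! Tensor expressions with (non-commutative) !-boxes over a signature `S` of variable-arity
generators, edge names `E` and !-box names `B`. -/

namespace BangTensor

/-- Directed edges: an input `ǎ` or an output `â`. -/
inductive DirEdge (E : Type*) where
  | inp (a : E) : DirEdge E
  | out (a : E) : DirEdge E

namespace DirEdge

variable {E : Type*}

/-- The edge name of a directed edge. -/
def name : DirEdge E → E
  | inp a => a
  | out a => a

/-- The same name with the opposite direction. -/
def flip : DirEdge E → DirEdge E
  | inp a => out a
  | out a => inp a

/-- Rename a directed edge. -/
def map (f : E → E) : DirEdge E → DirEdge E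
  | inp a => inp (f a)
  | out a => out (f a)

end DirEdge

/-- Edgeterms. -/
inductive EdgeTerm (E B : Type*) where
  | eps : EdgeTerm E B
  | edge (d : DirEdge E) : EdgeTerm E B
  /-- the clockwise edge group `[e⟩A` -/
  | clock (e : EdgeTerm E B) (A : B) : EdgeTerm E B
  /-- the anticlockwise edge group `⟨e]A` -/
  | anti (e : EdgeTerm E B) (A : B) : EdgeTerm E B
  | cat (e f : EdgeTerm E B) : EdgeTerm E B

/-- !-pretensor expressions. -/
inductive PreTensor (S E B : Type*) where
  /-- the empty tensor `1` -/
  | one : PreTensor S E B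
  /-- the identity tensor with output `a` and input `b` -/
  | idt (a b : E) : PreTensor S E B
  /-- a generator with its edgeterm -/
  | node (φ : S) (e : EdgeTerm E B) : PreTensor S E B
  /-- the !-box `[G]A` -/
  | box (G : PreTensor S E B) (A : B) : PreTensor S E B
  | prod (G H : PreTensor S E B) : PreTensor S E B

/-- An occurrence of a directed edge, with its edge context and its node context
(both listed from the inside out). -/
structure Occ (E B : Type*) where
  dir : DirEdge E
  ectx : List B
  nctx : List B

/-- The context of an occurrence. -/
def Occ.ctx {E B : Type*} (o : Occ E B) : List B := o.ectx ++ o.nctx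

/-- A pair of bijections, on edge names and on !-box names. -/
structure Fr (E B : Type*) where
  edge : Equiv.Perm E
  box : Equiv.Perm B

namespace EdgeTerm

variable {E B : Type*}

/-- The directed edges occurring in an edgeterm, each with the !-boxes of the edge groups around
it, from the inside out. -/
def occ : EdgeTerm E B → List (DirEdge E × List B)
  | eps => []
  | edge d => [(d, [])]
  | clock e A => e.occ.map fun p => (p.1, p.2 ++ [A])
  | anti e A => e.occ.map fun p => (p.1, p.2 ++ [A])
  | cat e f => e.occ ++ f.occ

/-- All !-box names written in an edgeterm. -/
def boxNames : EdgeTerm E B → List B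
  | eps => []
  | edge _ => []
  | clock e A => A :: e.boxNames
  | anti e A => A :: e.boxNames
  | cat e f => e.boxNames ++ f.boxNames

/-- Substitute edge names and !-box names. -/
def map (f : E → E) (g : B → B) : EdgeTerm E B → EdgeTerm E B
  | eps => eps
  | edge d => edge (d.map f)
  | clock e A => clock (e.map f g) (g A)
  | anti e A => anti (e.map f g) (g A)
  | cat e e' => cat (e.map f g) (e'.map f g)

/-- The !-box operation on `A` on edgeterms that acts as `c` on clockwise groups `[e⟩A` and as `k`
on anticlockwise groups `⟨e]A`. -/
def op [DecidableEq B] (A : B) (c k : EdgeTerm E B → EdgeTerm E B) :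
    EdgeTerm E B → EdgeTerm E B
  | eps => eps
  | edge d => edge d
  | clock e C => if C = A then c e else clock (e.op A c k) C
  | anti e C => if C = A then k e else anti (e.op A c k) C
  | cat e f => cat (e.op A c k) (f.op A c k)

/-- Equivalence of edgeterms. -/
inductive Equiv : EdgeTerm E B → EdgeTerm E B → Prop
  | refl (e) : Equiv e e
  | symm {e f} : Equiv e f → Equiv f e
  | trans {e f g} : Equiv e f → Equiv f g → Equiv e g
  | assoc (e f g) : Equiv (cat e (cat f g)) (cat (cat e f) g)
  | eps_cat (e) : Equiv (cat eps e) e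
  | cat_eps (e) : Equiv (cat e eps) e
  | clock_eps (A) : Equiv (clock eps A) eps
  | anti_eps (A) : Equiv (anti eps A) eps
  | cat {e e' f f'} : Equiv e e' → Equiv f f' → Equiv (cat e f) (cat e' f')
  | clock {e e'} (A) : Equiv e e' → Equiv (clock e A) (clock e' A)
  | anti {e e'} (A) : Equiv e e' → Equiv (anti e A) (anti e' A)

end EdgeTerm

namespace PreTensor

variable {S E B : Type*}

/-- The occurrences of directed edges, with their contexts. -/
def occ : PreTensor S E B → List (Occ E B)
  | one => []
  | idt a b => [⟨.out a, [], []⟩, ⟨.inp b, [], []⟩]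
  | node _ e => e.occ.map fun p => ⟨p.1, p.2, []⟩
  | box G A => G.occ.map fun o => ⟨o.dir, o.ectx, o.nctx ++ [A]⟩
  | prod G H => G.occ ++ H.occ

/-- The directed edges occurring in an expression, with multiplicity. -/
def dirs (G : PreTensor S E B) : List (DirEdge E) := G.occ.map Occ.dir

/-- The edge names occurring in an expression. -/
def edges (G : PreTensor S E B) : List E := G.dirs.map DirEdge.name

/-- The names `A` of the !-boxes `[…]A` of an expression, with multiplicity. -/
def boxes : PreTensor S E B → List B
  | one => []
  | idt _ _ => []
  | node _ _ => []
  | box G A => A :: G.boxes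
  | prod G H => G.boxes ++ H.boxes

/-- All !-box names written in an expression, those of edge groups included. -/
def boxNames : PreTensor S E B → List B
  | one => []
  | idt _ _ => []
  | node _ e => e.boxNames
  | box G A => A :: G.boxNames
  | prod G H => G.boxNames ++ H.boxNames

/-- The names of the top-level !-boxes. -/
def topBoxes : PreTensor S E B → List B
  | one => []
  | idt _ _ => []
  | node _ _ => []
  | box _ A => [A]
  | prod G H => G.topBoxes ++ H.topBoxes

/-- `Nested G A C`: the !-box `A` is nested immediately inside the !-box `C` in `G`. -/
def Nested : PreTensor S E B → B → B → Prop
  | one, _, _ => False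
  | idt _ _, _, _ => False
  | node _ _, _, _ => False
  | box G D, A, C => (D = C ∧ A ∈ G.topBoxes) ∨ G.Nested A C
  | prod G H, A, C => G.Nested A C ∨ H.Nested A C

/-- A directed edge is free if it occurs and its opposite does not. -/
def Free (G : PreTensor S E B) (d : DirEdge E) : Prop := d ∈ G.dirs ∧ d.flip ∉ G.dirs

/-- !-tensor expressions: the well-formed !-pretensor expressions. -/
structure IsTensor (G : PreTensor S E B) : Prop where
  /-- each directed edge occurs at most once. -/
  edges_nodup : G.dirs.Nodup
  /-- each !-box occurs at most once. -/
  boxes_nodup : G.boxes.Nodup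
  /-- edge context and node context are disjoint. -/
  ctx_disjoint : ∀ o ∈ G.occ, o.ectx.Disjoint o.nctx
  /-- an edge context consists of !-boxes of `G`, -/
  ectx_mem : ∀ o ∈ G.occ, ∀ A ∈ o.ectx, A ∈ G.boxes
  /-- each of them nested immediately inside the next, -/
  ectx_chain : ∀ o ∈ G.occ, o.ectx.IsChain G.Nested
  /-- and a !-box around the outermost of them also contains the node: every !-box that contains the
  edge is listed in its context. -/
  ectx_last : ∀ o ∈ G.occ, ∀ A ∈ o.ectx.getLast?, ∀ C, G.Nested A C → C ∈ o.nctx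
  /-- the contexts of the two ends of a bound edge match. -/
  bound : ∀ a, ∀ i ∈ G.occ, ∀ o ∈ G.occ, i.dir = .inp a → o.dir = .out a →
    ∃ es bs : List B, es ++ i.nctx = o.ectx ++ bs ∧ es ++ o.nctx = i.ectx ++ bs

/-- `G = H` is a !-tensor equation: both sides are !-tensor expressions, and their boundaries are
compatible. -/
structure IsEquation (G H : PreTensor S E B) : Prop where
  left : G.IsTensor
  right : H.IsTensor
  free_iff : ∀ d, G.Free d ↔ H.Free d
  boxes_iff : ∀ A, A ∈ G.boxes ↔ A ∈ H.boxes
  nested_iff : ∀ A C, G.Nested A C ↔ H.Nested A C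
  ctx_eq : ∀ o ∈ G.occ, ∀ o' ∈ H.occ, o.dir = o'.dir → G.Free o.dir → o.ctx = o'.ctx

/-- Substitute edge names and !-box names. -/
def map (f : E → E) (g : B → B) : PreTensor S E B → PreTensor S E B
  | one => one
  | idt a b => idt (f a) (f b)
  | node φ e => node φ (e.map f g)
  | box G A => box (G.map f g) (g A)
  | prod G H => prod (G.map f g) (H.map f g)

/-- `G[a ↦ b]` for edge names. -/
def renameEdge [DecidableEq E] (a b : E) (G : PreTensor S E B) : PreTensor S E B :=
  G.map (Function.update id a b) id

/-- `G[A ↦ C]` for !-box names. -/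
def renameBox [DecidableEq B] (A C : B) (G : PreTensor S E B) : PreTensor S E B :=
  G.map id (Function.update id A C)

/-- `fr` is a freshness function for the names that occur in `G` or `H`. -/
def IsFresh (fr : Fr E B) (G H : PreTensor S E B) : Prop :=
  (∀ a ∈ G.edges ++ H.edges, fr.edge a ∉ G.edges ++ H.edges) ∧
    ∀ A ∈ G.boxNames ++ H.boxNames, fr.box A ∉ G.boxNames ++ H.boxNames

section Operations

variable [DecidableEq B]

/-- The !-box operation on `A` that acts as `t` on `[G]A`, as `c` on `[e⟩A` and as `k` on
`⟨e]A`, and commutes with everything else. -/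
def op (A : B) (c k : EdgeTerm E B → EdgeTerm E B) (t : PreTensor S E B → PreTensor S E B) :
    PreTensor S E B → PreTensor S E B
  | one => one
  | idt a b => idt a b
  | node φ e => node φ (e.op A c k)
  | box G C => if C = A then t G else box (G.op A c k t) C
  | prod G H => prod (G.op A c k t) (H.op A c k t)

/-- The fresh copy `fr(G)` of the contents `G` of a !-box: all edges of `G` and all !-boxes of `G`
get their new names. The only !-box names in `G` that can be left are those of edge groups that
belong to !-boxes outside `G`: these are not copied and keep their names. -/
def fresh (fr : Fr E B) (G : PreTensor S E B) : PreTensor S E B :=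
  G.map fr.edge fun C => if C ∈ G.boxes then fr.box C else C

/-- `Exp`: `[G]A ↦ [G]A fr(G)`, `[e⟩A ↦ [e⟩A fr(e)`, `⟨e]A ↦ fr(e) ⟨e]A`. -/
def exp (A : B) (fr : Fr E B) : PreTensor S E B → PreTensor S E B :=
  op A (fun e => .cat (.clock e A) (e.map fr.edge fr.box))
    (fun e => .cat (e.map fr.edge fr.box) (.anti e A))
    (fun G => prod (box G A) (G.fresh fr))

/-- `Kill`: `[G]A ↦ 1`, `[e⟩A ↦ ε`, `⟨e]A ↦ ε`. -/
def kill (A : B) : PreTensor S E B → PreTensor S E B :=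
  op A (fun _ => .eps) (fun _ => .eps) (fun _ => one)

/-- `Copy`: `[G]A ↦ [G]A [fr(G)]fr(A)`, `[e⟩A ↦ [e⟩A [fr(e)⟩fr(A)`,
`⟨e]A ↦ ⟨fr(e)]fr(A) ⟨e]A`. -/
def copy (A : B) (fr : Fr E B) : PreTensor S E B → PreTensor S E B :=
  op A (fun e => .cat (.clock e A) (.clock (e.map fr.edge fr.box) (fr.box A)))
    (fun e => .cat (.anti (e.map fr.edge fr.box) (fr.box A)) (.anti e A))
    (fun G => prod (box G A) (box (G.fresh fr) (fr.box A)))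

/-- `Drop`: `[G]A ↦ G`, `[e⟩A ↦ e`, `⟨e]A ↦ e`. -/
def drop (A : B) : PreTensor S E B → PreTensor S E B :=
  op A (fun e => e) (fun e => e) (fun G => G)

/-- Weakening of the !-box `A` by `K`. -/
def weaken (A : B) (K : PreTensor S E B) : PreTensor S E B → PreTensor S E B
  | one => one
  | idt a b => idt a b
  | node φ e => node φ e
  | box G C => if C = A then box (prod G K) C else box (weaken A K G) C
  | prod G H => prod (weaken A K G) (weaken A K H)

/-- `Inst G H X Y`: the equation `X = Y` without !-boxes is obtained from `G = H` by a sequence of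
the operations `Exp` and `Kill`, applied to both sides with the same freshness functions. -/
inductive Inst : PreTensor S E B → PreTensor S E B → PreTensor S E B → PreTensor S E B → Prop
  | done {G H} : G.boxNames = [] → H.boxNames = [] → Inst G H G H
  | exp {G H X Y} (A : B) (fr : Fr E B) : IsFresh fr G H →
      Inst (G.exp A fr) (H.exp A fr) X Y → Inst G H X Y
  | kill {G H X Y} (A : B) : Inst (G.kill A) (H.kill A) X Y → Inst G H X Y

/-- `⟦G = H⟧`, the set of concrete instances of the equation `G = H`. -/
def sem (G H : PreTensor S E B) : Set (PreTensor S E B × PreTensor S E B) :=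
  {p | Inst G H p.1 p.2}

end Operations

/-- Concrete tensor expressions: the tensor expressions without !-boxes. -/
def IsConcrete (G : PreTensor S E B) : Prop := G.IsTensor ∧ G.boxNames = []

/-- Equivalence `≡` of tensor expressions (used below for concrete ones): product laws, edgeterm
equivalence, renaming of bound edges, contraction of identities, and closure under products. -/
inductive Equiv [DecidableEq E] : PreTensor S E B → PreTensor S E B → Prop
  | refl (G) : Equiv G G
  | symm {G H} : Equiv G H → Equiv H G
  | trans {G H K} : Equiv G H → Equiv H K → Equiv G K
  | assoc (G H K) : Equiv (prod (prod G H) K) (prod G (prod H K))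
  | comm (G H) : Equiv (prod G H) (prod H G)
  | unit (G) : Equiv (prod G one) G
  | node (φ) {e f} : e.Equiv f → Equiv (node φ e) (node φ f)
  | bound (G) (a b : E) : .inp a ∈ G.dirs → .out a ∈ G.dirs → b ∉ G.edges →
      Equiv G (G.renameEdge a b)
  | contract_inp (G) (a b : E) : .inp b ∈ G.dirs → (prod G (idt b a)).IsTensor →
      Equiv (prod G (idt b a)) (G.renameEdge b a)
  | contract_out (G) (a b : E) : .out b ∈ G.dirs → (prod G (idt a b)).IsTensor →
      Equiv (prod G (idt a b)) (G.renameEdge b a)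
  | prod {G H} (K) : Equiv G H → (prod G K).IsTensor → (prod H K).IsTensor →
      Equiv (prod G K) (prod H K)

/-- `Derives P X Y`: the concrete equation `X = Y` follows from the concrete equations in `P` by
equational reasoning: equality contains `≡`, is symmetric and transitive, and is preserved by
products. -/
inductive Derives [DecidableEq E] (P : Set (PreTensor S E B × PreTensor S E B)) :
    PreTensor S E B → PreTensor S E B → Prop
  | ax {X Y} : (X, Y) ∈ P → Derives P X Y
  | equiv {X Y} : X.IsConcrete → Y.IsConcrete → X.Equiv Y → Derives P X Y
  | symm {X Y} : Derives P X Y → Derives P Y X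
  | trans {X Y Z} : Derives P X Y → Derives P Y Z → Derives P X Z
  | prod {X Y} (K) : Derives P X Y → (prod X K).IsConcrete → (prod Y K).IsConcrete →
      Derives P (prod X K) (prod Y K)

/-- All equations in `Q` follow from the equations in `P`. -/
def Follows [DecidableEq E] (Q P : Set (PreTensor S E B × PreTensor S E B)) : Prop :=
  ∀ p ∈ Q, Derives P p.1 p.2

end PreTensor

end BangTensor

open BangTensor

/-!
An equation `G = H` with !-boxes stands for the family of all its concrete instances. The proof
replaces the sequences of operations that define these instances by a direct description.

A *count function* says how many copies each !-box has, depending on the copies of the surrounding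
!-boxes that one is in. `PreTensor.unroll` replaces every !-box by the prescribed number of copies;
the copies of an edge `a` are told apart by an environment `ρ`, which gives the index of the copy
of each surrounding !-box that they lie in, so that the result is a net with edges `(a, ρ)`. Two
facts connect this with the instances of `G = H`:

* `Inst.realizes`: every instance of an equation is the unrolling of both sides along some count
  function, up to an injective renaming of the edges;
* `exists_inst`: every count function is reached in this way.

Both rest on the behaviour of the operations under unrolling: killing `A` sets the count of `A` to
`0` (`unroll_kill`), dropping `A` sets it to `1` (`unroll_drop`), copying `A` splits the copies of
`A` into two groups (`unroll_copy`), and expanding is copying followed by dropping the new !-box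
(`exp_eq_drop_copy`). All of this is done for expressions that are `Layered` by a function that gives
the ancestors of each !-box; tensor expressions are layered by the transitive closure of `≺`
(`IsTensor.layered`).

On the side of equational reasoning, concrete expressions with the same net are equivalent
(`equiv_of_net_eq`), and derived equations may be renamed along any map that does not identify edges
(`Derives.rename`): free edges are renamed by plugging in identities, bound ones by `≡`. Since both
sides of an equation have the same boundary after unrolling, it follows that *all* equations between
unrollings of `G` and `H` along a common count function follow from `⟦G = H⟧`
(`IsEquation.netDerives`).

Each rule is then an identity between unrollings. The result of an operation or of a renaming
unrolls like `G = H` along another count function. The unrolling of `G K` is that of `G` together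
with a part that is the same on both sides, and likewise for weakening. The unrolling of `[G]A` is a
sum of unrollings of `G`, and these are exchanged one after another (`NetDerives.sum`).
-/

namespace BangTensor

/-! ### Nets and unrolling -/

/-- Rename a directed edge; the target type may differ from the source type. -/
def DirEdge.rename {E F : Type*} (f : E → F) : DirEdge E → DirEdge F
  | inp a => inp (f a)
  | out a => out (f a)

/-- A factor of a product without !-boxes: a generator with the list of its directed edges, or an
identity. Flattening edgeterms to lists absorbs the equivalence of edgeterms. -/
inductive Factor (S E : Type*) where
  | node (φ : S) (l : List (DirEdge E)) : Factor S E
  | idt (a b : E) : Factor S E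

/-- Rename the edges of a factor. -/
def Factor.rename {S E F : Type*} (f : E → F) : Factor S E → Factor S F
  | node φ l => node φ (l.map (DirEdge.rename f))
  | idt a b => idt (f a) (f b)

/-- A tensor without !-boxes up to the product laws and the equivalence of edgeterms. -/
abbrev Net (S E : Type*) := Multiset (Factor S E)

/-- Rename the edges of a net. -/
def Net.rename {S E F : Type*} (f : E → F) (N : Net S E) : Net S F :=
  Multiset.map (Factor.rename f) N

/-- An environment gives every !-box around the current position the index of the copy that the
position lies in; copies are numbered from `1`, and `0` stands for no copy. -/
abbrev Env (B : Type*) := B → ℕ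

/-- A count function: the number of copies of each !-box in each environment. -/
abbrev Count (B : Type*) := B → Env B → ℕ

section Rename

variable {S E F F' : Type*}

@[simp] theorem DirEdge.rename_inp (f : E → F) (a : E) : (DirEdge.inp a).rename f = .inp (f a) :=
  rfl

@[simp] theorem DirEdge.rename_out (f : E → F) (a : E) : (DirEdge.out a).rename f = .out (f a) :=
  rfl

theorem DirEdge.rename_rename (g : F → F') (f : E → F) (d : DirEdge E) :
    (d.rename f).rename g = d.rename (g ∘ f) := by
  cases d <;> rfl

theorem DirEdge.rename_congr {f g : E → F} {d : DirEdge E} (h : f d.name = g d.name) :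
    d.rename f = d.rename g := by
  cases d <;> simp_all [DirEdge.name]

@[simp] theorem DirEdge.name_rename (f : E → F) (d : DirEdge E) :
    (d.rename f).name = f d.name := by
  cases d <;> rfl

@[simp] theorem DirEdge.flip_rename (f : E → F) (d : DirEdge E) :
    (d.rename f).flip = d.flip.rename f := by
  cases d <;> rfl

@[simp] theorem DirEdge.name_flip (d : DirEdge E) : d.flip.name = d.name := by
  cases d <;> rfl

@[simp] theorem DirEdge.flip_flip (d : DirEdge E) : d.flip.flip = d := by
  cases d <;> rfl

theorem Factor.rename_rename (g : F → F') (f : E → F) (x : Factor S E) :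
    (x.rename f).rename g = x.rename (g ∘ f) := by
  cases x <;> simp [Factor.rename, DirEdge.rename_rename, Function.comp_def]

theorem Net.rename_rename (g : F → F') (f : E → F) (N : Net S E) :
    (N.rename f).rename g = N.rename (g ∘ f) := by
  simp [Net.rename, Factor.rename_rename, Function.comp_def]

@[simp] theorem Net.rename_add (f : E → F) (M N : Net S E) :
    Net.rename f (M + N) = M.rename f + N.rename f := by
  simp [Net.rename]

theorem Net.rename_sum (f : E → F) {ι : Type*} (s : Finset ι) (N : ι → Net S E) :
    Net.rename f (∑ i ∈ s, N i) = ∑ i ∈ s, (N i).rename f :=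
  map_sum (Multiset.mapAddMonoidHom (Factor.rename f)) N s

end Rename

section Unroll

variable {S E B : Type*} [DecidableEq B]

/-- The directed edges of an edgeterm after every edge group around `A` has been replaced by
`n A ρ` copies of its contents. An edge `a` met in the environment `ρ` gets the name `(a, ρ)`. The
copies in an anticlockwise group are listed in reverse, as every expansion puts its fresh copy of such
a group in front. -/
def EdgeTerm.unroll (n : Count B) : EdgeTerm E B → Env B → List (DirEdge (E × Env B))
  | eps, _ => []
  | edge d, ρ => [d.rename fun a => (a, ρ)]
  | clock e A, ρ =>
    (List.range (n A ρ)).flatMap fun i => e.unroll n (Function.update ρ A (i + 1))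
  | anti e A, ρ =>
    (List.range (n A ρ)).reverse.flatMap fun i => e.unroll n (Function.update ρ A (i + 1))
  | cat e f, ρ => e.unroll n ρ ++ f.unroll n ρ

/-- The net that arises from an expression if every !-box `A` is replaced by `n A ρ` copies of its
contents. All copies of an edge are told apart by their environments. -/
def PreTensor.unroll (n : Count B) : PreTensor S E B → Env B → Net S (E × Env B)
  | one, _ => 0
  | idt a b, ρ => {.idt (a, ρ) (b, ρ)}
  | node φ e, ρ => {.node φ (e.unroll n ρ)}
  | box G A, ρ => ∑ i ∈ Finset.range (n A ρ), G.unroll n (Function.update ρ A (i + 1))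
  | prod G H, ρ => G.unroll n ρ + H.unroll n ρ

theorem EdgeTerm.unroll_of_occ_eq_nil (n : Count B) (e : EdgeTerm E B) (he : e.occ = [])
    (ρ : Env B) : e.unroll n ρ = [] := by
  induction e generalizing ρ with
  | eps => rfl
  | edge d => simp [occ] at he
  | clock e A ih => simp [occ] at he; simp [unroll, ih he]
  | anti e A ih => simp [occ] at he; simp [unroll, ih he]
  | cat e f ihe ihf => simp [occ] at he; simp [unroll, ihe he.1, ihf he.2]

omit [DecidableEq B] in
theorem EdgeTerm.occ_map (f : E → E) (g : B → B) (e : EdgeTerm E B) :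
    (e.map f g).occ = e.occ.map fun p => (p.1.map f, p.2.map g) := by
  induction e with
  | eps => rfl
  | edge d => simp [occ, EdgeTerm.map]
  | clock e A ih => simp [occ, EdgeTerm.map, ih]
  | anti e A ih => simp [occ, EdgeTerm.map, ih]
  | cat e f ihe ihf => simp [occ, EdgeTerm.map, ihe, ihf]

omit [DecidableEq B] in
theorem PreTensor.occ_map (f : E → E) (g : B → B) (G : PreTensor S E B) :
    (G.map f g).occ = G.occ.map fun o => ⟨o.dir.map f, o.ectx.map g, o.nctx.map g⟩ := by
  induction G with
  | one => rfl
  | idt a b => simp [occ, PreTensor.map, DirEdge.map]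
  | node φ e => simp [occ, PreTensor.map, EdgeTerm.occ_map]
  | box G A ih => simp [occ, PreTensor.map, ih]
  | prod G H ihG ihH => simp [occ, PreTensor.map, ihG, ihH]

omit [DecidableEq B] in
theorem PreTensor.boxes_map (f : E → E) (g : B → B) (G : PreTensor S E B) :
    (G.map f g).boxes = G.boxes.map g := by
  induction G with
  | one => rfl
  | idt a b => rfl
  | node φ e => rfl
  | box G A ih => simp [boxes, PreTensor.map, ih]
  | prod G H ihG ihH => simp [boxes, PreTensor.map, ihG, ihH]

/-- Unrolling with counts `n` is simulated, after the substitutions `f` and `g`, by unrolling with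
counts `n'`. The map `t` translates the environments, `h` the names of the copies; `I` is an
invariant of the environments met on the way, and `K` holds of the !-boxes met on the way. -/
structure Simulates (n n' : Count B) (f : E → E) (g : B → B) (t : Env B → Env B)
    (h : E × Env B → E × Env B) (I : Env B → Prop) (K : B → Prop) : Prop where
  name : ∀ a ρ, I ρ → h (a, ρ) = (f a, t ρ)
  count : ∀ C, K C → ∀ ρ, I ρ → n' (g C) (t ρ) = n C ρ
  inv : ∀ C, K C → ∀ ρ, I ρ → ∀ i, i < n C ρ → I (Function.update ρ C (i + 1))
  update : ∀ C, K C → ∀ ρ, I ρ → ∀ i, i < n C ρ →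
    t (Function.update ρ C (i + 1)) = Function.update (t ρ) (g C) (i + 1)

variable {n n' : Count B} {f : E → E} {g : B → B} {t : Env B → Env B}
  {h : E × Env B → E × Env B} {I : Env B → Prop} {K : B → Prop}

theorem EdgeTerm.unroll_map (hs : Simulates n n' f g t h I K) (e : EdgeTerm E B)
    (he : ∀ p ∈ e.occ, ∀ C ∈ p.2, K C) (ρ : Env B) (hρ : I ρ) :
    (e.map f g).unroll n' (t ρ) = (e.unroll n ρ).map (DirEdge.rename h) := by
  -- `K` may fail for the name of a group without edges, but such a group unrolls to nothing
  have group : ∀ (e : EdgeTerm E B) (A : B),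
      ((∀ p ∈ e.occ, ∀ C ∈ p.2, K C) → ∀ ρ, I ρ →
        (e.map f g).unroll n' (t ρ) = (e.unroll n ρ).map (DirEdge.rename h)) →
      (∀ p ∈ e.occ, ∀ C ∈ p.2 ++ [A], K C) → ∀ ρ, I ρ →
      (∀ i < n A ρ, (e.map f g).unroll n' (Function.update (t ρ) (g A) (i + 1)) =
        (e.unroll n (Function.update ρ A (i + 1))).map (DirEdge.rename h)) ∧
      (e.occ ≠ [] → n' (g A) (t ρ) = n A ρ) := by
    intro e A ih he ρ hρ
    by_cases h0 : e.occ = []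
    · refine ⟨fun i _ => ?_, fun h1 => absurd h0 h1⟩
      rw [unroll_of_occ_eq_nil _ _ (by simp [occ_map, h0]), unroll_of_occ_eq_nil _ _ h0]; rfl
    · obtain ⟨p, hp⟩ := List.exists_mem_of_ne_nil _ h0
      have hA : K A := he p hp A (by simp)
      refine ⟨fun i hi => ?_, fun _ => hs.count A hA ρ hρ⟩
      rw [← hs.update A hA ρ hρ i hi]
      exact ih (fun p hp C hC => he p hp C (by simp [hC])) _ (hs.inv A hA ρ hρ i hi)
  induction e generalizing ρ with
  | eps => rfl
  | edge d => cases d <;> simp [unroll, EdgeTerm.map, DirEdge.map, hs.name _ _ hρ]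
  | clock e A ih =>
    obtain ⟨h1, h2⟩ := group e A ih
      (fun p hp => he (p.1, p.2 ++ [A]) (List.mem_map.2 ⟨p, hp, rfl⟩)) ρ hρ
    by_cases h0 : e.occ = []
    · rw [unroll_of_occ_eq_nil _ _ (by simp [occ_map, h0, occ]),
        unroll_of_occ_eq_nil _ _ (by simp [h0, occ])]; rfl
    · simp only [unroll, EdgeTerm.map, h2 h0, List.map_flatMap]
      exact List.flatMap_congr fun i hi => h1 i (by simpa using hi)
  | anti e A ih =>
    obtain ⟨h1, h2⟩ := group e A ih
      (fun p hp => he (p.1, p.2 ++ [A]) (List.mem_map.2 ⟨p, hp, rfl⟩)) ρ hρ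
    by_cases h0 : e.occ = []
    · rw [unroll_of_occ_eq_nil _ _ (by simp [occ_map, h0, occ]),
        unroll_of_occ_eq_nil _ _ (by simp [h0, occ])]; rfl
    · simp only [unroll, EdgeTerm.map, h2 h0, List.map_flatMap]
      exact List.flatMap_congr fun i hi => h1 i (by simpa using hi)
  | cat e e' ih ih' =>
    simp only [unroll, EdgeTerm.map, List.map_append]
    rw [ih (fun p hp => he p (by simp [occ, hp])) ρ hρ,
      ih' (fun p hp => he p (by simp [occ, hp])) ρ hρ]

theorem PreTensor.unroll_map (hs : Simulates n n' f g t h I K) (G : PreTensor S E B)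
    (hb : ∀ C ∈ G.boxes, K C) (he : ∀ o ∈ G.occ, ∀ C ∈ o.ectx, K C) (ρ : Env B) (hρ : I ρ) :
    (G.map f g).unroll n' (t ρ) = (G.unroll n ρ).rename h := by
  induction G generalizing ρ with
  | one => rfl
  | idt a b => simp [unroll, PreTensor.map, Net.rename, Factor.rename, hs.name _ _ hρ]
  | node φ e =>
    simp only [unroll, PreTensor.map, Net.rename, Factor.rename, Multiset.map_singleton]
    rw [EdgeTerm.unroll_map hs e _ ρ hρ]
    intro p hp
    exact he ⟨p.1, p.2, []⟩ (List.mem_map.2 ⟨p, hp, rfl⟩)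
  | box G A ih =>
    have hA : K A := hb A (by simp [boxes])
    simp only [unroll, PreTensor.map, Net.rename_sum, hs.count A hA ρ hρ]
    refine Finset.sum_congr rfl fun i hi => ?_
    rw [Finset.mem_range] at hi
    rw [← hs.update A hA ρ hρ i hi]
    refine ih (fun C hC => hb C (by simp [boxes, hC])) (fun o ho => ?_) _ (hs.inv A hA ρ hρ i hi)
    exact he ⟨o.dir, o.ectx, o.nctx ++ [A]⟩ (List.mem_map.2 ⟨o, ho, rfl⟩)
  | prod G H ihG ihH =>
    simp only [unroll, PreTensor.map, Net.rename_add]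
    rw [ihG (fun C hC => hb C (by simp [boxes, hC])) (fun o ho => he o (by simp [occ, ho])) ρ hρ,
      ihH (fun C hC => hb C (by simp [boxes, hC])) (fun o ho => he o (by simp [occ, ho])) ρ hρ]

omit [DecidableEq B] in
theorem EdgeTerm.map_id (e : EdgeTerm E B) : e.map id id = e := by
  induction e with
  | eps => rfl
  | edge d => cases d <;> rfl
  | clock e A ih => simp [EdgeTerm.map, ih]
  | anti e A ih => simp [EdgeTerm.map, ih]
  | cat e f ihe ihf => simp [EdgeTerm.map, ihe, ihf]

omit [DecidableEq B] in
theorem PreTensor.map_id (G : PreTensor S E B) : G.map id id = G := by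
  induction G with
  | one => rfl
  | idt a b => rfl
  | node φ e => simp [PreTensor.map, EdgeTerm.map_id]
  | box G A ih => simp [PreTensor.map, ih]
  | prod G H ihG ihH => simp [PreTensor.map, ihG, ihH]

/-! ### Expressions layered by an ancestor function -/

/-- `UpClosed anc l`: the list `l` of !-boxes, from the inside out, has no repetitions, and all
`anc`-ancestors of an entry come later in it. -/
def UpClosed (anc : B → Set B) : List B → Prop
  | [] => True
  | A :: l => A ∉ l ∧ (∀ D ∈ anc A, D ∈ l ∧ anc D ⊆ anc A) ∧ UpClosed anc l

/-- `Layered anc r G`: in `G`, placed inside the !-boxes `r` (from the inside out), the ancestors of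
a !-box are exactly the !-boxes around it, and contexts of edges are closed under ancestors. An edge
group inside `[G]A` that belongs to a !-box inside `A` must belong to one of `G`, since the fresh copy
of `G` renames just the !-boxes of `G`.
This is what the operations have to know about an expression; unlike the relation `≺`, the function
`anc` can be shared by the two sides of an equation by construction. -/
def PreTensor.Layered (anc : B → Set B) : List B → PreTensor S E B → Prop
  | _, one => True
  | _, idt _ _ => True
  | r, node _ e => ∀ p ∈ e.occ, UpClosed anc (p.2 ++ r) ∧ p.2.Pairwise fun C D => D ∈ anc C
  | r, box G A => UpClosed anc (A :: r) ∧ (∀ C ∈ r, C ∈ anc A) ∧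
      (∀ o ∈ G.occ, ∀ C ∈ o.ectx, A ∈ anc C → C ∈ G.boxes) ∧ Layered anc (A :: r) G
  | r, prod G H => Layered anc r G ∧ Layered anc r H

/-- Inside `M`, the !-box `C` and its ancestors behave like a node of a forest. -/
def Proper (anc : B → Set B) (M : Set B) (C : B) : Prop :=
  C ∈ M ∧ C ∉ anc C ∧ ∀ D ∈ anc C, D ∈ M ∧ anc D ⊆ anc C

/-- The number of copies of a !-box depends only on the copies of its ancestors that it is in. -/
def Count.Local (anc : B → Set B) (n : Count B) : Prop :=
  ∀ C ρ ρ', (∀ D ∈ anc C, ρ D = ρ' D) → n C ρ = n C ρ'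

variable {anc : B → Set B} {M : Set B}

omit [DecidableEq B] in
theorem UpClosed.of_append {l l' : List B} (hl : UpClosed anc (l ++ l')) : UpClosed anc l' := by
  induction l with
  | nil => exact hl
  | cons A l ih => exact ih hl.2.2

omit [DecidableEq B] in
theorem UpClosed.nodup {l : List B} (hl : UpClosed anc l) : l.Nodup := by
  induction l with
  | nil => simp
  | cons A l ih => exact List.nodup_cons.2 ⟨hl.1, ih hl.2.2⟩

omit [DecidableEq B] in
/-- An outer !-box does not lie inside an inner one. -/
theorem UpClosed.not_mem_anc {A : B} {l : List B} (hl : UpClosed anc (A :: l)) :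
    ∀ C ∈ l, A ∉ anc C := by
  intro C hC hA
  obtain ⟨l1, l2, rfl⟩ := List.append_of_mem hC
  have := (hl.2.2.of_append).2.1 A hA
  exact hl.1 (by simp [this.1])

omit [DecidableEq B] in
theorem UpClosed.proper {l : List B} (hl : UpClosed anc l) (hM : ∀ C ∈ l, C ∈ M) :
    ∀ C ∈ l, Proper anc M C := by
  intro C hC
  obtain ⟨l1, l2, rfl⟩ := List.append_of_mem hC
  have h2 := hl.of_append
  exact ⟨hM C hC, fun hC' => h2.1 (h2.2.1 C hC').1,
    fun D hD => ⟨hM D (by simp [(h2.2.1 D hD).1]), (h2.2.1 D hD).2⟩⟩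

end Unroll

section Layered

variable {S E B : Type*} {anc : B → Set B} {M : Set B}

theorem UpClosed.inner {A C : B} {l r : List B} (h : UpClosed anc (l ++ A :: r)) (hC : C ∈ l) :
    C ≠ A ∧ C ∉ anc A ∧ C ∉ r := by
  have hn := h.nodup
  have h2 := h.of_append.2.1
  rw [List.nodup_append] at hn
  have h3 : C ∉ r := fun hr => hn.2.2 C hC C (by simp [hr]) rfl
  exact ⟨hn.2.2 C hC A (by simp), fun hA => h3 (h2 C hA).1, h3⟩

namespace PreTensor

theorem boxes_subset_boxNames {G : PreTensor S E B} : ∀ C ∈ G.boxes, C ∈ G.boxNames := by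
  induction G with
  | one => simp [boxes]
  | idt a b => simp [boxes]
  | node φ e => simp [boxes]
  | box G A ih => simp only [boxes, boxNames, List.mem_cons]; grind
  | prod G H ihG ihH => simp only [boxes, boxNames, List.mem_append]; grind

theorem _root_.BangTensor.EdgeTerm.occ_subset_boxNames {e : EdgeTerm E B} :
    ∀ p ∈ e.occ, ∀ C ∈ p.2, C ∈ e.boxNames := by
  induction e with
  | eps => simp [EdgeTerm.occ]
  | edge d => simp [EdgeTerm.occ]
  | clock e A ih =>
    simp only [EdgeTerm.occ, EdgeTerm.boxNames, List.mem_map]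
    rintro _ ⟨p, hp, rfl⟩ C hC
    have := ih p hp C
    grind
  | anti e A ih =>
    simp only [EdgeTerm.occ, EdgeTerm.boxNames, List.mem_map]
    rintro _ ⟨p, hp, rfl⟩ C hC
    have := ih p hp C
    grind
  | cat e f ihe ihf =>
    simp only [EdgeTerm.occ, EdgeTerm.boxNames, List.mem_append]
    rintro p (hp | hp) C hC
    exacts [.inl (ihe p hp C hC), .inr (ihf p hp C hC)]

theorem ectx_subset_boxNames {G : PreTensor S E B} :
    ∀ o ∈ G.occ, ∀ C ∈ o.ectx, C ∈ G.boxNames := by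
  induction G with
  | one => simp [occ]
  | idt a b => simp [occ]
  | node φ e =>
    simp only [occ, boxNames, List.mem_map]
    rintro _ ⟨p, hp, rfl⟩
    exact EdgeTerm.occ_subset_boxNames p hp
  | box G A ih => simp only [occ, boxNames, List.mem_map]; grind
  | prod G H ihG ihH => simp only [occ, boxNames, List.mem_append]; grind

theorem nctx_subset_boxes {G : PreTensor S E B} :
    ∀ o ∈ G.occ, ∀ C ∈ o.nctx, C ∈ G.boxes := by
  induction G with
  | one => simp [occ]
  | idt a b => simp [occ]
  | node φ e => simp only [occ, List.mem_map]; grind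
  | box G A ih => simp only [occ, boxes, List.mem_map]; grind
  | prod G H ihG ihH => simp only [occ, boxes, List.mem_append]; grind

theorem Layered.box_ctx {r : List B} {G : PreTensor S E B} (hG : G.Layered anc r) :
    ∀ C ∈ G.boxes, ∃ s, UpClosed anc (C :: s ++ r) ∧ (∀ D ∈ s ++ r, D ∈ anc C) ∧
      ∀ D ∈ s, D ∈ G.boxes := by
  induction G generalizing r with
  | one => simp [boxes]
  | idt a b => simp [boxes]
  | node φ e => simp [boxes]
  | box G A ih =>
    intro C hC
    obtain ⟨h1, h2, h3, h4⟩ := hG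
    rcases List.mem_cons.1 hC with rfl | hC
    · exact ⟨[], by simpa using h1, by simpa using h2, by simp⟩
    · obtain ⟨s, hs1, hs2, hs3⟩ := ih h4 C hC
      refine ⟨s ++ [A], by simpa using hs1, by simpa using hs2, fun D hD => ?_⟩
      rcases List.mem_append.1 hD with h | h
      · exact List.mem_cons_of_mem _ (hs3 D h)
      · simp only [List.mem_singleton] at h; simp [boxes, h]
  | prod G H ihG ihH =>
    intro C hC
    rcases List.mem_append.1 hC with h | h
    · obtain ⟨s, h1, h2, h3⟩ := ihG hG.1 C h
      exact ⟨s, h1, h2, fun D hD => List.mem_append_left _ (h3 D hD)⟩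
    · obtain ⟨s, h1, h2, h3⟩ := ihH hG.2 C h
      exact ⟨s, h1, h2, fun D hD => List.mem_append_right _ (h3 D hD)⟩

theorem Layered.occ_ctx {r : List B} {G : PreTensor S E B} (hG : G.Layered anc r)
    (hr : UpClosed anc r) :
    ∀ o ∈ G.occ, UpClosed anc (o.ectx ++ (o.nctx ++ r)) ∧
      o.ectx.Pairwise fun C D => D ∈ anc C := by
  induction G generalizing r with
  | one => simp [occ]
  | idt a b => simpa [occ] using hr
  | node φ e =>
    simp only [occ, List.mem_map]
    rintro _ ⟨p, hp, rfl⟩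
    exact hG p hp
  | box G A ih =>
    simp only [occ, List.mem_map]
    rintro _ ⟨o, ho, rfl⟩
    simpa using ih hG.2.2.2 hG.1 o ho
  | prod G H ihG ihH =>
    intro o ho
    rcases List.mem_append.1 ho with h | h
    exacts [ihG hG.1 hr o h, ihH hG.2 hr o h]

/-- The !-boxes met inside a !-box `A` are proper, different from `A`, and not around `A`. -/
theorem Layered.inner {A : B} {r : List B} {G : PreTensor S E B}
    (hG : (G.box A).Layered anc r) (hM : ∀ C ∈ (G.box A).boxNames, C ∈ M) (hr : ∀ C ∈ r, C ∈ M) :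
    (∀ C ∈ G.boxes, Proper anc M C ∧ C ≠ A ∧ C ∉ anc A ∧ A ∈ anc C) ∧
    (∀ o ∈ G.occ, ∀ C ∈ o.ectx, Proper anc M C ∧ C ≠ A ∧ C ∉ anc A ∧
      (C ∈ G.boxes ↔ A ∈ anc C)) := by
  have hA : A ∈ M := hM A (by simp [boxNames])
  have hGM : ∀ C ∈ G.boxNames, C ∈ M := fun C hC => hM C (by simp [boxNames, hC])
  have hb : ∀ C ∈ G.boxes, Proper anc M C ∧ C ≠ A ∧ C ∉ anc A ∧ A ∈ anc C := by
    intro C hC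
    obtain ⟨s, h1, h2, h3⟩ := hG.2.2.2.box_ctx C hC
    have hi := UpClosed.inner (l := C :: s) h1 (by simp : C ∈ C :: s)
    refine ⟨h1.proper ?_ C (by simp), hi.1, hi.2.1, h2 A (by simp)⟩
    intro D hD
    simp only [List.cons_append, List.mem_cons, List.mem_append] at hD
    rcases hD with rfl | h | rfl | h
    exacts [hGM _ (boxes_subset_boxNames _ hC), hGM _ (boxes_subset_boxNames _ (h3 D h)), hA, hr D h]
  refine ⟨hb, fun o ho C hC => ?_⟩
  have h1 := (hG.2.2.2.occ_ctx hG.1 o ho).1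
  have hi := UpClosed.inner (l := o.ectx ++ o.nctx) (by simpa using h1) (by simp [hC] : C ∈ _)
  refine ⟨h1.proper ?_ C (by simp [hC]), hi.1, hi.2.1, fun h => (hb C h).2.2.2, hG.2.2.1 o ho C hC⟩
  intro D hD
  simp only [List.mem_append, List.mem_cons] at hD
  rcases hD with h | h | rfl | h
  exacts [hGM _ (ectx_subset_boxNames o ho D h),
    hGM _ (boxes_subset_boxNames _ (nctx_subset_boxes o ho D h)), hA, hr D h]

end PreTensor
end Layered

/-! ### Operations and unrolling -/

section Operations

variable {S E B : Type*} [DecidableEq B] {anc : B → Set B} {M : Set B} {A : B} {n n' : Count B}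
  {h : E × Env B → E × Env B} {Q : Env B → Prop} {c k : EdgeTerm E B → EdgeTerm E B}
  {t : PreTensor S E B → PreTensor S E B}

/-- Unrolling with counts `n` and `n'` goes the same way outside of the !-box `A`, in the
environments that satisfy `Q`. -/
structure AgreeOutside (anc : B → Set B) (M : Set B) (A : B) (n n' : Count B)
    (h : E × Env B → E × Env B) (Q : Env B → Prop) : Prop where
  name : ∀ a ρ, Q ρ → h (a, ρ) = (a, ρ)
  count : ∀ C, Proper anc M C → C ≠ A → A ∉ anc C → ∀ ρ, Q ρ → n' C ρ = n C ρ
  inv : ∀ C, Proper anc M C → C ≠ A → A ∉ anc C → ∀ ρ, Q ρ → ∀ i, i < n C ρ →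
    Q (Function.update ρ C (i + 1))

/-- The requirements on an edgeterm inside the !-boxes `r`. -/
def EdgeTerm.Layered (anc : B → Set B) (M : Set B) (r : List B) (e : EdgeTerm E B) : Prop :=
  ∀ p ∈ e.occ, UpClosed anc (p.2 ++ r) ∧ (p.2.Pairwise fun C D => D ∈ anc C) ∧
    ∀ C ∈ p.2 ++ r, C ∈ M

/-- To unroll the result of an operation on `A`, it is enough to know how to unroll it at the edge
groups of `A`. -/
theorem EdgeTerm.unroll_op (ho : AgreeOutside anc M A n n' h Q)
    (hc0 : ∀ e, e.occ = [] → (c e).occ = []) (hk0 : ∀ e, e.occ = [] → (k e).occ = [])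
    (hc : ∀ e r ρ, e.occ ≠ [] → (clock e A).Layered anc M r → Q ρ →
      (c e).unroll n' ρ = ((clock e A).unroll n ρ).map (DirEdge.rename h))
    (hk : ∀ e r ρ, e.occ ≠ [] → (anti e A).Layered anc M r → Q ρ →
      (k e).unroll n' ρ = ((anti e A).unroll n ρ).map (DirEdge.rename h))
    (e : EdgeTerm E B) (r : List B) (hA : A ∉ r) (he : e.Layered anc M r) (ρ : Env B)
    (hρ : Q ρ) :
    (e.op A c k).unroll n' ρ = (e.unroll n ρ).map (DirEdge.rename h) := by
  have op0 : ∀ e : EdgeTerm E B, e.occ = [] → (e.op A c k).occ = [] := by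
    intro e he
    induction e with
    | eps => rfl
    | edge d => simp [occ] at he
    | clock e C ih =>
      have h0 : e.occ = [] := by simpa [occ] using he
      by_cases hC : C = A
      · simp [op, hC, hc0 e h0]
      · simp [op, hC, occ, ih h0]
    | anti e C ih =>
      have h0 : e.occ = [] := by simpa [occ] using he
      by_cases hC : C = A
      · simp [op, hC, hk0 e h0]
      · simp [op, hC, occ, ih h0]
    | cat e f ihe ihf => simp [occ] at he; simp [op, occ, ihe he.1, ihf he.2]
  have triv : ∀ (e : EdgeTerm E B) ρ, e.occ = [] →
      (e.op A c k).unroll n' ρ = (e.unroll n ρ).map (DirEdge.rename h) := by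
    intro e ρ h0
    rw [unroll_of_occ_eq_nil _ _ h0, unroll_of_occ_eq_nil _ _ (op0 e h0)]; rfl
  have group : ∀ (e : EdgeTerm E B) (C : B) r, A ∉ r → ∀ ρ, Q ρ → C ≠ A → e.occ ≠ [] →
      (∀ r, A ∉ r → e.Layered anc M r → ∀ ρ, Q ρ →
        (e.op A c k).unroll n' ρ = (e.unroll n ρ).map (DirEdge.rename h)) →
      (clock e C).Layered anc M r →
      (∀ i < n C ρ, (e.op A c k).unroll n' (Function.update ρ C (i + 1)) =
        (e.unroll n (Function.update ρ C (i + 1))).map (DirEdge.rename h)) ∧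
      n' C ρ = n C ρ := by
    intro e C r hA ρ hρ hC h0 ih he
    have he' : ∀ p ∈ e.occ, UpClosed anc (p.2 ++ (C :: r)) ∧
        (p.2.Pairwise fun C D => D ∈ anc C) ∧ ∀ D ∈ p.2 ++ (C :: r), D ∈ M := by
      intro p hp
      have := he (p.1, p.2 ++ [C]) (List.mem_map.2 ⟨p, hp, rfl⟩)
      exact ⟨by simpa using this.1, (List.pairwise_append.1 this.2.1).1, by simpa using this.2.2⟩
    obtain ⟨p, hp⟩ := List.exists_mem_of_ne_nil _ h0
    have hp := he' p hp
    have hCP : Proper anc M C := hp.1.proper hp.2.2 C (by simp)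
    have hAC : A ∉ anc C := fun h => hA (hp.1.of_append.2.1 A h).1
    refine ⟨fun i hi => ih (C :: r) ?_ he' _ (ho.inv C hCP hC hAC ρ hρ i hi),
      ho.count C hCP hC hAC ρ hρ⟩
    simp [hA, hC.symm]
  induction e generalizing r ρ with
  | eps => rfl
  | edge d => cases d <;> simp [unroll, op, ho.name _ _ hρ]
  | clock e C ih =>
    by_cases h0 : e.occ = []
    · exact triv _ _ (by simp [occ, h0])
    by_cases hC : C = A
    · subst hC; simpa [op] using hc e r ρ h0 he hρ
    · obtain ⟨h1, h2⟩ := group e C r hA ρ hρ hC h0 ih he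
      simp only [op, if_neg hC, unroll, h2, List.map_flatMap]
      exact List.flatMap_congr fun i hi => h1 i (by simpa using hi)
  | anti e C ih =>
    by_cases h0 : e.occ = []
    · exact triv _ _ (by simp [occ, h0])
    by_cases hC : C = A
    · subst hC; simpa [op] using hk e r ρ h0 he hρ
    · obtain ⟨h1, h2⟩ := group e C r hA ρ hρ hC h0 ih he
      simp only [op, if_neg hC, unroll, h2, List.map_flatMap]
      exact List.flatMap_congr fun i hi => h1 i (by simpa using hi)
  | cat e f ihe ihf =>
    simp only [op, unroll, List.map_append]
    rw [ihe r hA (fun p hp => he p (by simp [occ, hp])) ρ hρ,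
      ihf r hA (fun p hp => he p (by simp [occ, hp])) ρ hρ]

theorem PreTensor.unroll_op (ho : AgreeOutside anc M A n n' h Q)
    (hc0 : ∀ e, e.occ = [] → (c e).occ = []) (hk0 : ∀ e, e.occ = [] → (k e).occ = [])
    (hc : ∀ e r ρ, e.occ ≠ [] → (EdgeTerm.clock e A).Layered anc M r → Q ρ →
      (c e).unroll n' ρ = ((EdgeTerm.clock e A).unroll n ρ).map (DirEdge.rename h))
    (hk : ∀ e r ρ, e.occ ≠ [] → (EdgeTerm.anti e A).Layered anc M r → Q ρ →
      (k e).unroll n' ρ = ((EdgeTerm.anti e A).unroll n ρ).map (DirEdge.rename h))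
    (ht : ∀ G r ρ, (box G A).Layered anc r → (∀ C ∈ (box G A).boxNames, C ∈ M) →
      (∀ C ∈ r, C ∈ M) → Q ρ → (t G).unroll n' ρ = ((box G A).unroll n ρ).rename h)
    (G : PreTensor S E B) (r : List B) (hA : A ∉ r) (hr : ∀ C ∈ r, C ∈ M)
    (hG : G.Layered anc r) (hM : ∀ C ∈ G.boxNames, C ∈ M) (ρ : Env B) (hρ : Q ρ) :
    (G.op A c k t).unroll n' ρ = (G.unroll n ρ).rename h := by
  induction G generalizing r ρ with
  | one => rfl
  | idt a b => simp [unroll, op, Net.rename, Factor.rename, ho.name _ _ hρ]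
  | node φ e =>
    simp only [unroll, op, Net.rename, Factor.rename, Multiset.map_singleton]
    rw [EdgeTerm.unroll_op ho hc0 hk0 hc hk e r hA _ ρ hρ]
    intro p hp
    refine ⟨(hG p hp).1, (hG p hp).2, fun C hC => ?_⟩
    rcases List.mem_append.1 hC with h | h
    exacts [hM C (EdgeTerm.occ_subset_boxNames p hp C h), hr C h]
  | box G C ih =>
    by_cases hC : C = A
    · subst hC; simpa [op] using ht G r ρ hG hM hr hρ
    · have hCM : C ∈ M := hM C (by simp [boxNames])
      have hr' : ∀ D ∈ C :: r, D ∈ M := by simpa [hCM] using hr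
      have hCP : Proper anc M C := hG.1.proper hr' C (by simp)
      have hAC : A ∉ anc C := fun h => hA (hG.1.2.1 A h).1
      simp only [op, if_neg hC, unroll, Net.rename_sum, ho.count C hCP hC hAC ρ hρ]
      refine Finset.sum_congr rfl fun i hi => ih (C :: r) (by simp [hA, Ne.symm hC]) hr' hG.2.2.2
        (fun D hD => hM D (by simp [boxNames, hD])) _
        (ho.inv C hCP hC hAC ρ hρ i (by simpa using hi))
  | prod G H ihG ihH =>
    simp only [op, unroll, Net.rename_add]
    rw [ihG r hA hr hG.1 (fun C hC => hM C (by simp [boxNames, hC])) ρ hρ,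
      ihH r hA hr hG.2 (fun C hC => hM C (by simp [boxNames, hC])) ρ hρ]

/-! ### Killing a !-box -/

theorem EdgeTerm.unroll_kill (hn : ∀ ρ, n A ρ = 0) (e : EdgeTerm E B) (ρ : Env B) :
    (e.op A (fun _ => .eps) (fun _ => .eps)).unroll n ρ = e.unroll n ρ := by
  induction e generalizing ρ with
  | eps => rfl
  | edge d => rfl
  | clock e C ih => by_cases hC : C = A <;> simp [op, unroll, hC, hn, ih]
  | anti e C ih => by_cases hC : C = A <;> simp [op, unroll, hC, hn, ih]
  | cat e f ihe ihf => simp [op, unroll, ihe, ihf]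

theorem PreTensor.unroll_kill (hn : ∀ ρ, n A ρ = 0) (G : PreTensor S E B) (ρ : Env B) :
    (G.kill A).unroll n ρ = G.unroll n ρ := by
  unfold kill
  induction G generalizing ρ with
  | one => rfl
  | idt a b => rfl
  | node φ e => simp [op, unroll, EdgeTerm.unroll_kill hn]
  | box G C ih => by_cases hC : C = A <;> simp [op, unroll, hC, hn, ih]
  | prod G H ihG ihH => simp [op, unroll, ihG, ihH]

end Operations

/-! ### Dropping a !-box -/

section Drop

variable {S E B : Type*} [DecidableEq B] {anc : B → Set B} {M : Set B} {A : B} {n n' : Count B}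

/-- The counts `n` for an expression give one copy of `A`, and otherwise correspond to the counts
`n'` for the expression without the !-box `A`. -/
structure DropCount (anc : B → Set B) (M : Set B) (A : B) (n n' : Count B) : Prop where
  one : ∀ ρ, n A ρ = 1
  outside : ∀ C, Proper anc M C → C ≠ A → A ∉ anc C → ∀ ρ, n' C ρ = n C ρ
  inside : ∀ C, C ≠ A → ∀ ρ, ρ A = 1 → n' C (Function.update ρ A 0) = n C ρ

/-- Forget that an edge lies in a copy of `A`. -/
def dropName (A : B) (x : E × Env B) : E × Env B := (x.1, Function.update x.2 A 0)

theorem DropCount.simulates (hn : DropCount anc M A n n') :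
    Simulates (E := E) n n' id id (fun ρ => Function.update ρ A 0) (dropName A)
      (fun ρ => ρ A = 1) (fun C => C ≠ A) where
  name a ρ _ := rfl
  count C hC ρ hρ := hn.inside C hC ρ hρ
  inv C hC ρ hρ i _ := by simpa [Function.update_of_ne hC.symm] using hρ
  update C hC ρ _ i _ := (Function.update_comm hC.symm _ _ _).symm

theorem DropCount.agreeOutside (hn : DropCount anc M A n n') :
    AgreeOutside (E := E) anc M A n n' (dropName A) (fun ρ => ρ A = 0) where
  name a ρ hρ := by simp [dropName, ← hρ]
  count C hC hCA hAC ρ _ := hn.outside C hC hCA hAC ρ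
  inv C hC hCA _ ρ hρ i _ := by simpa [Function.update_of_ne hCA.symm] using hρ

omit [DecidableEq B] in
theorem EdgeTerm.Layered.ne {e : EdgeTerm E B} {r : List B}
    (he : ∀ p ∈ e.occ, UpClosed anc (p.2 ++ A :: r)) : ∀ p ∈ e.occ, ∀ C ∈ p.2, C ≠ A :=
  fun p hp _ hC => ((he p hp).inner hC).1

/-- Dropping `A` is unrolling with one copy of `A`. -/
theorem PreTensor.unroll_drop (hn : DropCount anc M A n n') (G : PreTensor S E B)
    (hG : G.Layered anc []) (hM : ∀ C ∈ G.boxNames, C ∈ M) :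
    (G.drop A).unroll n' 0 = (G.unroll n 0).rename (dropName A) := by
  have group : ∀ (e : EdgeTerm E B) r (ρ : Env B), (EdgeTerm.clock e A).Layered anc M r → ρ A = 0 →
      e.unroll n' ρ = (e.unroll n (Function.update ρ A 1)).map (DirEdge.rename (dropName A)) := by
    intro e r ρ he hρ
    have := EdgeTerm.unroll_map (hn.simulates (E := E)) e (EdgeTerm.Layered.ne (r := r)
      fun p hp => by
        simpa using (he (p.1, p.2 ++ [A]) (List.mem_map.2 ⟨p, hp, rfl⟩)).1)
      (Function.update ρ A 1) (by simp)
    rw [← this, EdgeTerm.map_id]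
    simp [← hρ]
  refine unroll_op hn.agreeOutside (by simp) (by simp) ?_ ?_ ?_ G [] (by simp) (by simp) hG hM 0 rfl
  · intro e r ρ _ he hρ
    simpa [EdgeTerm.unroll, hn.one] using group e r ρ he hρ
  · intro e r ρ _ he hρ
    simpa [EdgeTerm.unroll, hn.one] using group e r ρ he hρ
  · intro G r ρ hG hM hr hρ
    have hi := hG.inner hM hr
    have := PreTensor.unroll_map (hn.simulates (E := E)) G (fun C hC => (hi.1 C hC).2.1)
      (fun o ho C hC => (hi.2 o ho C hC).2.1) (Function.update ρ A 1) (by simp)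
    simp only [unroll, hn.one, Finset.range_one, Finset.sum_singleton, zero_add]
    rw [← this, PreTensor.map_id]
    simp [← hρ]

end Drop

/-! ### Copying a !-box -/

section Copy

variable {S E B : Type*} [DecidableEq B] {anc : B → Set B} {M : Set B} {A : B} {n n' : Count B}
  {fr : Fr E B}

open Classical in
/-- The name of a !-box in the fresh copy of `A`: `A` and the !-boxes inside `A` are renamed. -/
noncomputable def copyName (anc : B → Set B) (A : B) (f : Equiv.Perm B) (C : B) : B :=
  if C = A ∨ A ∈ anc C then f C else C

open Classical in
/-- Translate an environment inside a late copy of `A` in an expression to an environment inside a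
copy of the fresh copy of `A` in the copied expression. The set `M` contains the names in use, so that
a name outside of `M` can only be the fresh name of its preimage under `f`. -/
noncomputable def copyEnv (anc : B → Set B) (M : Set B) (A : B) (f : Equiv.Perm B) (n' : Count B)
    (ρ : Env B) : Env B := fun X =>
  if X ∈ M then if X = A ∨ A ∈ anc X then 0 else ρ X
  else if f.symm X = A then ρ A - n' A ρ else if A ∈ anc (f.symm X) then ρ (f.symm X) else 0

/-- The edge of the copied expression that corresponds to a copy of an edge: the first `n' A` copies
of `A` stem from `A`, the others from its fresh copy. -/
noncomputable def copyEdge (anc : B → Set B) (M : Set B) (A : B) (fr : Fr E B) (n' : Count B)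
    (x : E × Env B) : E × Env B :=
  if x.2 A ≤ n' A x.2 then x else (fr.edge x.1, copyEnv anc M A fr.box n' x.2)

open Classical in
/-- The ancestors of the !-boxes in the copied expression. -/
noncomputable def copyAnc (anc : B → Set B) (M : Set B) (A : B) (f : Equiv.Perm B) (X : B) :
    Set B :=
  if X ∈ M then anc X
  else if f.symm X = A ∨ A ∈ anc (f.symm X) then copyName anc A f '' anc (f.symm X) else ∅

/-- The counts `n` for an expression correspond to the counts `n'` for the expression in which `A`
is copied. -/
structure CopyCount (anc : B → Set B) (M : Set B) (A : B) (f : Equiv.Perm B) (n n' : Count B) :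
    Prop where
  base : Proper anc M A → ∀ ρ, n A ρ = n' A ρ + n' (f A) ρ
  outside : ∀ C, Proper anc M C → C ≠ A → A ∉ anc C → ∀ ρ, n C ρ = n' C ρ
  old : ∀ C, Proper anc M C → A ∈ anc C → ∀ ρ, ρ A ≤ n' A ρ → n C ρ = n' C ρ
  new : ∀ C, Proper anc M C → A ∈ anc C → ∀ ρ, n' A ρ < ρ A →
    n C ρ = n' (f C) (copyEnv anc M A f n' ρ)

variable {f : Equiv.Perm B} (hf : ∀ C ∈ M, f C ∉ M)

theorem copyAnc_of_mem {C : B} (hC : C ∈ M) : copyAnc anc M A f C = anc C := by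
  simp [copyAnc, hC]

include hf in
theorem copyAnc_fresh {C : B} (hC : C ∈ M) (hA : C = A ∨ A ∈ anc C) :
    copyAnc anc M A f (f C) = copyName anc A f '' anc C := by
  simp [copyAnc, hf C hC, hA]

omit [DecidableEq B] in
/-- Ancestors of a proper !-box outside of `A` are outside of `A`. -/
theorem Proper.outside {C D : B} (hC : Proper anc M C) (hAC : A ∉ anc C) (hD : D ∈ anc C) :
    D ≠ A ∧ A ∉ anc D :=
  ⟨fun h => hAC (h ▸ hD), fun h => hAC ((hC.2.2 D hD).2 h)⟩

theorem copyEnv_outside {C : B} (hC : C ∈ M) (h1 : C ≠ A) (h2 : A ∉ anc C) (ρ : Env B) :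
    copyEnv anc M A f n' ρ C = ρ C := by
  simp [copyEnv, hC, h1, h2]

include hf in
theorem copyEnv_inside {C : B} (hC : C ∈ M) (h1 : C ≠ A) (h2 : A ∈ anc C) (ρ : Env B) :
    copyEnv anc M A f n' ρ (f C) = ρ C := by
  simp [copyEnv, hf C hC, h1, h2]

include hf in
theorem copyEnv_self (hA : A ∈ M) (ρ : Env B) :
    copyEnv anc M A f n' ρ (f A) = ρ A - n' A ρ := by
  simp [copyEnv, hf A hA]

theorem Count.Local.update {n : Count B} (hn : n.Local anc) {A C : B} (hC : C ∉ anc A) (ρ : Env B)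
    (i : ℕ) : n A (Function.update ρ C i) = n A ρ :=
  hn _ _ _ fun _ hD => Function.update_of_ne (by rintro rfl; exact hC hD) _ _

theorem Count.Local.copy {n' : Count B} (hn' : n'.Local (copyAnc anc M A f)) {C D : B}
    (hC : C ∈ M) (hD : D ∉ anc C) (ρ : Env B) (i : ℕ) :
    n' C (Function.update ρ D i) = n' C ρ :=
  hn'.update (by rwa [copyAnc_of_mem hC]) ρ i

include hf in
theorem copyEnv_update (hn' : n'.Local (copyAnc anc M A f)) (hA : A ∈ M) {C : B} (hC : C ∈ M)
    (hCA : C ≠ A) (hCA' : C ∉ anc A) (ρ : Env B) (i : ℕ) :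
    copyEnv anc M A f n' (Function.update ρ C i) =
      Function.update (copyEnv anc M A f n' ρ) (copyName anc A f C) i := by
  have h1 : n' A (Function.update ρ C i) = n' A ρ := hn'.copy hA hCA' ρ i
  funext X
  by_cases hAC : A ∈ anc C
  · have hg : copyName anc A f C = f C := by simp [copyName, hAC]
    rw [hg]
    by_cases hX : X ∈ M
    · have hXC : X ≠ f C := fun h => hf C hC (h ▸ hX)
      rw [Function.update_of_ne hXC]
      by_cases h2 : X = A ∨ A ∈ anc X
      · simp [copyEnv, hX, h2]
      · have : X ≠ C := by rintro rfl; exact h2 (.inr hAC)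
        simp [copyEnv, hX, h2, Function.update_of_ne this]
    · by_cases hXC : X = f C
      · subst hXC; simp [copyEnv, hX, hCA, hAC]
      · have : f.symm X ≠ C := by rintro rfl; simp at hXC
        simp [copyEnv, hX, h1, Function.update_of_ne this, Function.update_of_ne hCA.symm,
          Function.update_of_ne hXC]
  · have hg : copyName anc A f C = C := by simp [copyName, hAC, hCA]
    rw [hg]
    by_cases hXC : X = C
    · subst hXC; simp [copyEnv, hC, hCA, hAC]
    · rw [Function.update_of_ne hXC]
      by_cases h2 : A ∈ anc (f.symm X)
      · have : f.symm X ≠ C := by rintro rfl; exact hAC h2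
        simp [copyEnv, h1, Function.update_of_ne hXC, Function.update_of_ne this,
          Function.update_of_ne hCA.symm]
      · simp [copyEnv, h1, Function.update_of_ne hXC, h2, Function.update_of_ne hCA.symm]

/-- The environments met before a copy of `A` is entered. -/
def OutsideEnv (anc : B → Set B) (M : Set B) (A : B) (ρ : Env B) : Prop :=
  ∀ X, X ∉ M ∨ X = A ∨ A ∈ anc X → ρ X = 0

include hf in
theorem OutsideEnv.copyEnv_start (hn' : n'.Local (copyAnc anc M A f)) (hA : Proper anc M A)
    {ρ : Env B} (hρ : OutsideEnv anc M A ρ) (j : ℕ) :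
    copyEnv anc M A f n' (Function.update ρ A (n' A ρ + j + 1)) =
      Function.update ρ (f A) (j + 1) := by
  have h1 : ∀ i, n' A (Function.update ρ A i) = n' A ρ := fun i => hn'.copy hA.1 hA.2.1 ρ i
  funext X
  by_cases hX : X ∈ M
  · have hXA : X ≠ f A := fun h => hf A hA.1 (h ▸ hX)
    rw [Function.update_of_ne hXA]
    by_cases h2 : X = A ∨ A ∈ anc X
    · simp [copyEnv, hX, h2, hρ X (.inr h2)]
    · have : X ≠ A := fun h => h2 (.inl h)
      simp [copyEnv, hX, h2, Function.update_of_ne this]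
  · by_cases hXA : X = f A
    · subst hXA; simp [copyEnv, hX, h1]; omega
    · have h3 : f.symm X ≠ A := by rintro rfl; simp at hXA
      rw [Function.update_of_ne hXA, hρ X (.inl hX)]
      by_cases h4 : A ∈ anc (f.symm X)
      · simp [copyEnv, hX, h3, h4, hρ _ (.inr (.inr h4))]
      · simp [copyEnv, hX, h3, h4]

theorem CopyCount.simulates_old (hn : CopyCount anc M A fr.box n n')
    (hn' : n'.Local (copyAnc anc M A fr.box)) (hA : A ∈ M) :
    Simulates n n' id id id (copyEdge anc M A fr n') (fun ρ => ρ A ≤ n' A ρ)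
      (fun C => Proper anc M C ∧ C ≠ A ∧ C ∉ anc A) where
  name a ρ hρ := by simp [copyEdge, hρ]
  count C hC ρ hρ := by
    by_cases hAC : A ∈ anc C
    · exact (hn.old C hC.1 hAC ρ hρ).symm
    · exact (hn.outside C hC.1 hC.2.1 hAC ρ).symm
  inv C hC ρ hρ i _ := by
    rw [hn'.copy hA hC.2.2, Function.update_of_ne hC.2.1.symm]; exact hρ
  update C hC ρ _ i _ := rfl

theorem CopyCount.simulates_new (hfr : ∀ C ∈ M, fr.box C ∉ M) (hn : CopyCount anc M A fr.box n n')
    (hn' : n'.Local (copyAnc anc M A fr.box)) (hA : A ∈ M) (g : B → B) :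
    Simulates n n' fr.edge g (copyEnv anc M A fr.box n') (copyEdge anc M A fr n')
      (fun ρ => n' A ρ < ρ A)
      (fun C => (Proper anc M C ∧ C ≠ A ∧ C ∉ anc A) ∧ g C = copyName anc A fr.box C) where
  name a ρ hρ := by simp [copyEdge, hρ]
  count C hC ρ hρ := by
    obtain ⟨hC, hg⟩ := hC
    by_cases hAC : A ∈ anc C
    · rw [hn.new C hC.1 hAC ρ hρ, hg]; simp [copyName, hAC]
    · rw [hn.outside C hC.1 hC.2.1 hAC ρ, hg]
      simp only [copyName, hC.2.1, hAC, or_false, if_false]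
      refine hn' _ _ _ fun D hD => ?_
      rw [copyAnc_of_mem hC.1.1] at hD
      have := hC.1.outside hAC hD
      exact copyEnv_outside (hC.1.2.2 D hD).1 this.1 this.2 ρ
  inv C hC ρ hρ i _ := by
    rw [hn'.copy hA hC.1.2.2, Function.update_of_ne hC.1.2.1.symm]; exact hρ
  update C hC ρ _ i _ := by
    rw [hC.2]; exact copyEnv_update hfr hn' hA hC.1.1.1 hC.1.2.1 hC.1.2.2 ρ _

theorem CopyCount.agreeOutside (hn : CopyCount anc M A fr.box n n') :
    AgreeOutside anc M A n n' (copyEdge anc M A fr n') (OutsideEnv anc M A) where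
  name a ρ hρ := by simp [copyEdge, hρ A (.inr (.inl rfl))]
  count C hC hCA hAC ρ _ := (hn.outside C hC hCA hAC ρ).symm
  inv C hC hCA hAC ρ hρ i _ X hX := by
    rw [Function.update_of_ne]
    · exact hρ X hX
    · rintro rfl
      rcases hX with h | h | h
      exacts [h hC.1, hCA h, hAC h]

/-- Copying `A` splits the copies of `A`: the first `n' A` of them come from the old !-box, the
others from its fresh copy. -/
theorem PreTensor.unroll_copy (hfr : ∀ C ∈ M, fr.box C ∉ M) (hn : CopyCount anc M A fr.box n n')
    (hn' : n'.Local (copyAnc anc M A fr.box)) (G : PreTensor S E B)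
    (hG : G.Layered anc []) (hM : ∀ C ∈ G.boxNames, C ∈ M) :
    (G.copy A fr).unroll n' 0 = (G.unroll n 0).rename (copyEdge anc M A fr n') := by
  have group : ∀ (e : EdgeTerm E B) r (ρ : Env B), e.occ ≠ [] →
      (EdgeTerm.clock e A).Layered anc M r → OutsideEnv anc M A ρ → Proper anc M A ∧
      (∀ i < n' A ρ, e.unroll n' (Function.update ρ A (i + 1)) =
        (e.unroll n (Function.update ρ A (i + 1))).map
          (DirEdge.rename (copyEdge anc M A fr n'))) ∧
      (∀ j, (e.map fr.edge fr.box).unroll n' (Function.update ρ (fr.box A) (j + 1)) =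
        (e.unroll n (Function.update ρ A (n' A ρ + j + 1))).map
          (DirEdge.rename (copyEdge anc M A fr n'))) := by
    intro e r ρ h0 he hρ
    have he' : ∀ p ∈ e.occ, UpClosed anc (p.2 ++ A :: r) ∧ (∀ C ∈ p.2, A ∈ anc C) ∧
        ∀ C ∈ p.2 ++ A :: r, C ∈ M := by
      intro p hp
      have := he (p.1, p.2 ++ [A]) (List.mem_map.2 ⟨p, hp, rfl⟩)
      refine ⟨by simpa using this.1, fun C hC => ?_, by simpa using this.2.2⟩
      exact (List.pairwise_append.1 this.2.1).2.2 C hC A (by simp)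
    obtain ⟨p, hp⟩ := List.exists_mem_of_ne_nil _ h0
    have hA : Proper anc M A := (he' p hp).1.proper (he' p hp).2.2 A (by simp)
    have hK : ∀ p ∈ e.occ, ∀ C ∈ p.2, Proper anc M C ∧ C ≠ A ∧ C ∉ anc A := fun p hp C hC =>
      ⟨(he' p hp).1.proper (he' p hp).2.2 C (by simp [hC]), ((he' p hp).1.inner hC).1,
        ((he' p hp).1.inner hC).2.1⟩
    refine ⟨hA, fun i hi => ?_, fun j => ?_⟩
    · have := EdgeTerm.unroll_map (hn.simulates_old hn' hA.1) e hK (Function.update ρ A (i + 1))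
        (by rw [hn'.copy hA.1 hA.2.1]; simp; omega)
      rwa [EdgeTerm.map_id] at this
    · rw [← hρ.copyEnv_start hfr hn' hA j]
      refine EdgeTerm.unroll_map (hn.simulates_new hfr hn' hA.1 fr.box) e (fun p hp C hC =>
        ⟨hK p hp C hC, ?_⟩) _ (by rw [hn'.copy hA.1 hA.2.1, Function.update_self]; omega)
      simp [copyName, (he' p hp).2.1 C hC]
  refine unroll_op hn.agreeOutside (fun e he => ?_) (fun e he => ?_) ?_ ?_ ?_ G [] (by simp)
    (by simp) hG hM 0 (fun _ _ => rfl)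
  · simp [EdgeTerm.occ, EdgeTerm.occ_map, he]
  · simp [EdgeTerm.occ, EdgeTerm.occ_map, he]
  · intro e r ρ h0 he hρ
    obtain ⟨hA, h1, h2⟩ := group e r ρ h0 he hρ
    simp only [EdgeTerm.unroll, hn.base hA, List.range_add, List.flatMap_append, List.map_append,
      List.map_flatMap, List.flatMap_map]
    congr 1
    · exact List.flatMap_congr fun i hi => h1 i (by simpa using hi)
    · exact List.flatMap_congr fun j _ => h2 j
  · intro e r ρ h0 he hρ
    obtain ⟨hA, h1, h2⟩ := group e r ρ h0 he hρ
    simp only [EdgeTerm.unroll, hn.base hA, List.range_add, List.flatMap_append, List.map_append,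
      List.map_flatMap, List.flatMap_map, List.reverse_append, ← List.map_reverse]
    congr 1
    · exact List.flatMap_congr fun j _ => h2 j
    · exact List.flatMap_congr fun i hi => h1 i (by simpa using hi)
  · intro G r ρ hG hM hr hρ
    have hi := hG.inner hM hr
    have hA : Proper anc M A := hG.1.proper
      (by simpa [hM A (by simp [boxNames])] using hr) A (by simp)
    simp only [unroll, hn.base hA, Finset.sum_range_add, Net.rename_add, Net.rename_sum]
    congr 1
    · refine Finset.sum_congr rfl fun i hi' => ?_
      have := PreTensor.unroll_map (hn.simulates_old hn' hA.1) G
        (fun C hC => ⟨(hi.1 C hC).1, (hi.1 C hC).2.1, (hi.1 C hC).2.2.1⟩)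
        (fun o ho C hC => ⟨(hi.2 o ho C hC).1, (hi.2 o ho C hC).2.1, (hi.2 o ho C hC).2.2.1⟩)
        (Function.update ρ A (i + 1))
        (by rw [hn'.copy hA.1 hA.2.1]; simp at hi' ⊢; omega)
      rwa [PreTensor.map_id] at this
    · refine Finset.sum_congr rfl fun j _ => ?_
      rw [← hρ.copyEnv_start hfr hn' hA j]
      refine PreTensor.unroll_map (hn.simulates_new hfr hn' hA.1
        (fun C => if C ∈ G.boxes then fr.box C else C)) G (fun C hC => ?_) (fun o ho C hC => ?_) _
        (by rw [hn'.copy hA.1 hA.2.1, Function.update_self]; omega)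
      · have := hi.1 C hC
        exact ⟨⟨this.1, this.2.1, this.2.2.1⟩, by simp [copyName, hC, this.2.2.2]⟩
      · have := hi.2 o ho C hC
        refine ⟨⟨this.1, this.2.1, this.2.2.1⟩, ?_⟩
        by_cases hAC : A ∈ anc C <;> simp [copyName, this.2.2.2, this.2.1, hAC]

end Copy

/-! ### Operations preserve layering -/

section KillLayered

variable {S E B : Type*} [DecidableEq B] {anc : B → Set B} {M : Set B} {A : B}

omit [DecidableEq B] in
theorem UpClosed.anc_mem {l : List B} (hl : UpClosed anc l) {X D : B} (hX : X ∈ l)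
    (hD : D ∈ anc X) : D ∈ l :=
  have h := hl.proper (M := {C | C ∈ l}) (fun _ h => h) X hX
  (h.2.2 D hD).1

theorem EdgeTerm.occ_kill (e : EdgeTerm E B) :
    ∀ p ∈ (e.op A (fun _ => .eps) (fun _ => .eps)).occ, p ∈ e.occ ∧ A ∉ p.2 := by
  induction e with
  | eps => simp [op, occ]
  | edge d => simp [op, occ]
  | clock e C ih =>
    by_cases hC : C = A
    · simp [op, hC, occ]
    · simp only [op, if_neg hC, occ, List.mem_map]
      rintro _ ⟨p, hp, rfl⟩
      exact ⟨⟨p, (ih p hp).1, rfl⟩, by simpa [Ne.symm hC] using (ih p hp).2⟩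
  | anti e C ih =>
    by_cases hC : C = A
    · simp [op, hC, occ]
    · simp only [op, if_neg hC, occ, List.mem_map]
      rintro _ ⟨p, hp, rfl⟩
      exact ⟨⟨p, (ih p hp).1, rfl⟩, by simpa [Ne.symm hC] using (ih p hp).2⟩
  | cat e f ihe ihf =>
    intro p hp
    rcases List.mem_append.1 hp with h | h
    exacts [⟨List.mem_append_left _ (ihe p h).1, (ihe p h).2⟩,
      ⟨List.mem_append_right _ (ihf p h).1, (ihf p h).2⟩]

theorem PreTensor.occ_kill (G : PreTensor S E B) :
    ∀ o ∈ (G.kill A).occ, o ∈ G.occ ∧ A ∉ o.ectx ∧ A ∉ o.nctx := by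
  unfold kill
  induction G with
  | one => simp [op, occ]
  | idt a b => simp [op, occ]
  | node φ e =>
    simp only [op, occ, List.mem_map]
    rintro _ ⟨p, hp, rfl⟩
    have := EdgeTerm.occ_kill e p hp
    exact ⟨⟨p, this.1, rfl⟩, this.2, by simp⟩
  | box G C ih =>
    by_cases hC : C = A
    · simp [op, hC, occ]
    · simp only [op, if_neg hC, occ, List.mem_map]
      rintro _ ⟨o, ho, rfl⟩
      have := ih o ho
      exact ⟨⟨o, this.1, rfl⟩, this.2.1, by simpa [Ne.symm hC] using this.2.2⟩
  | prod G H ihG ihH =>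
    intro o ho
    rcases List.mem_append.1 ho with h | h
    exacts [⟨List.mem_append_left _ (ihG o h).1, (ihG o h).2⟩,
      ⟨List.mem_append_right _ (ihH o h).1, (ihH o h).2⟩]

theorem PreTensor.boxes_kill {G : PreTensor S E B} {r : List B} (hG : G.Layered anc r) :
    ∀ X ∈ G.boxes, X ≠ A → A ∉ anc X → X ∈ (G.kill A).boxes := by
  unfold kill
  induction G generalizing r with
  | one => simp [boxes]
  | idt a b => simp [boxes]
  | node φ e => simp [boxes]
  | box G C ih =>
    intro X hX hXA hAX
    rcases List.mem_cons.1 hX with rfl | hX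
    · simp [op, hXA, boxes]
    · by_cases hC : C = A
      · subst hC
        obtain ⟨s, -, hs, -⟩ := hG.2.2.2.box_ctx X hX
        exact absurd (hs C (by simp)) hAX
      · simp only [op, if_neg hC, boxes]
        exact List.mem_cons_of_mem _ (ih hG.2.2.2 X hX hXA hAX)
  | prod G H ihG ihH =>
    intro X hX hXA hAX
    rcases List.mem_append.1 hX with h | h
    exacts [List.mem_append_left _ (ihG hG.1 X h hXA hAX),
      List.mem_append_right _ (ihH hG.2 X h hXA hAX)]

theorem PreTensor.Layered.kill {G : PreTensor S E B} {r : List B} (hG : G.Layered anc r)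
    (hA : A ∉ r) : (G.kill A).Layered anc r := by
  induction G generalizing r with
  | one => trivial
  | idt a b => trivial
  | node φ e => exact fun p hp => hG p (EdgeTerm.occ_kill e p hp).1
  | box G C ih =>
    by_cases hC : C = A
    · simp [PreTensor.kill, op, hC, Layered]
    · have hA' : A ∉ C :: r := by simp [hA, Ne.symm hC]
      have := ih hG.2.2.2 hA'
      simp only [PreTensor.kill, op, if_neg hC]
      refine ⟨hG.1, hG.2.1, fun o ho X hX hCX => ?_, this⟩
      obtain ⟨h1, h2, h3⟩ := occ_kill G o ho
      refine boxes_kill hG.2.2.2 X (hG.2.2.1 o h1 X hX hCX) (by rintro rfl; exact h2 hX) ?_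
      intro hAX
      have := (hG.2.2.2.occ_ctx hG.1 o h1).1.anc_mem (List.mem_append_left _ hX) hAX
      simp only [List.mem_append] at this
      tauto
  | prod G H ihG ihH => exact ⟨ihG hG.1 hA, ihH hG.2 hA⟩

end KillLayered

section DropLayered

variable {S E B : Type*} [DecidableEq B] {anc : B → Set B} {M : Set B} {A : B}

/-- The ancestors that are left when the !-box `A` is dropped. -/
def dropAnc (anc : B → Set B) (A : B) (C : B) : Set B := anc C \ {A}

theorem UpClosed.drop {l : List B} (hl : UpClosed anc l) :
    UpClosed (dropAnc anc A) (l.filter (· ≠ A)) := by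
  induction l with
  | nil => trivial
  | cons C l ih =>
    by_cases hC : C = A
    · simpa [hC] using ih hl.2.2
    · rw [List.filter_cons_of_pos (by simpa using hC)]
      refine ⟨fun h => hl.1 (List.mem_of_mem_filter h), fun D hD => ⟨?_, ?_⟩, ih hl.2.2⟩
      · exact List.mem_filter.2 ⟨(hl.2.1 D hD.1).1, by simpa using hD.2⟩
      · exact fun X hX => ⟨(hl.2.1 D hD.1).2 hX.1, hX.2⟩

theorem filter_ne_of_not_mem {l : List B} (hA : A ∉ l) : l.filter (· ≠ A) = l :=
  List.filter_eq_self.2 fun C hC => by simpa using fun h : C = A => hA (h ▸ hC)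

theorem EdgeTerm.occ_drop (e : EdgeTerm E B) (he : ∀ p ∈ e.occ, p.2.Nodup) :
    (e.op A (fun e => e) (fun e => e)).occ = e.occ.map fun p => (p.1, p.2.filter (· ≠ A)) := by
  have group : ∀ (e : EdgeTerm E B) (C : B), (∀ p ∈ (clock e C).occ, p.2.Nodup) →
      ((∀ p ∈ e.occ, p.2.Nodup) →
        (e.op A (fun e => e) (fun e => e)).occ =
          e.occ.map fun p => (p.1, p.2.filter (· ≠ A))) →
      ((clock e C).op A (fun e => e) (fun e => e)).occ =
        (clock e C).occ.map fun p => (p.1, p.2.filter (· ≠ A)) := by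
    intro e C he ih
    have he' : ∀ p ∈ e.occ, (p.2 ++ [C]).Nodup := fun p hp =>
      he (p.1, p.2 ++ [C]) (List.mem_map.2 ⟨p, hp, rfl⟩)
    by_cases hC : C = A
    · subst hC
      simp only [op, if_true, occ, List.map_map]
      conv_lhs => rw [← List.map_id e.occ]
      refine List.map_congr_left fun p hp => ?_
      have : C ∉ p.2 := fun h => (List.nodup_append.1 (he' p hp)).2.2 C h C (by simp) rfl
      simpa [List.filter_append] using congrArg (Prod.mk p.1) (filter_ne_of_not_mem this).symm
    · simp only [op, if_neg hC, occ, List.map_map,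
        ih fun p hp => (List.nodup_append.1 (he' p hp)).1]
      refine List.map_congr_left fun p hp => ?_
      simp [List.filter_append, hC]
  induction e with
  | eps => rfl
  | edge d => simp [op, occ]
  | clock e C ih => exact group e C he ih
  | anti e C ih =>
    have := group e C he ih
    simp only [op] at this ⊢
    split_ifs at this ⊢ <;> exact this
  | cat e f ihe ihf =>
    simp only [op, occ, List.map_append]
    rw [ihe fun p hp => he p (by simp [occ, hp]), ihf fun p hp => he p (by simp [occ, hp])]

theorem PreTensor.boxes_drop {G : PreTensor S E B} {r : List B} (hG : G.Layered anc r) :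
    (G.drop A).boxes = G.boxes.filter (· ≠ A) := by
  unfold PreTensor.drop
  induction G generalizing r with
  | one => rfl
  | idt a b => rfl
  | node φ e => rfl
  | box G C ih =>
    by_cases hC : C = A
    · subst hC
      simp only [op, if_true, boxes]
      rw [List.filter_cons_of_neg (by simp), filter_ne_of_not_mem]
      intro hb
      obtain ⟨s, h1, -, -⟩ := hG.2.2.2.box_ctx C hb
      exact h1.1 (by simp)
    · simp only [op, if_neg hC, boxes, ih hG.2.2.2]
      rw [List.filter_cons_of_pos (by simpa using hC)]
  | prod G H ihG ihH => simp [op, boxes, ihG hG.1, ihH hG.2]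

theorem PreTensor.occ_drop {G : PreTensor S E B} {r : List B} (hG : G.Layered anc r)
    (hr : UpClosed anc r) :
    (G.drop A).occ = G.occ.map fun o =>
      ⟨o.dir, o.ectx.filter (· ≠ A), o.nctx.filter (· ≠ A)⟩ := by
  unfold PreTensor.drop
  induction G generalizing r with
  | one => rfl
  | idt a b => rfl
  | node φ e =>
    simp only [op, occ]
    rw [EdgeTerm.occ_drop e fun p hp => (List.nodup_append.1 (hG p hp).1.nodup).1]
    simp
  | box G C ih =>
    by_cases hC : C = A
    · subst hC
      simp only [op, if_true, occ, List.map_map]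
      conv_lhs => rw [← List.map_id G.occ]
      refine List.map_congr_left fun o ho => ?_
      have h1 := (hG.2.2.2.occ_ctx hG.1 o ho).1.nodup
      rw [← List.append_assoc, List.nodup_append] at h1
      have h2 : C ∉ o.ectx ++ o.nctx := fun h => h1.2.2 C h C (by simp) rfl
      rw [List.mem_append, not_or] at h2
      have h3 := filter_ne_of_not_mem h2.1
      have h4 := filter_ne_of_not_mem h2.2
      simp only [ne_eq, decide_not] at h3 h4
      simp [List.filter_append, h3, h4]
    · simp only [op, if_neg hC, occ, ih hG.2.2.2 hG.1, List.map_map]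
      refine List.map_congr_left fun o _ => ?_
      simp [List.filter_append, hC]
  | prod G H ihG ihH => simp [op, occ, ihG hG.1 hr, ihH hG.2 hr]

/-- Inside of `A`, dropping `A` changes nothing but the ancestors. -/
theorem PreTensor.Layered.erase {G : PreTensor S E B} {r : List B} (hG : G.Layered anc r)
    (hA : A ∈ r) : G.Layered (dropAnc anc A) (r.filter (· ≠ A)) := by
  induction G generalizing r with
  | one => trivial
  | idt a b => trivial
  | node φ e =>
    intro p hp
    obtain ⟨h1, h2⟩ := hG p hp
    have hAp : A ∉ p.2 := fun h => (List.nodup_append.1 h1.nodup).2.2 A h A hA rfl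
    have := h1.drop (A := A)
    rw [List.filter_append, filter_ne_of_not_mem hAp] at this
    exact ⟨this, h2.imp_of_mem fun {C D} _ hD h => ⟨h, by rintro rfl; exact hAp hD⟩⟩
  | box G C ih =>
    have hC : C ≠ A := by rintro rfl; exact hG.1.1 hA
    have hf : (C :: r).filter (· ≠ A) = C :: r.filter (· ≠ A) :=
      List.filter_cons_of_pos (by simpa using hC)
    refine ⟨hf ▸ hG.1.drop, fun D hD => ?_, fun o ho X hX hCX => hG.2.2.1 o ho X hX hCX.1,
      hf ▸ ih hG.2.2.2 (by simp [hA])⟩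
    rw [List.mem_filter] at hD
    exact ⟨hG.2.1 D hD.1, by simpa using hD.2⟩
  | prod G H ihG ihH => exact ⟨ihG hG.1 hA, ihH hG.2 hA⟩

theorem PreTensor.Layered.drop {G : PreTensor S E B} {r : List B} (hG : G.Layered anc r) :
    (G.drop A).Layered (dropAnc anc A) (r.filter (· ≠ A)) := by
  induction G generalizing r with
  | one => trivial
  | idt a b => trivial
  | node φ e =>
    intro p hp
    rw [EdgeTerm.occ_drop e fun p hp => (List.nodup_append.1 (hG p hp).1.nodup).1] at hp
    obtain ⟨q, hq, rfl⟩ := List.mem_map.1 hp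
    have := (hG q hq).1.drop (A := A)
    rw [List.filter_append] at this
    exact ⟨this, ((hG q hq).2.filter _).imp_of_mem fun {C D} _ hD h =>
      ⟨h, by simpa using (List.mem_filter.1 hD).2⟩⟩
  | box G C ih =>
    by_cases hC : C = A
    · subst hC
      have := hG.2.2.2.erase (A := C) (by simp)
      rw [List.filter_cons_of_neg (by simp)] at this
      simpa [PreTensor.drop, op] using this
    · have hf : (C :: r).filter (· ≠ A) = C :: r.filter (· ≠ A) :=
        List.filter_cons_of_pos (by simpa using hC)
      have hd := boxes_drop (A := A) hG.2.2.2
      have ho := occ_drop (A := A) hG.2.2.2 hG.1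
      have hi := ih hG.2.2.2
      rw [hf] at hi
      unfold PreTensor.drop at hd ho hi ⊢
      simp only [op, if_neg hC]
      refine ⟨hf ▸ hG.1.drop, fun D hD => ?_, fun o' ho' X hX hCX => ?_, hi⟩
      · rw [List.mem_filter] at hD
        exact ⟨hG.2.1 D hD.1, by simpa using hD.2⟩
      · rw [ho] at ho'
        obtain ⟨o, h1, rfl⟩ := List.mem_map.1 ho'
        rw [List.mem_filter] at hX
        rw [hd, List.mem_filter]
        exact ⟨hG.2.2.1 o h1 X hX.1 hCX.1, hX.2⟩
  | prod G H ihG ihH => exact ⟨ihG hG.1, ihH hG.2⟩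

end DropLayered

section CopyLayered

variable {S E B : Type*} [DecidableEq B] {anc : B → Set B} {M : Set B} {A : B} {f : Equiv.Perm B}

theorem copyName_injOn (hf : ∀ C ∈ M, f C ∉ M) : Set.InjOn (copyName anc A f) M := by
  intro C hC D hD h
  unfold copyName at h
  split_ifs at h
  · exact f.injective h
  · exact absurd (h ▸ hD) (hf C hC)
  · exact absurd (h ▸ hC) (hf D hD)
  · exact h

theorem Proper.copyAnc_copyName (hf : ∀ C ∈ M, f C ∉ M) {C : B} (hC : Proper anc M C) :
    copyAnc anc M A f (copyName anc A f C) = copyName anc A f '' anc C := by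
  by_cases hAC : C = A ∨ A ∈ anc C
  · rw [copyName, if_pos hAC, copyAnc_fresh hf hC.1 hAC]
  · rw [copyName, if_neg hAC, copyAnc_of_mem hC.1]
    rw [not_or] at hAC
    conv_lhs => rw [← Set.image_id (anc C)]
    refine Set.image_congr fun D hD => ?_
    have := hC.outside hAC.2 hD
    simp [copyName, this.1, this.2]

theorem UpClosed.copy_of_subset {l : List B} (hl : UpClosed anc l) (hM : ∀ C ∈ l, C ∈ M) :
    UpClosed (copyAnc anc M A f) l := by
  induction l with
  | nil => trivial
  | cons C l ih =>
    refine ⟨hl.1, fun D hD => ?_, ih hl.2.2 fun D hD => hM D (by simp [hD])⟩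
    rw [copyAnc_of_mem (hM C (by simp))] at hD ⊢
    rw [copyAnc_of_mem (hM D (by simp [(hl.2.1 D hD).1]))]
    exact hl.2.1 D hD

theorem UpClosed.map_copyName (hf : ∀ C ∈ M, f C ∉ M) {l : List B} (hl : UpClosed anc l)
    (hM : ∀ C ∈ l, C ∈ M) :
    UpClosed (copyAnc anc M A f) (l.map (copyName anc A f)) := by
  induction l with
  | nil => trivial
  | cons C l ih =>
    have hP := hl.proper hM
    refine ⟨fun h => ?_, fun D' hD' => ?_, ih hl.2.2 fun D hD => hM D (by simp [hD])⟩
    · obtain ⟨D, hD, hDC⟩ := List.mem_map.1 h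
      have := copyName_injOn hf (hM D (by simp [hD])) (hM C (by simp)) hDC
      exact hl.1 (this ▸ hD)
    · rw [(hP C (by simp)).copyAnc_copyName hf] at hD' ⊢
      obtain ⟨D, hD, rfl⟩ := hD'
      have hDl := (hl.2.1 D hD).1
      rw [(hP D (by simp [hDl])).copyAnc_copyName hf]
      exact ⟨List.mem_map_of_mem hDl, Set.image_mono (hl.2.1 D hD).2⟩

theorem PreTensor.Layered.copy_of_subset {G : PreTensor S E B} {r : List B}
    (hG : G.Layered anc r) (hr : ∀ C ∈ r, C ∈ M) (hM : ∀ C ∈ G.boxNames, C ∈ M) :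
    G.Layered (copyAnc anc M A f) r := by
  induction G generalizing r with
  | one => trivial
  | idt a b => trivial
  | node φ e =>
    intro p hp
    have hpM : ∀ C ∈ p.2, C ∈ M := fun C hC => hM C (EdgeTerm.occ_subset_boxNames p hp C hC)
    refine ⟨(hG p hp).1.copy_of_subset ?_, (hG p hp).2.imp_of_mem fun {C D} hC _ h => ?_⟩
    · intro C hC
      rcases List.mem_append.1 hC with h | h
      exacts [hpM C h, hr C h]
    · rwa [copyAnc_of_mem (hpM C hC)]
  | box G C ih =>
    have hC : C ∈ M := hM C (by simp [boxNames])
    have hr' : ∀ D ∈ C :: r, D ∈ M := by simpa [hC] using hr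
    refine ⟨hG.1.copy_of_subset hr', ?_, fun o ho X hX => ?_,
      ih hG.2.2.2 hr' fun D hD => hM D (by simp [boxNames, hD])⟩
    · rw [copyAnc_of_mem hC]; exact hG.2.1
    · rw [copyAnc_of_mem (hM X (by simp [boxNames, ectx_subset_boxNames o ho X hX]))]
      exact hG.2.2.1 o ho X hX
  | prod G H ihG ihH =>
    exact ⟨ihG hG.1 hr fun C hC => hM C (by simp [boxNames, hC]),
      ihH hG.2 hr fun C hC => hM C (by simp [boxNames, hC])⟩

theorem PreTensor.Layered.map_copyName (hf : ∀ C ∈ M, f C ∉ M) {G : PreTensor S E B} {r : List B}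
    (hG : G.Layered anc r) (hr : ∀ C ∈ r, C ∈ M) (hM : ∀ C ∈ G.boxNames, C ∈ M)
    (u : E → E) (g : B → B) (hb : ∀ C ∈ G.boxes, g C = copyName anc A f C)
    (he : ∀ o ∈ G.occ, ∀ C ∈ o.ectx, g C = copyName anc A f C) :
    (G.map u g).Layered (copyAnc anc M A f) (r.map (copyName anc A f)) := by
  induction G generalizing r with
  | one => trivial
  | idt a b => trivial
  | node φ e =>
    intro p' hp'
    rw [EdgeTerm.occ_map] at hp'
    obtain ⟨p, hp, rfl⟩ := List.mem_map.1 hp'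
    have hpM : ∀ C ∈ p.2 ++ r, C ∈ M := by
      intro C hC
      rcases List.mem_append.1 hC with h | h
      exacts [hM C (EdgeTerm.occ_subset_boxNames p hp C h), hr C h]
    have hg : p.2.map g = p.2.map (copyName anc A f) :=
      List.map_congr_left fun C hC => he ⟨p.1, p.2, []⟩ (List.mem_map.2 ⟨p, hp, rfl⟩) C hC
    obtain ⟨h1, h2⟩ := hG p hp
    simp only [hg, ← List.map_append]
    refine ⟨h1.map_copyName hf hpM, List.pairwise_map.2 (h2.imp_of_mem fun {C D} hC _ h => ?_)⟩
    rw [(h1.proper hpM C (by simp [hC])).copyAnc_copyName hf]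
    exact Set.mem_image_of_mem _ h
  | box G C ih =>
    have hC : C ∈ M := hM C (by simp [boxNames])
    have hr' : ∀ D ∈ C :: r, D ∈ M := by simpa [hC] using hr
    have hGM : ∀ D ∈ G.boxNames, D ∈ M := fun D hD => hM D (by simp [boxNames, hD])
    have hgC : g C = copyName anc A f C := hb C (by simp [boxes])
    have he' : ∀ o ∈ G.occ, ∀ C ∈ o.ectx, g C = copyName anc A f C := fun o ho =>
      he ⟨o.dir, o.ectx, o.nctx ++ [C]⟩ (List.mem_map.2 ⟨o, ho, rfl⟩)
    have hi := ih hG.2.2.2 hr' hGM (fun D hD => hb D (by simp [boxes, hD])) he'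
    have hCP := hG.1.proper hr' C (by simp)
    simp only [PreTensor.map, hgC]
    refine ⟨hG.1.map_copyName hf hr', fun D' hD' => ?_, fun o' ho' X' hX' hCX => ?_, hi⟩
    · obtain ⟨D, hD, rfl⟩ := List.mem_map.1 hD'
      rw [hCP.copyAnc_copyName hf]
      exact Set.mem_image_of_mem _ (hG.2.1 D hD)
    · rw [PreTensor.occ_map] at ho'
      obtain ⟨o, ho, rfl⟩ := List.mem_map.1 ho'
      obtain ⟨X, hX, rfl⟩ := List.mem_map.1 hX'
      have hXP : Proper anc M X := by
        refine (hG.2.2.2.occ_ctx hG.1 o ho).1.proper (fun D hD => ?_) X (by simp [hX])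
        simp only [List.mem_append] at hD
        rcases hD with h | h | h
        exacts [hGM D (ectx_subset_boxNames o ho D h),
          hGM D (boxes_subset_boxNames D (nctx_subset_boxes o ho D h)), hr' D h]
      rw [he' o ho X hX, hXP.copyAnc_copyName hf] at hCX
      obtain ⟨D, hD, hDC⟩ := hCX
      have := copyName_injOn hf (hXP.2.2 D hD).1 hC hDC
      rw [PreTensor.boxes_map]
      exact List.mem_map_of_mem (hG.2.2.1 o ho X hX (this ▸ hD))
  | prod G H ihG ihH =>
    exact ⟨ihG hG.1 hr (fun C hC => hM C (by simp [boxNames, hC]))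
        (fun C hC => hb C (by simp [boxes, hC])) (fun o ho => he o (by simp [occ, ho])),
      ihH hG.2 hr (fun C hC => hM C (by simp [boxNames, hC]))
        (fun C hC => hb C (by simp [boxes, hC])) (fun o ho => he o (by simp [occ, ho]))⟩

variable {fr : Fr E B}

theorem map_copyName_of_outside {A : B} {r : List B} (h : UpClosed anc (A :: r)) :
    r.map (copyName anc A f) = r := by
  conv_rhs => rw [← List.map_id r]
  refine List.map_congr_left fun C hC => ?_
  have h1 : C ≠ A := by rintro rfl; exact h.1 hC
  simp [copyName, h1, h.not_mem_anc C hC]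

theorem EdgeTerm.occ_copy (e : EdgeTerm E B) (r : List B)
    (he : ∀ p ∈ e.occ, UpClosed anc (p.2 ++ r) ∧ p.2.Pairwise fun C D => D ∈ anc C) :
    ∀ p' ∈ (e.op A (fun e => .cat (.clock e A) (.clock (e.map fr.edge fr.box) (fr.box A)))
      (fun e => .cat (.anti (e.map fr.edge fr.box) (fr.box A)) (.anti e A))).occ,
      ∃ p ∈ e.occ, p'.2 = p.2 ∨ A ∈ p.2 ∧ p'.2 = p.2.map (copyName anc A fr.box) := by
  have hsplit : ∀ (e : EdgeTerm E B) C r, (∀ p ∈ (clock e C).occ,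
      UpClosed anc (p.2 ++ r) ∧ p.2.Pairwise fun C D => D ∈ anc C) →
      (∀ p ∈ e.occ, UpClosed anc (p.2 ++ C :: r) ∧ p.2.Pairwise fun C D => D ∈ anc C) ∧
      (∀ p ∈ e.occ, ∀ D ∈ p.2, C ∈ anc D) := by
    intro e C r he
    have h := fun p hp => he (p.1, p.2 ++ [C]) (List.mem_map.2 ⟨p, hp, rfl⟩)
    refine ⟨fun p hp => ?_, fun p hp D hD => ?_⟩
    · exact ⟨by simpa using (h p hp).1, (List.pairwise_append.1 (h p hp).2).1⟩
    · exact (List.pairwise_append.1 (h p hp).2).2.2 D hD C (by simp)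
  -- an edge in a group around `C ≠ A`
  have outer : ∀ (e e' : EdgeTerm E B) C r, C ≠ A → (∀ p ∈ (clock e C).occ,
      UpClosed anc (p.2 ++ r) ∧ p.2.Pairwise fun C D => D ∈ anc C) →
      (∀ p' ∈ e'.occ, ∃ p ∈ e.occ,
        p'.2 = p.2 ∨ A ∈ p.2 ∧ p'.2 = p.2.map (copyName anc A fr.box)) →
      ∀ p' ∈ (clock e' C).occ, ∃ p ∈ (clock e C).occ,
        p'.2 = p.2 ∨ A ∈ p.2 ∧ p'.2 = p.2.map (copyName anc A fr.box) := by
    intro e e' C r hC he ih p' hp'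
    obtain ⟨q', hq', rfl⟩ := List.mem_map.1 hp'
    obtain ⟨q, hq, h⟩ := ih q' hq'
    refine ⟨(q.1, q.2 ++ [C]), List.mem_map.2 ⟨q, hq, rfl⟩, ?_⟩
    rcases h with h | ⟨hA, h⟩
    · simp [h]
    · refine .inr ⟨by simp [hA], ?_⟩
      obtain ⟨l1, l2, hl⟩ := List.append_of_mem hA
      have h1 := ((hsplit e C r he).1 q hq).1
      rw [hl, List.append_assoc, List.cons_append] at h1
      have := h1.of_append.not_mem_anc C (by simp)
      simp [h, copyName, hC, this]
  -- an edge in a group around `A`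
  have inner : ∀ (e : EdgeTerm E B) r, (∀ p ∈ (clock e A).occ,
      UpClosed anc (p.2 ++ r) ∧ p.2.Pairwise fun C D => D ∈ anc C) →
      ∀ p', p' ∈ (clock e A).occ ∨ p' ∈ (clock (e.map fr.edge fr.box) (fr.box A)).occ →
      ∃ p ∈ (clock e A).occ,
        p'.2 = p.2 ∨ A ∈ p.2 ∧ p'.2 = p.2.map (copyName anc A fr.box) := by
    rintro e r he p' (hp' | hp')
    · exact ⟨p', hp', .inl rfl⟩
    · obtain ⟨q', hq', rfl⟩ := List.mem_map.1 hp'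
      rw [occ_map] at hq'
      obtain ⟨q, hq, rfl⟩ := List.mem_map.1 hq'
      refine ⟨(q.1, q.2 ++ [A]), List.mem_map.2 ⟨q, hq, rfl⟩, .inr ⟨by simp, ?_⟩⟩
      have := (hsplit e A r he).2 q hq
      simp only [List.map_append, List.map_cons, List.map_nil]
      congr 1
      · exact List.map_congr_left fun D hD => by simp [copyName, this D hD]
      · simp [copyName]
  induction e generalizing r with
  | eps => simp [op, occ]
  | edge d => simp [op, occ]
  | clock e C ih =>
    by_cases hC : C = A
    · subst hC
      simp only [op, if_true]
      exact fun p' hp' => inner e r he p' (List.mem_append.1 hp')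
    · simp only [op, if_neg hC]
      exact outer e _ C r hC he (ih (C :: r) (hsplit e C r he).1)
  | anti e C ih =>
    by_cases hC : C = A
    · subst hC
      simp only [op, if_true]
      exact fun p' hp' => inner e r he p' (List.mem_append.1 hp').symm
    · simp only [op, if_neg hC]
      exact outer e _ C r hC he (ih (C :: r) (hsplit e C r he).1)
  | cat e f ihe ihf =>
    intro p' hp'
    rcases List.mem_append.1 hp' with h | h
    · obtain ⟨p, hp, h⟩ := ihe r (fun p hp => he p (by simp [occ, hp])) p' h
      exact ⟨p, by simp [occ, hp], h⟩
    · obtain ⟨p, hp, h⟩ := ihf r (fun p hp => he p (by simp [occ, hp])) p' h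
      exact ⟨p, by simp [occ, hp], h⟩

/-- The !-boxes that the fresh copy of the contents of `A` renames are those inside `A`. -/
theorem PreTensor.map_fresh_eq_copyName {G : PreTensor S E B} {r : List B}
    (hG : (G.box A).Layered anc r) :
    (∀ C ∈ G.boxes, (if C ∈ G.boxes then f C else C) = copyName anc A f C) ∧
    (∀ o ∈ G.occ, ∀ C ∈ o.ectx, (if C ∈ G.boxes then f C else C) = copyName anc A f C) := by
  have hi := hG.inner (M := Set.univ) (by simp) (by simp)
  refine ⟨fun C hC => by simp [copyName, hC, (hi.1 C hC).2.2.2], fun o ho C hC => ?_⟩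
  have := hi.2 o ho C hC
  by_cases hAC : A ∈ anc C <;> simp [copyName, this.2.2.2, this.2.1, hAC]

/-- The edge groups around an edge of the copied expression are those around an edge of the
expression, up to the names in the fresh copy. -/
theorem PreTensor.occ_copy {G : PreTensor S E B} {r : List B} (hG : G.Layered anc r) :
    ∀ o' ∈ (G.copy A fr).occ, ∃ o ∈ G.occ,
      o'.ectx = o.ectx ∨ o'.ectx = o.ectx.map (copyName anc A fr.box) := by
  unfold PreTensor.copy
  induction G generalizing r with
  | one => simp [op, occ]
  | idt a b =>
    simp only [op]
    exact fun o ho => ⟨o, ho, .inl rfl⟩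
  | node φ e =>
    simp only [op, occ, List.mem_map]
    rintro _ ⟨p', hp', rfl⟩
    obtain ⟨p, hp, h⟩ := EdgeTerm.occ_copy e r hG p' hp'
    exact ⟨_, ⟨p, hp, rfl⟩, h.imp id And.right⟩
  | box G C ih =>
    by_cases hC : C = A
    · subst hC
      simp only [op, if_true, occ, List.mem_append, List.mem_map]
      rintro o' (h | h)
      · exact ⟨o', h, .inl rfl⟩
      · obtain ⟨o1, ho1, rfl⟩ := h
        rw [fresh, PreTensor.occ_map] at ho1
        obtain ⟨o, ho, rfl⟩ := List.mem_map.1 ho1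
        exact ⟨_, ⟨o, ho, rfl⟩, .inr (List.map_congr_left fun D hD =>
          (map_fresh_eq_copyName hG).2 o ho D hD)⟩
    · simp only [op, if_neg hC, occ, List.mem_map]
      rintro _ ⟨o1, ho1, rfl⟩
      obtain ⟨o, ho, h⟩ := ih hG.2.2.2 o1 ho1
      exact ⟨_, ⟨o, ho, rfl⟩, h⟩
  | prod G H ihG ihH =>
    intro o' ho'
    rcases List.mem_append.1 ho' with h | h
    · obtain ⟨o, ho, h⟩ := ihG hG.1 o' h
      exact ⟨o, by simp [occ, ho], h⟩
    · obtain ⟨o, ho, h⟩ := ihH hG.2 o' h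
      exact ⟨o, by simp [occ, ho], h⟩

theorem PreTensor.boxes_copy {G : PreTensor S E B} {r : List B} (hG : G.Layered anc r)
    (hA : A ∉ r) :
    ∀ X ∈ G.boxes, X ∈ (G.copy A fr).boxes ∧ copyName anc A fr.box X ∈ (G.copy A fr).boxes := by
  unfold PreTensor.copy
  induction G generalizing r with
  | one => simp [boxes]
  | idt a b => simp [boxes]
  | node φ e => simp [boxes]
  | box G C ih =>
    intro X hX
    by_cases hC : C = A
    · subst hC
      simp only [op, if_true, boxes, List.mem_append]
      refine ⟨.inl hX, .inr ?_⟩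
      rcases List.mem_cons.1 hX with rfl | hX
      · simp [copyName]
      · rw [fresh, PreTensor.boxes_map]
        refine List.mem_cons_of_mem _ (List.mem_map.2 ⟨X, hX, (map_fresh_eq_copyName hG).1 X hX⟩)
    · simp only [op, if_neg hC, boxes]
      rcases List.mem_cons.1 hX with rfl | hX
      · have : A ∉ anc X := fun h => hA (hG.1.2.1 A h).1
        simp [copyName, hC, this]
      · have := ih hG.2.2.2 (by simp [hA, Ne.symm hC]) X hX
        exact ⟨List.mem_cons_of_mem _ this.1, List.mem_cons_of_mem _ this.2⟩
  | prod G H ihG ihH =>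
    intro X hX
    simp only [op, boxes, List.mem_append]
    rcases List.mem_append.1 hX with h | h
    exacts [(ihG hG.1 hA X h).imp .inl .inl, (ihH hG.2 hA X h).imp .inr .inr]

theorem PreTensor.Layered.copy (hf : ∀ C ∈ M, fr.box C ∉ M) {G : PreTensor S E B} {r : List B}
    (hG : G.Layered anc r) (hA : A ∉ r) (hr : ∀ C ∈ r, C ∈ M) (hM : ∀ C ∈ G.boxNames, C ∈ M) :
    (G.copy A fr).Layered (copyAnc anc M A fr.box) r := by
  induction G generalizing r with
  | one => trivial
  | idt a b => trivial
  | node φ e =>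
    intro p' hp'
    obtain ⟨p, hp, h⟩ := EdgeTerm.occ_copy e r hG p' hp'
    have hpM : ∀ C ∈ p.2 ++ r, C ∈ M := by
      intro C hC
      rcases List.mem_append.1 hC with h | h
      exacts [hM C (EdgeTerm.occ_subset_boxNames p hp C h), hr C h]
    obtain ⟨h1, h2⟩ := hG p hp
    rcases h with h | ⟨hAp, h⟩
    · rw [h]
      exact (hG.copy_of_subset (A := A) (f := fr.box) hr hM) p hp
    · rw [h]
      constructor
      · obtain ⟨l1, l2, hl⟩ := List.append_of_mem hAp
        have h3 := h1
        rw [hl, List.append_assoc, List.cons_append] at h3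
        have h4 := map_copyName_of_outside (f := fr.box) h3.of_append
        rw [List.map_append] at h4
        have h5 : r.map (copyName anc A fr.box) = r := (List.append_inj' h4 (by simp)).2
        have := h1.map_copyName (A := A) hf hpM
        rwa [List.map_append, h5] at this
      · refine List.pairwise_map.2 (h2.imp_of_mem fun {C D} hC _ h => ?_)
        rw [(h1.proper hpM C (by simp [hC])).copyAnc_copyName hf]
        exact Set.mem_image_of_mem _ h
  | box G C ih =>
    have hC' : C ∈ M := hM C (by simp [boxNames])
    have hr' : ∀ D ∈ C :: r, D ∈ M := by simpa [hC'] using hr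
    have hGM : ∀ D ∈ G.boxNames, D ∈ M := fun D hD => hM D (by simp [boxNames, hD])
    have hcopy := hG.copy_of_subset (A := A) (f := fr.box) hr hM
    by_cases hC : C = A
    · subst hC
      simp only [PreTensor.copy, op, if_true]
      refine ⟨hcopy, ?_⟩
      have hfresh := map_fresh_eq_copyName (f := fr.box) hG
      have hi := hG.2.2.2.map_copyName (A := C) hf hr' hGM fr.edge _ hfresh.1 hfresh.2
      have hu := hG.1.map_copyName (A := C) hf hr'
      have hCf : copyName anc C fr.box C = fr.box C := by simp [copyName]
      rw [List.map_cons, map_copyName_of_outside hG.1, hCf] at hi hu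
      refine ⟨hu, fun D hD => ?_, fun o' ho' X' hX' hCX => ?_, hi⟩
      · rw [copyAnc_fresh hf hC' (.inl rfl)]
        refine ⟨D, hG.2.1 D hD, ?_⟩
        have h1 : D ≠ C := by rintro rfl; exact hG.1.1 hD
        simp [copyName, h1, hG.1.not_mem_anc D hD]
      · rw [fresh, PreTensor.occ_map] at ho'
        obtain ⟨o, ho, rfl⟩ := List.mem_map.1 ho'
        obtain ⟨X, hX, rfl⟩ := List.mem_map.1 hX'
        have hXP := ((hG.inner hM hr).2 o ho X hX).1
        rw [hfresh.2 o ho X hX, hXP.copyAnc_copyName hf, ← hCf] at hCX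
        obtain ⟨D, hD, hDC⟩ := hCX
        have := copyName_injOn hf (hXP.2.2 D hD).1 hC' hDC
        rw [fresh, PreTensor.boxes_map]
        exact List.mem_map_of_mem (hG.2.2.1 o ho X hX (this ▸ hD))
    · have hA' : A ∉ C :: r := by simp [hA, Ne.symm hC]
      have hi := ih hG.2.2.2 hA' hr' hGM
      have hb := boxes_copy (fr := fr) hG.2.2.2 hA'
      have ho := occ_copy (A := A) (fr := fr) hG.2.2.2
      unfold PreTensor.copy at hi hb ho ⊢
      simp only [op, if_neg hC]
      refine ⟨hcopy.1, hcopy.2.1, fun o' ho' X' hX' hCX => ?_, hi⟩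
      obtain ⟨o, h1, h2⟩ := ho o' ho'
      have hXP : ∀ X ∈ o.ectx, Proper anc M X := by
        intro X hX
        refine (hG.2.2.2.occ_ctx hG.1 o h1).1.proper (fun D hD => ?_) X (by simp [hX])
        simp only [List.mem_append] at hD
        rcases hD with h | h | h
        exacts [hGM D (ectx_subset_boxNames o h1 D h),
          hGM D (boxes_subset_boxNames D (nctx_subset_boxes o h1 D h)), hr' D h]
      rcases h2 with h2 | h2
      · rw [h2] at hX'
        rw [copyAnc_of_mem (hXP X' hX').1] at hCX
        exact (hb X' (hG.2.2.1 o h1 X' hX' hCX)).1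
      · rw [h2] at hX'
        obtain ⟨X, hX, rfl⟩ := List.mem_map.1 hX'
        rw [(hXP X hX).copyAnc_copyName hf] at hCX
        obtain ⟨D, hD, hDC⟩ := hCX
        have hDM := ((hXP X hX).2.2 D hD).1
        have hD' : D = C := by
          unfold copyName at hDC
          split_ifs at hDC
          · exact absurd (hDC ▸ hC') (hf D hDM)
          · exact hDC
        exact (hb X (hG.2.2.1 o h1 X hX (hD' ▸ hD))).2
  | prod G H ihG ihH =>
    exact ⟨ihG hG.1 hA hr fun C hC => hM C (by simp [boxNames, hC]),
      ihH hG.2 hA hr fun C hC => hM C (by simp [boxNames, hC])⟩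

end CopyLayered

/-! ### Expansion as copying and dropping -/

section ExpEq

variable {S E B : Type*} [DecidableEq B] {A : B} {fr : Fr E B}

theorem EdgeTerm.op_of_not_mem {c k : EdgeTerm E B → EdgeTerm E B} (e : EdgeTerm E B)
    (he : A ∉ e.boxNames) : e.op A c k = e := by
  induction e with
  | eps => rfl
  | edge d => rfl
  | clock e C ih =>
    simp only [boxNames, List.mem_cons, not_or] at he
    simp [op, Ne.symm he.1, ih he.2]
  | anti e C ih =>
    simp only [boxNames, List.mem_cons, not_or] at he
    simp [op, Ne.symm he.1, ih he.2]
  | cat e f ihe ihf =>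
    simp only [boxNames, List.mem_append, not_or] at he
    simp [op, ihe he.1, ihf he.2]

theorem PreTensor.op_of_not_mem {c k : EdgeTerm E B → EdgeTerm E B}
    {t : PreTensor S E B → PreTensor S E B} (G : PreTensor S E B)
    (hG : A ∉ G.boxNames) : G.op A c k t = G := by
  induction G with
  | one => rfl
  | idt a b => rfl
  | node φ e => simp [op, EdgeTerm.op_of_not_mem e hG]
  | box G C ih =>
    simp only [boxNames, List.mem_cons, not_or] at hG
    simp [op, Ne.symm hG.1, ih hG.2]
  | prod G H ihG ihH =>
    simp only [boxNames, List.mem_append, not_or] at hG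
    simp [op, ihG hG.1, ihH hG.2]

theorem EdgeTerm.exp_eq_drop_copy (hA : fr.box A ≠ A) (e : EdgeTerm E B)
    (he : fr.box A ∉ e.boxNames) :
    e.op A (fun e => .cat (.clock e A) (e.map fr.edge fr.box))
      (fun e => .cat (e.map fr.edge fr.box) (.anti e A)) =
    (e.op A (fun e => .cat (.clock e A) (.clock (e.map fr.edge fr.box) (fr.box A)))
      (fun e => .cat (.anti (e.map fr.edge fr.box) (fr.box A)) (.anti e A))).op (fr.box A)
        (fun e => e) (fun e => e) := by
  induction e with
  | eps => rfl
  | edge d => rfl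
  | clock e C ih =>
    simp only [boxNames, List.mem_cons, not_or] at he
    by_cases hC : C = A
    · subst hC; simp [op, hA.symm, op_of_not_mem e he.2]
    · simp [op, hC, Ne.symm he.1, ih he.2]
  | anti e C ih =>
    simp only [boxNames, List.mem_cons, not_or] at he
    by_cases hC : C = A
    · subst hC; simp [op, hA.symm, op_of_not_mem e he.2]
    · simp [op, hC, Ne.symm he.1, ih he.2]
  | cat e f ihe ihf =>
    simp only [boxNames, List.mem_append, not_or] at he
    simp [op, ihe he.1, ihf he.2]

/-- Expanding `A` is copying `A` and dropping the fresh copy. -/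
theorem PreTensor.exp_eq_drop_copy (hA : fr.box A ≠ A) (G : PreTensor S E B)
    (hG : fr.box A ∉ G.boxNames) : G.exp A fr = (G.copy A fr).drop (fr.box A) := by
  unfold exp copy drop
  induction G with
  | one => rfl
  | idt a b => rfl
  | node φ e => simp [op, EdgeTerm.exp_eq_drop_copy hA e hG]
  | box G C ih =>
    simp only [boxNames, List.mem_cons, not_or] at hG
    by_cases hC : C = A
    · subst hC; simp [op, hA.symm, op_of_not_mem G hG.2]
    · simp [op, hC, Ne.symm hG.1, ih hG.2]
  | prod G H ihG ihH =>
    simp only [boxNames, List.mem_append, not_or] at hG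
    simp [op, ihG hG.1, ihH hG.2]

end ExpEq

/-! ### Corresponding counts -/

section Counts

variable {B : Type*} [DecidableEq B] {anc : B → Set B} {M : Set B} {A : B}

/-- Counts for the expression without `A` come from counts for the expression. -/
theorem exists_dropCount {n' : Count B} (hn' : n'.Local (dropAnc anc A)) :
    ∃ n : Count B, n.Local anc ∧ DropCount anc M A n n' := by
  refine ⟨fun C ρ => if C = A then 1 else n' C (Function.update ρ A 0), ?_, ?_, ?_, ?_⟩
  · intro C ρ ρ' h
    by_cases hC : C = A
    · simp [hC]
    · simp only [if_neg hC]
      refine hn' _ _ _ fun D hD => ?_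
      rw [Function.update_of_ne hD.2, Function.update_of_ne hD.2, h D hD.1]
  · simp
  · intro C _ hC hAC ρ
    simp only [if_neg hC]
    exact (hn'.update (fun h => h.2 rfl) ρ 0 : _) ▸ rfl
  · intro C hC ρ _
    simp [hC]

/-- Counts that give one copy of `A` can be read as counts for the expression without `A`. -/
theorem DropCount.of_count {n : Count B} (hn : n.Local anc) (h1 : ∀ ρ, n A ρ = 1) :
    Count.Local (dropAnc anc A) (fun C ρ => n C (Function.update ρ A 1)) ∧
      DropCount anc M A n (fun C ρ => n C (Function.update ρ A 1)) := by
  refine ⟨fun C ρ ρ' h => hn _ _ _ fun D hD => ?_, h1, fun C _ _ hAC ρ => hn.update hAC ρ 1,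
    fun C _ ρ hρ => ?_⟩
  · by_cases hDA : D = A
    · simp [hDA]
    · rw [Function.update_of_ne hDA, Function.update_of_ne hDA, h D ⟨hD, hDA⟩]
  · simp [← hρ]

open Classical in
/-- Counts for the copied expression come from counts for the expression. -/
theorem exists_copyCount {f : Equiv.Perm B} (hf : ∀ C ∈ M, f C ∉ M) {n' : Count B}
    (hn' : n'.Local (copyAnc anc M A f)) :
    ∃ n : Count B, n.Local anc ∧ CopyCount anc M A f n n' := by
  let F : Count B := fun C ρ =>
    if C = A then n' A ρ + n' (f A) ρ
    else if A ∈ anc C then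
      if ρ A ≤ n' A ρ then n' C ρ else n' (f C) (copyEnv anc M A f n' ρ)
    else n' C ρ
  have hF : ∀ C, Proper anc M C → ∀ ρ ρ', (∀ D ∈ anc C, ρ D = ρ' D) → F C ρ = F C ρ' := by
    intro C hC ρ ρ' h
    have hloc : ∀ C ∈ M, (∀ D ∈ anc C, ρ D = ρ' D) → n' C ρ = n' C ρ' := fun C hC h =>
      hn' _ _ _ fun D hD => h D (by rwa [copyAnc_of_mem hC] at hD)
    by_cases hCA : C = A
    · subst hCA
      simp only [F, if_true, hloc C hC.1 h]
      congr 1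
      refine hn' _ _ _ fun D' hD' => ?_
      rw [copyAnc_fresh hf hC.1 (.inl rfl)] at hD'
      obtain ⟨D, hD, rfl⟩ := hD'
      have := hC.outside hC.2.1 hD
      simpa [copyName, this.1, this.2] using h D hD
    · by_cases hAC : A ∈ anc C
      · have hA := hC.2.2 A hAC
        have h1 : n' A ρ = n' A ρ' := hloc A hA.1 fun D hD => h D (hA.2 hD)
        simp only [F, if_neg hCA, if_pos hAC, hloc C hC.1 h, h A hAC, h1]
        congr 1
        refine hn' _ _ _ fun D' hD' => ?_
        rw [copyAnc_fresh hf hC.1 (.inr hAC)] at hD'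
        obtain ⟨D, hD, rfl⟩ := hD'
        have hDM := (hC.2.2 D hD).1
        by_cases hDA : D = A
        · subst hDA
          simp [copyName, copyEnv_self hf hDM, h1, h D hAC]
        · by_cases hAD : A ∈ anc D
          · simp [copyName, hAD, copyEnv_inside hf hDM hDA hAD, h D hD]
          · simp [copyName, hAD, hDA, copyEnv_outside hDM hDA hAD, h D hD]
      · simp only [F, if_neg hCA, if_neg hAC]
        exact hloc C hC.1 h
  -- restricting the environments makes the counts local everywhere
  let n : Count B := fun C ρ => F C fun D => if D ∈ anc C then ρ D else 0
  have hn : ∀ C, Proper anc M C → ∀ ρ, n C ρ = F C ρ := fun C hC ρ =>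
    hF C hC _ _ fun D hD => by simp [hD]
  refine ⟨n, ?_, ?_, ?_, ?_, ?_⟩
  · intro C ρ ρ' h
    have : (fun D => if D ∈ anc C then ρ D else 0) = fun D => if D ∈ anc C then ρ' D else 0 := by
      funext D
      by_cases hD : D ∈ anc C
      · simp [hD, h D hD]
      · simp [hD]
    simp only [n, this]
  · intro hA ρ
    rw [hn A hA]; simp [F]
  · intro C hC hCA hAC ρ
    rw [hn C hC]; simp [F, hCA, hAC]
  · intro C hC hAC ρ hρ
    have hCA : C ≠ A := by rintro rfl; exact hC.2.1 hAC
    rw [hn C hC]; simp [F, hCA, hAC, hρ]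
  · intro C hC hAC ρ hρ
    have hCA : C ≠ A := by rintro rfl; exact hC.2.1 hAC
    rw [hn C hC]; simp [F, hCA, hAC, hρ]

open Classical in
/-- If a top-level !-box `A` has `k + 1` copies, the last copy can be split off by copying `A`. -/
theorem exists_copyCount_split {f : Equiv.Perm B} (hf : ∀ C ∈ M, f C ∉ M) {n : Count B}
    (hn : n.Local anc) (hA : A ∈ M) (hanc : anc A = ∅) {k : ℕ} (hk : n A 0 = k + 1) :
    ∃ n' : Count B, n'.Local (copyAnc anc M A f) ∧ CopyCount anc M A f n n' ∧
      (∀ ρ, n' A ρ = k) ∧ ∀ ρ, n' (f A) ρ = 1 := by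
  -- translate environments back
  let s : Env B → Env B := fun ρ D =>
    if D = A then ρ (f A) + k else if A ∈ anc D then ρ (f D) else ρ D
  let n' : Count B := fun X ρ =>
    if X ∈ M then if X = A then k else n X ρ
    else if f.symm X = A then 1 else if A ∈ anc (f.symm X) then n (f.symm X) (s ρ) else 0
  have hA1 : ∀ ρ, n' A ρ = k := by simp [n', hA]
  have hA2 : ∀ ρ, n' (f A) ρ = 1 := by simp [n', hf A hA]
  refine ⟨n', ?_, ⟨?_, ?_, ?_, ?_⟩, hA1, hA2⟩
  · intro X ρ ρ' h
    by_cases hX : X ∈ M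
    · rw [copyAnc_of_mem hX] at h
      by_cases hXA : X = A
      · simp [hXA, hA1]
      · simp only [n', hX, hXA, if_true, if_false]
        exact hn _ _ _ h
    · by_cases h1 : f.symm X = A
      · simp [n', hX, h1]
      · by_cases h2 : A ∈ anc (f.symm X)
        · simp only [n', hX, h1, h2, if_true, if_false]
          refine hn _ _ _ fun D hD => ?_
          have h3 : ρ (copyName anc A f D) = ρ' (copyName anc A f D) := h _ (by
            rw [copyAnc, if_neg hX, if_pos (.inr h2)]; exact Set.mem_image_of_mem _ hD)
          by_cases hDA : D = A
          · subst hDA; simpa [s, copyName] using h3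
          · by_cases hAD : A ∈ anc D
            · simpa [s, hDA, hAD, copyName] using h3
            · simpa [s, hDA, hAD, copyName] using h3
        · simp [n', hX, h1, h2]
  · intro _ ρ
    rw [hA1, hA2, ← hk]
    exact hn _ _ _ (by simp [hanc])
  · intro C hC hCA _ ρ
    simp [n', hC.1, hCA]
  · intro C hC hAC ρ _
    have hCA : C ≠ A := by rintro rfl; exact hC.2.1 hAC
    simp [n', hC.1, hCA]
  · intro C hC hAC ρ hρ
    have hCA : C ≠ A := by rintro rfl; exact hC.2.1 hAC
    rw [hA1] at hρ
    have : n' (f C) (copyEnv anc M A f n' ρ) = n C (s (copyEnv anc M A f n' ρ)) := by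
      simp [n', hf C hC.1, hCA, hAC]
    rw [this]
    refine hn _ _ _ fun D hD => ?_
    have hDM := (hC.2.2 D hD).1
    by_cases hDA : D = A
    · subst hDA; simp [s, copyEnv_self hf hDM, hA1]; omega
    · by_cases hAD : A ∈ anc D
      · simp [s, hDA, hAD, copyEnv_inside hf hDM hDA hAD]
      · simp [s, hDA, hAD, copyEnv_outside hDM hDA hAD]

end Counts

/-! ### The edges of an unrolled expression -/

section Dirs

variable {S E F B : Type*}

/-- The directed edges of a factor. -/
def Factor.dirs : Factor S E → List (DirEdge E)
  | node _ l => l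
  | idt a b => [.out a, .inp b]

/-- The directed edges of a net. -/
def Net.dirs (N : Net S E) : Multiset (DirEdge E) := (Multiset.map (fun x => (x.dirs : Multiset _)) N).sum

/-- The edge names of a net. -/
def Net.names (N : Net S E) : Set E := {a | ∃ d ∈ N.dirs, d.name = a}

theorem Factor.dirs_rename (f : E → F) (x : Factor S E) :
    (x.rename f).dirs = x.dirs.map (DirEdge.rename f) := by
  cases x <;> rfl

@[simp] theorem Net.dirs_singleton (x : Factor S E) : Net.dirs {x} = (x.dirs : Multiset _) := by
  simp [Net.dirs]

@[simp] theorem Net.dirs_add (M N : Net S E) : Net.dirs (M + N) = M.dirs + N.dirs := by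
  simp [Net.dirs]

theorem Net.dirs_sum {ι : Type*} (s : Finset ι) (N : ι → Net S E) :
    Net.dirs (∑ i ∈ s, N i) = ∑ i ∈ s, (N i).dirs := by
  classical
  induction s using Finset.induction_on with
  | empty => rfl
  | insert i s hi ih => simp [Finset.sum_insert hi, ih]

theorem Net.dirs_rename (f : E → F) (N : Net S E) :
    (N.rename f).dirs = N.dirs.map (DirEdge.rename f) := by
  induction N using Multiset.induction_on with
  | empty => rfl
  | cons x N ih =>
    rw [← Multiset.singleton_add, Net.rename_add, Net.dirs_add, ih, Net.dirs_add, Multiset.map_add]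
    simp [Net.rename, Factor.dirs_rename]

theorem Net.names_rename (f : E → F) (N : Net S E) : (N.rename f).names = f '' N.names := by
  ext b
  simp only [names, dirs_rename, Multiset.mem_map, Set.mem_ofPred_eq, Set.mem_image]
  constructor
  · rintro ⟨_, ⟨d, hd, rfl⟩, rfl⟩
    exact ⟨d.name, ⟨d, hd, rfl⟩, by simp⟩
  · rintro ⟨_, ⟨d, hd, rfl⟩, rfl⟩
    exact ⟨_, ⟨d, hd, rfl⟩, by simp⟩

theorem Net.rename_congr {f g : E → F} {N : Net S E} (h : ∀ a ∈ N.names, f a = g a) :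
    N.rename f = N.rename g := by
  refine Multiset.map_congr rfl fun x hx => ?_
  have hd : ∀ d ∈ x.dirs, f d.name = g d.name := fun d hd => h _ ⟨d, by
    obtain ⟨N', rfl⟩ := Multiset.exists_cons_of_mem hx
    rw [← Multiset.singleton_add, Net.dirs_add]
    simp [hd], rfl⟩
  cases x with
  | node φ l =>
    simp only [Factor.rename, Factor.node.injEq, true_and]
    exact List.map_congr_left fun d hd' => DirEdge.rename_congr (hd d hd')
  | idt a b =>
    have h1 := hd (.out a) (by simp [Factor.dirs])
    have h2 := hd (.inp b) (by simp [Factor.dirs])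
    simp only [DirEdge.name] at h1 h2
    simp [Factor.rename, h1, h2]

end Dirs

section Envs

variable {S E B : Type*} [DecidableEq B] {anc : B → Set B} {n : Count B}

/-- The environments inside the !-boxes `l`, listed from the outside in. -/
def envs (n : Count B) : List B → Env B → Multiset (Env B)
  | [], ρ => {ρ}
  | C :: l, ρ => ∑ i ∈ Finset.range (n C ρ), envs n l (Function.update ρ C (i + 1))

omit [DecidableEq B] in
theorem coe_flatMap_range {α : Type*} (k : ℕ) (F : ℕ → List α) :
    (((List.range k).flatMap F : List α) : Multiset α) =
      ∑ i ∈ Finset.range k, (F i : Multiset α) := by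
  induction k with
  | zero => rfl
  | succ k ih => simp [List.range_succ, List.flatMap_append, Finset.sum_range_succ, ← ih]

omit [DecidableEq B] in
theorem list_sum_finset_sum {α β ι : Type*} [AddCommMonoid β] (l : List α) (s : Finset ι)
    (F : α → ι → β) :
    (l.map fun x => ∑ i ∈ s, F x i).sum = ∑ i ∈ s, (l.map fun x => F x i).sum := by
  induction l with
  | nil => simp
  | cons x l ih => simp [ih, Finset.sum_add_distrib]

theorem EdgeTerm.coe_unroll (n : Count B) (e : EdgeTerm E B) (ρ : Env B) :
    (e.unroll n ρ : Multiset (DirEdge (E × Env B))) = (e.occ.map fun p =>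
      (envs n p.2.reverse ρ).map fun ρ' => p.1.rename fun a => (a, ρ')).sum := by
  have group : ∀ (e : EdgeTerm E B) (C : B) (ρ : Env B),
      (∀ ρ, (e.unroll n ρ : Multiset (DirEdge (E × Env B))) = (e.occ.map fun p =>
        (envs n p.2.reverse ρ).map fun ρ' => p.1.rename fun a => (a, ρ')).sum) →
      ∑ i ∈ Finset.range (n C ρ),
        (e.unroll n (Function.update ρ C (i + 1)) : Multiset (DirEdge (E × Env B))) =
      ((clock e C).occ.map fun p =>
        (envs n p.2.reverse ρ).map fun ρ' => p.1.rename fun a => (a, ρ')).sum := by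
    intro e C ρ ih
    simp only [occ, List.map_map, Function.comp_def, List.reverse_append, List.reverse_cons,
      List.reverse_nil, List.nil_append, List.cons_append, envs, ih]
    rw [← list_sum_finset_sum]
    congr 1
    refine List.map_congr_left fun p _ => ?_
    exact (map_sum (Multiset.mapAddMonoidHom _) _ _).symm
  induction e generalizing ρ with
  | eps => rfl
  | edge d => simp [unroll, occ, envs]
  | clock e C ih => rw [unroll, coe_flatMap_range]; exact group e C ρ ih
  | anti e C ih =>
    refine Eq.trans ?_ (group e C ρ ih)
    rw [unroll, ← coe_flatMap_range]
    exact Multiset.coe_eq_coe.2 ((List.reverse_perm _).flatMap_right _)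
  | cat e f ihe ihf => simp [unroll, occ, ← ihe, ← ihf]

/-- Every edge of an expression has one copy for each environment inside its context. -/
theorem PreTensor.dirs_unroll (n : Count B) (G : PreTensor S E B) (ρ : Env B) :
    (G.unroll n ρ).dirs = (G.occ.map fun o =>
      (envs n o.ctx.reverse ρ).map fun ρ' => o.dir.rename fun a => (a, ρ')).sum := by
  induction G generalizing ρ with
  | one => rfl
  | idt a b => simp [unroll, occ, envs, Occ.ctx, Factor.dirs]; rfl
  | node φ e =>
    simp [unroll, occ, Factor.dirs, EdgeTerm.coe_unroll, Occ.ctx, Function.comp_def]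
  | box G C ih =>
    have : ∀ o : Occ E B, (o.ectx ++ (o.nctx ++ [C])).reverse = C :: o.ctx.reverse := by
      intro o; simp [Occ.ctx]
    simp only [unroll, occ, Net.dirs_sum, ih, List.map_map, Function.comp_def, Occ.ctx]
    rw [← list_sum_finset_sum]
    congr 1
    refine List.map_congr_left fun o _ => ?_
    rw [this, envs]
    exact (map_sum (Multiset.mapAddMonoidHom _) _ _).symm
  | prod G H ihG ihH => simp [unroll, occ, ihG, ihH]

theorem mem_list_sum {α : Type*} {L : List (Multiset α)} {x : α} :
    x ∈ L.sum ↔ ∃ s ∈ L, x ∈ s := by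
  induction L with
  | nil => simp
  | cons s L ih => simp [ih]

theorem PreTensor.mem_dirs_unroll {G : PreTensor S E B} {ρ : Env B} {d : DirEdge (E × Env B)} :
    d ∈ (G.unroll n ρ).dirs ↔ ∃ o ∈ G.occ, ∃ ρ' ∈ envs n o.ctx.reverse ρ,
      o.dir.rename (fun a => (a, ρ')) = d := by
  rw [dirs_unroll, mem_list_sum]
  simp

theorem PreTensor.mem_names_unroll {G : PreTensor S E B} {ρ : Env B} {x : E × Env B} :
    x ∈ (G.unroll n ρ).names ↔ ∃ o ∈ G.occ, o.dir.name = x.1 ∧ x.2 ∈ envs n o.ctx.reverse ρ := by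
  simp only [Net.names, mem_dirs_unroll, Set.mem_ofPred_eq]
  constructor
  · rintro ⟨_, ⟨o, ho, ρ', hρ', rfl⟩, rfl⟩
    exact ⟨o, ho, by simp, by simpa using hρ'⟩
  · rintro ⟨o, ho, h, hρ'⟩
    exact ⟨_, ⟨o, ho, _, hρ', rfl⟩, by simp [h]⟩

theorem eq_of_mem_envs {l : List B} {ρ ρ' : Env B} (h : ρ' ∈ envs n l ρ) {X : B} (hX : X ∉ l) :
    ρ' X = ρ X := by
  induction l generalizing ρ with
  | nil => simp only [envs, Multiset.mem_singleton] at h; rw [h]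
  | cons C l ih =>
    simp only [envs, Multiset.mem_sum] at h
    obtain ⟨i, -, h⟩ := h
    simp only [List.mem_cons, not_or] at hX
    rw [ih h hX.2, Function.update_of_ne hX.1]

/-- The environments inside the !-boxes `l` do not depend on the order of `l`. -/
theorem mem_envs (hn : n.Local anc) {l r : List B} (hl : UpClosed anc (l.reverse ++ r))
    {ρ ρ' : Env B} :
    ρ' ∈ envs n l ρ ↔ (∀ X, X ∉ l → ρ' X = ρ X) ∧ ∀ C ∈ l, 0 < ρ' C ∧ ρ' C ≤ n C ρ' := by
  induction l generalizing ρ r with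
  | nil => simp [envs, funext_iff]
  | cons C l ih =>
    rw [List.reverse_cons, List.append_assoc, List.singleton_append] at hl
    have hnd := hl.nodup
    have hCl : C ∉ l := fun h =>
      (List.nodup_append.1 hnd).2.2 C (List.mem_reverse.2 h) C (by simp) rfl
    have hn' : (∀ X, X ∉ C :: l → ρ' X = ρ X) → n C ρ' = n C ρ := fun h =>
      hn _ _ _ fun D hD => h D <| by
        have := (hl.of_append.2.1 D hD).1
        refine fun h => ?_
        rcases List.mem_cons.1 h with rfl | h
        · exact hl.of_append.1 this
        · exact (List.nodup_append.1 hnd).2.2 D (List.mem_reverse.2 h) D (by simp [this]) rfl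
    simp only [envs, Multiset.mem_sum, Finset.mem_range, ih hl]
    constructor
    · rintro ⟨i, hi, h1, h2⟩
      have h3 : ρ' C = i + 1 := by simpa using h1 C hCl
      have h4 : ∀ X, X ∉ C :: l → ρ' X = ρ X := by
        intro X hX
        simp only [List.mem_cons, not_or] at hX
        rw [h1 X hX.2, Function.update_of_ne hX.1]
      refine ⟨h4, fun D hD => ?_⟩
      rcases List.mem_cons.1 hD with rfl | hD
      · rw [hn' h4, h3]; omega
      · exact h2 D hD
    · rintro ⟨h1, h2⟩
      have h3 := h2 C (by simp)
      rw [hn' h1] at h3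
      refine ⟨ρ' C - 1, by omega, fun X hX => ?_, fun D hD => h2 D (by simp [hD])⟩
      by_cases hXC : X = C
      · subst hXC; simp; omega
      · rw [Function.update_of_ne hXC, h1 X (by simp [hX, hXC])]

omit [DecidableEq B] in
theorem nodup_sum_range {α : Type*} {k : ℕ} {F : ℕ → Multiset α}
    (h1 : ∀ i < k, (F i).Nodup) (h2 : ∀ i < k, ∀ j < i, Disjoint (F j) (F i)) :
    (∑ i ∈ Finset.range k, F i).Nodup := by
  induction k with
  | zero => simp
  | succ k ih =>
    rw [Finset.sum_range_succ, Multiset.nodup_add]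
    refine ⟨ih (fun i hi => h1 i (by omega)) (fun i hi => h2 i (by omega)), h1 k (by omega), ?_⟩
    rw [Multiset.disjoint_left]
    intro x hx hxk
    obtain ⟨j, hj, hxj⟩ := Multiset.mem_sum.1 hx
    exact Multiset.disjoint_left.1 (h2 k (by omega) j (by simpa using hj)) hxj hxk

theorem nodup_envs {l : List B} (hl : l.Nodup) (ρ : Env B) : (envs n l ρ).Nodup := by
  induction l generalizing ρ with
  | nil => simp [envs]
  | cons C l ih =>
    rw [List.nodup_cons] at hl
    refine nodup_sum_range (fun i _ => ih hl.2 _) fun i _ j hj => ?_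
    rw [Multiset.disjoint_left]
    intro ρ' h1 h2
    have h3 := eq_of_mem_envs h1 hl.1
    have h4 := eq_of_mem_envs h2 hl.1
    simp only [Function.update_self] at h3 h4
    omega

theorem PreTensor.nodup_dirs_unroll {G : PreTensor S E B} (hG : G.dirs.Nodup)
    (hc : ∀ o ∈ G.occ, o.ctx.Nodup) (ρ : Env B) : (G.unroll n ρ).dirs.Nodup := by
  rw [dirs_unroll]
  unfold PreTensor.dirs at hG
  have hfst : ∀ (d : DirEdge E) (ρ : Env B),
      (d.rename fun a => (a, ρ)).rename Prod.fst = d := by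
    intro d ρ; cases d <;> rfl
  have hsnd : ∀ (d : DirEdge E) (ρ : Env B), (d.rename fun a => (a, ρ)).name.2 = ρ := by
    intro d ρ; cases d <;> rfl
  revert hG hc
  induction G.occ with
  | nil => simp
  | cons o L ih =>
    intro hG hc
    rw [List.map_cons, List.nodup_cons] at hG
    rw [List.map_cons, List.sum_cons]
    refine Multiset.nodup_add.2 ⟨?_, ih hG.2 fun o ho => hc o (by simp [ho]), ?_⟩
    · refine (nodup_envs (List.nodup_reverse.2 (hc o (by simp))) ρ).map fun ρ1 ρ2 h => ?_
      rw [← hsnd o.dir ρ1, ← hsnd o.dir ρ2]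
      exact congrArg (fun d => d.name.2) h
    · rw [Multiset.disjoint_left]
      intro d h1 h2
      obtain ⟨ρ1, -, rfl⟩ := Multiset.mem_map.1 h1
      obtain ⟨_, hs, h3⟩ := mem_list_sum.1 h2
      obtain ⟨o', ho', rfl⟩ := List.mem_map.1 hs
      obtain ⟨ρ2, -, h4⟩ := Multiset.mem_map.1 h3
      have := congrArg (DirEdge.rename Prod.fst) h4
      rw [hfst, hfst] at this
      exact hG.1 (this ▸ List.mem_map_of_mem ho')

/-- What is known about the name of an edge in the unrolled expression. -/
theorem PreTensor.Layered.of_mem_names {M : Set B} (hn : n.Local anc) {G : PreTensor S E B}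
    (hG : G.Layered anc []) (hM : ∀ C ∈ G.boxNames, C ∈ M) {x : E × Env B}
    (hx : x ∈ (G.unroll n 0).names) :
    x.1 ∈ G.edges ∧ (∀ X, x.2 X ≠ 0 → Proper anc M X) ∧ ∀ X, x.2 X ≤ n X x.2 := by
  obtain ⟨o, ho, h1, h2⟩ := mem_names_unroll.1 hx
  have hu := (hG.occ_ctx trivial o ho).1
  have hl : UpClosed anc (o.ctx.reverse.reverse ++ []) := by simpa [Occ.ctx] using hu
  obtain ⟨h3, h4⟩ := (mem_envs hn hl).1 h2
  have hlM : ∀ C ∈ o.ectx ++ (o.nctx ++ []), C ∈ M := by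
    intro C hC
    simp only [List.append_nil, List.mem_append] at hC
    rcases hC with h | h
    exacts [hM C (ectx_subset_boxNames o ho C h),
      hM C (boxes_subset_boxNames C (nctx_subset_boxes o ho C h))]
  refine ⟨?_, fun X hX => ?_, fun X => ?_⟩
  · rw [← h1]; exact List.mem_map_of_mem (List.mem_map_of_mem ho)
  · refine hu.proper hlM X ?_
    by_contra h
    exact hX (h3 X (by simpa [Occ.ctx, and_comm] using h))
  · by_cases h : X ∈ o.ctx
    · exact (h4 X (by simpa using h)).2
    · rw [h3 X (by simpa using h)]; simp

end Envs

/-! ### Concrete instances are unrollings -/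

theorem exists_perm_not_mem {α : Type*} [Infinite α] (s : Finset α) :
    ∃ f : Equiv.Perm α, ∀ a ∈ s, f a ∉ s := by
  classical
  have h : ∀ t : Finset α, ∃ f : Equiv.Perm α, ∀ a ∈ t, f a ∉ s := by
    intro t
    induction t using Finset.induction_on with
    | empty => exact ⟨1, by simp⟩
    | insert a t ha ih =>
      obtain ⟨f, hf⟩ := ih
      obtain ⟨c, hc⟩ := Infinite.exists_notMem_finset (s ∪ t.image f)
      simp only [Finset.mem_union, Finset.mem_image, not_or, not_exists, not_and] at hc
      refine ⟨Equiv.swap (f a) c * f, fun b hb => ?_⟩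
      rcases Finset.mem_insert.1 hb with rfl | hb
      · simpa using hc.1
      · have h1 : f b ≠ f a := fun h => ha (f.injective h ▸ hb)
        rw [Equiv.Perm.mul_apply, Equiv.swap_apply_of_ne_of_ne h1 (hc.2 b hb)]
        exact hf b hb
  exact h s

section Instances

variable {S E B : Type*} [DecidableEq B] {anc : B → Set B} {A : B}

/-- The net of an expression without !-boxes. -/
def PreTensor.net (X : PreTensor S E B) : Net S E :=
  (X.unroll (fun _ _ => 0) 0).rename Prod.fst

/-- All edge groups of `G` belong to !-boxes of `G`. -/
def PreTensor.GroupsInBoxes (G : PreTensor S E B) : Prop :=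
  ∀ o ∈ G.occ, ∀ C ∈ o.ectx, C ∈ G.boxes

/-- `X = Y` is the equation that arises from unrolling both sides of `G = H` with the counts `n` and
giving the copies of the edges their names by means of `f`. -/
structure Realizes (n : Count B) (f : E × Env B → E) (G H X Y : PreTensor S E B) : Prop where
  left_boxNames : X.boxNames = []
  right_boxNames : Y.boxNames = []
  left : X.net = (G.unroll n 0).rename f
  right : Y.net = (H.unroll n 0).rename f
  injOn : Set.InjOn f ((G.unroll n 0).names ∪ (H.unroll n 0).names)

theorem Realizes.of_rename {n n' : Count B} {f : E × Env B → E} {h : E × Env B → E × Env B}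
    {G H G' H' X Y : PreTensor S E B} (hr : Realizes n' f G' H' X Y)
    (hG : G'.unroll n' 0 = (G.unroll n 0).rename h) (hH : H'.unroll n' 0 = (H.unroll n 0).rename h)
    (hh : Set.InjOn h ((G.unroll n 0).names ∪ (H.unroll n 0).names)) :
    Realizes n (f ∘ h) G H X Y where
  left_boxNames := hr.left_boxNames
  right_boxNames := hr.right_boxNames
  left := by rw [hr.left, hG, Net.rename_rename]
  right := by rw [hr.right, hH, Net.rename_rename]
  injOn := by
    have := hr.injOn
    rw [hG, hH, Net.names_rename, Net.names_rename, ← Set.image_union] at this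
    exact this.comp hh (Set.mapsTo_image _ _)

@[simp] theorem Net.rename_id {F : Type*} (N : Net S F) : N.rename id = N := by
  have hd : (DirEdge.rename id : DirEdge F → DirEdge F) = id := by funext d; cases d <;> rfl
  have hx : (Factor.rename id : Factor S F → Factor S F) = id := by
    funext x; cases x <;> simp [Factor.rename, hd]
  simp [Net.rename, hx]

theorem PreTensor.unroll_congr {n n' : Count B} {K : B → Prop} (h : ∀ C, K C → n' C = n C)
    (G : PreTensor S E B) (hb : ∀ C ∈ G.boxes, K C) (he : ∀ o ∈ G.occ, ∀ C ∈ o.ectx, K C)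
    (ρ : Env B) : G.unroll n' ρ = G.unroll n ρ := by
  have hs : Simulates (E := E) n n' id id id id (fun _ => True) K :=
    ⟨fun _ _ _ => rfl, fun C hC ρ _ => by simp [h C hC], by simp, fun _ _ _ _ _ _ => rfl⟩
  have := PreTensor.unroll_map hs G hb he ρ trivial
  rwa [PreTensor.map_id, Net.rename_id] at this

theorem Realizes.done {G H : PreTensor S E B} (hG : G.boxNames = []) (hH : H.boxNames = [])
    (n : Count B) : Realizes n Prod.fst G H G H := by
  have key : ∀ X : PreTensor S E B, X.boxNames = [] →
      X.unroll (fun _ _ => 0) 0 = X.unroll n 0 ∧ ∀ x ∈ (X.unroll n 0).names, x.2 = 0 := by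
    intro X hX
    have h1 : ∀ C ∈ X.boxes, False := fun C hC => by
      have := PreTensor.boxes_subset_boxNames C hC; simp [hX] at this
    have h2 : ∀ o ∈ X.occ, ∀ C ∈ o.ectx, False := fun o ho C hC => by
      have := PreTensor.ectx_subset_boxNames o ho C hC; simp [hX] at this
    refine ⟨?_, ?_⟩
    · exact PreTensor.unroll_congr (K := fun _ => False) (by simp) X h1 h2 0
    · intro x hx
      obtain ⟨o, ho, -, hx⟩ := PreTensor.mem_names_unroll.1 hx
      have h3 : o.ectx = [] := List.eq_nil_iff_forall_not_mem.2 (h2 o ho)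
      have h4 : o.nctx = [] := List.eq_nil_iff_forall_not_mem.2 fun C hC =>
        h1 C (PreTensor.nctx_subset_boxes o ho C hC)
      simpa [Occ.ctx, h3, h4, envs] using hx
  refine ⟨hG, hH, by rw [PreTensor.net, (key G hG).1], by rw [PreTensor.net, (key H hH).1], ?_⟩
  intro x hx y hy hxy
  have h0 : ∀ x ∈ (G.unroll n 0).names ∪ (H.unroll n 0).names, x.2 = 0 := by
    rintro x (hx | hx)
    exacts [(key G hG).2 x hx, (key H hH).2 x hx]
  exact Prod.ext hxy ((h0 x hx).trans (h0 y hy).symm)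

theorem Count.Local.kill {n : Count B} (hn : n.Local anc) :
    Count.Local anc (fun C ρ => if C = A then 0 else n C ρ) := by
  intro C ρ ρ' h
  by_cases hC : C = A
  · simp [hC]
  · simp [hC, hn C ρ ρ' h]

theorem PreTensor.not_mem_boxes_kill (G : PreTensor S E B) : A ∉ (G.kill A).boxes := by
  unfold kill
  induction G with
  | one => simp [op, boxes]
  | idt a b => simp [op, boxes]
  | node φ e => simp [op, boxes]
  | box G C ih => by_cases hC : C = A <;> simp [op, hC, boxes, Ne.symm, ih]
  | prod G H ihG ihH => simp [op, boxes, ihG, ihH]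

/-- Replacing the number of copies of `A` by `0` is the effect of killing `A`. -/
theorem PreTensor.unroll_kill_eq (n : Count B) (G : PreTensor S E B) (ρ : Env B) :
    (G.kill A).unroll n ρ = G.unroll (fun C ρ => if C = A then 0 else n C ρ) ρ := by
  rw [← unroll_kill (A := A) (by simp) G ρ]
  refine unroll_congr (K := (· ≠ A)) (fun C hC => by simp [hC]) _ (fun C hC => ?_)
    (fun o ho C hC => ?_) ρ
  · rintro rfl; exact not_mem_boxes_kill G hC
  · rintro rfl; exact (occ_kill G o ho).2.1 hC

/-- The !-box names of an equation. -/
def namesOf (G H : PreTensor S E B) : Set B := {C | C ∈ G.boxNames ++ H.boxNames}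

variable {G H : PreTensor S E B} {fr : Fr E B}

theorem exp_of_not_mem (hA : A ∉ namesOf G H) : G.exp A fr = G ∧ H.exp A fr = H := by
  have : A ∉ G.boxNames ∧ A ∉ H.boxNames := by simpa [namesOf] using hA
  exact ⟨PreTensor.op_of_not_mem G this.1, PreTensor.op_of_not_mem H this.2⟩

/-- A renaming that keeps the names in the old copies of `A`, and gives the names in the new copies
fresh edge names and environments, is injective if the indices of the new copies can be read off. -/
theorem injOn_of_copy {M : Set B} {L : List E} {s : Set (E × Env B)} {n₁ : Count B}
    {h : E × Env B → E × Env B} (hs : ∀ x ∈ s, x.1 ∈ L ∧ ∀ X, x.2 X ≠ 0 → Proper anc M X)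
    (hL : ∀ a ∈ L, fr.edge a ∉ L) (hf : ∀ C ∈ M, fr.box C ∉ M)
    (hn₁ : n₁.Local (copyAnc anc M A fr.box)) (old : ∀ x ∈ s, x.2 A ≤ n₁ A x.2 → h x = x)
    (new : ∀ x ∈ s, ¬ x.2 A ≤ n₁ A x.2 → (h x).1 = fr.edge x.1 ∧
      ∀ X, X ≠ fr.box A → (h x).2 X = copyEnv anc M A fr.box n₁ x.2 X)
    (last : ∀ x ∈ s, ∀ y ∈ s, ¬ x.2 A ≤ n₁ A x.2 → ¬ y.2 A ≤ n₁ A y.2 → Proper anc M A →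
      h x = h y → n₁ A x.2 = n₁ A y.2 → x.2 A = y.2 A) : Set.InjOn h s := by
  intro x hx y hy hxy
  by_cases h1 : x.2 A ≤ n₁ A x.2 <;> by_cases h2 : y.2 A ≤ n₁ A y.2
  · rwa [old x hx h1, old y hy h2] at hxy
  · have : x.1 = fr.edge y.1 := by rw [← (new y hy h2).1, ← hxy, old x hx h1]
    exact absurd (this ▸ (hs x hx).1) (hL _ (hs y hy).1)
  · have : y.1 = fr.edge x.1 := by rw [← (new x hx h1).1, hxy, old y hy h2]
    exact absurd (this ▸ (hs y hy).1) (hL _ (hs x hx).1)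
  · have h3 : fr.edge x.1 = fr.edge y.1 := by rw [← (new x hx h1).1, hxy, (new y hy h2).1]
    have h4 : ∀ X, X ≠ fr.box A →
        copyEnv anc M A fr.box n₁ x.2 X = copyEnv anc M A fr.box n₁ y.2 X := fun X hX => by
      rw [← (new x hx h1).2 X hX, ← (new y hy h2).2 X hX, hxy]
    refine Prod.ext (fr.edge.injective h3) ?_
    have hAP : Proper anc M A := (hs x hx).2 A (by omega)
    have out : ∀ X ∈ M, X ≠ A → x.2 X = y.2 X := by
      intro X hX hXA
      by_cases hAX : A ∈ anc X
      · have h6 : fr.box X ≠ fr.box A := fun h => hXA (fr.box.injective h)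
        simpa only [copyEnv_inside hf hX hXA hAX] using h4 (fr.box X) h6
      · have h6 : X ≠ fr.box A := fun h => hf A hAP.1 (h ▸ hX)
        simpa only [copyEnv_outside hX hXA hAX] using h4 X h6
    have hloc : n₁ A x.2 = n₁ A y.2 := hn₁ _ _ _ fun D hD => by
      rw [copyAnc_of_mem hAP.1] at hD
      exact out D (hAP.2.2 D hD).1 (hAP.outside hAP.2.1 hD).1
    funext X
    by_cases hX : X ∈ M
    · by_cases hXA : X = A
      · rw [hXA, last x hx y hy h1 h2 hAP hxy hloc]
      · exact out X hX hXA
    · have zero : ∀ z ∈ s, z.2 X = 0 := fun z hz => by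
        by_contra h; exact hX ((hs z hz).2 X h).1
      rw [zero x hx, zero y hy]

theorem names_of_layered (hG : G.Layered anc []) (hH : H.Layered anc []) {n : Count B}
    (hn : n.Local anc) : ∀ x ∈ (G.unroll n 0).names ∪ (H.unroll n 0).names,
      x.1 ∈ G.edges ++ H.edges ∧ (∀ X, x.2 X ≠ 0 → Proper anc (namesOf G H) X) ∧
        x.2 A ≤ n A x.2 := by
  rintro x (hx | hx)
  · have := hG.of_mem_names hn (fun C hC => List.mem_append_left H.boxNames hC) hx
    exact ⟨List.mem_append_left _ this.1, this.2.1, this.2.2 A⟩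
  · have := hH.of_mem_names hn (fun C hC => List.mem_append_right G.boxNames hC) hx
    exact ⟨List.mem_append_right _ this.1, this.2.1, this.2.2 A⟩

/-- The edges of the unrolled equation keep different names in the unrolled copied equation. -/
theorem injOn_copyEdge (hG : G.Layered anc []) (hH : H.Layered anc [])
    (hfr : PreTensor.IsFresh fr G H) {n n₁ : Count B} (hn : n.Local anc)
    (hn₁ : n₁.Local (copyAnc anc (namesOf G H) A fr.box)) :
    Set.InjOn (copyEdge anc (namesOf G H) A fr n₁)
      ((G.unroll n 0).names ∪ (H.unroll n 0).names) := by
  have hs := names_of_layered (A := A) hG hH hn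
  have hf : ∀ C ∈ namesOf G H, fr.box C ∉ namesOf G H := hfr.2
  refine injOn_of_copy (fun x hx => ⟨(hs x hx).1, (hs x hx).2.1⟩) hfr.1 hf hn₁ ?_ ?_ ?_
  · intro x _ h
    simp [copyEdge, h]
  · intro x _ h
    simp [copyEdge, h]
  · intro x _ y _ h1 h2 hA hxy hxyA
    have h3 := congrFun (congrArg Prod.snd hxy) (fr.box A)
    simp only [copyEdge, h1, h2, if_false, copyEnv, hf A hA.1, Equiv.symm_apply_apply,
      if_true] at h3
    omega

/-- Unrolling an expanded equation is the same as unrolling the equation, up to an injective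
renaming of the edges: the fresh copy becomes the last copy of `A`. -/
theorem unroll_exp (hG : G.Layered anc []) (hH : H.Layered anc []) (hfr : PreTensor.IsFresh fr G H)
    (hA : A ∈ namesOf G H) {n n₁ n' : Count B} (hn : n.Local anc)
    (hn₁ : n₁.Local (copyAnc anc (namesOf G H) A fr.box))
    (hc : CopyCount anc (namesOf G H) A fr.box n n₁)
    (hd : DropCount (copyAnc anc (namesOf G H) A fr.box) Set.univ (fr.box A) n₁ n') :
    let h := dropName (fr.box A) ∘ copyEdge anc (namesOf G H) A fr n₁
    (G.exp A fr).unroll n' 0 = (G.unroll n 0).rename h ∧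
    (H.exp A fr).unroll n' 0 = (H.unroll n 0).rename h ∧
    Set.InjOn h ((G.unroll n 0).names ∪ (H.unroll n 0).names) := by
  intro h
  have hf : ∀ C ∈ namesOf G H, fr.box C ∉ namesOf G H := hfr.2
  have hfA : fr.box A ≠ A := fun h => hf A hA (h.symm ▸ hA)
  have step : ∀ K : PreTensor S E B, K.Layered anc [] → (∀ C ∈ K.boxNames, C ∈ namesOf G H) →
      (K.exp A fr).unroll n' 0 = (K.unroll n 0).rename h := by
    intro K hK hM
    rw [K.exp_eq_drop_copy hfA fun h => hf A hA (hM _ h),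
      PreTensor.unroll_drop hd _ (hK.copy hf (by simp) (by simp) hM) (by simp),
      PreTensor.unroll_copy hf hc hn₁ K hK hM, Net.rename_rename]
  refine ⟨step G hG fun C hC => List.mem_append_left _ hC,
    step H hH fun C hC => List.mem_append_right _ hC, ?_⟩
  have hs := names_of_layered (A := A) hG hH hn
  refine injOn_of_copy (fun x hx => ⟨(hs x hx).1, (hs x hx).2.1⟩) hfr.1 hf hn₁ ?_ ?_ ?_
  · intro x hx hxA
    simp only [h, Function.comp_apply, copyEdge, hxA, if_true, dropName]
    have h0 : x.2 (fr.box A) = 0 := by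
      by_contra h; exact hf A hA ((hs x hx).2.1 _ h).1
    refine Prod.ext rfl ?_
    simp [← h0]
  · intro x _ hxA
    refine ⟨by simp [h, copyEdge, hxA, dropName], fun X hX => ?_⟩
    simp [h, copyEdge, hxA, dropName, hX]
  · intro x hx y hy h1 h2 hAP _ hxy
    -- both names lie in the last copy of `A`
    have h5 := (hs x hx).2.2
    have h6 := (hs y hy).2.2
    rw [hc.base hAP, hd.one] at h5 h6
    omega

theorem layered_exp {K : PreTensor S E B} (hK : K.Layered anc []) (hfr : PreTensor.IsFresh fr G H)
    (hA : A ∈ namesOf G H) (hM : ∀ C ∈ K.boxNames, C ∈ namesOf G H) :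
    (K.exp A fr).Layered (dropAnc (copyAnc anc (namesOf G H) A fr.box) (fr.box A)) [] := by
  have hf : ∀ C ∈ namesOf G H, fr.box C ∉ namesOf G H := hfr.2
  have hfA : fr.box A ≠ A := fun h => hf A hA (h.symm ▸ hA)
  rw [K.exp_eq_drop_copy hfA fun h => hf A hA (hM _ h)]
  exact (hK.copy hf (by simp) (by simp) hM).drop (A := fr.box A)

/-- Every concrete instance of an equation is obtained by unrolling. -/
theorem Inst.realizes {X Y : PreTensor S E B} (h : PreTensor.Inst G H X Y) :
    ∀ anc : B → Set B, G.Layered anc [] → H.Layered anc [] →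
      ∃ n f, Count.Local anc n ∧ Realizes n f G H X Y := by
  induction h with
  | done hG hH => exact fun anc _ _ => ⟨fun _ _ => 0, _, fun _ _ _ _ => rfl, .done hG hH _⟩
  | @exp G H X Y A fr hfr _ ih =>
    intro anc hG hH
    by_cases hA : A ∈ namesOf G H
    · have hf : ∀ C ∈ namesOf G H, fr.box C ∉ namesOf G H := hfr.2
      obtain ⟨n', f, hn', hr⟩ := ih _ (layered_exp hG hfr hA fun C hC => List.mem_append_left _ hC)
        (layered_exp hH hfr hA fun C hC => List.mem_append_right _ hC)
      obtain ⟨n₁, hn₁, hd⟩ := exists_dropCount (M := Set.univ) hn'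
      obtain ⟨n, hn, hc⟩ := exists_copyCount hf hn₁
      obtain ⟨h1, h2, h3⟩ := unroll_exp hG hH hfr hA hn hn₁ hc hd
      exact ⟨n, _, hn, hr.of_rename h1 h2 h3⟩
    · have := exp_of_not_mem (fr := fr) hA
      rw [this.1, this.2] at ih
      exact ih anc hG hH
  | @kill G H X Y A _ ih =>
    intro anc hG hH
    obtain ⟨n, f, hn, hr⟩ := ih anc (hG.kill (by simp)) (hH.kill (by simp))
    refine ⟨_, f, hn.kill (A := A), hr.left_boxNames, hr.right_boxNames, ?_, ?_, ?_⟩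
    · rw [hr.left, PreTensor.unroll_kill_eq]
    · rw [hr.right, PreTensor.unroll_kill_eq]
    · have := hr.injOn
      rwa [PreTensor.unroll_kill_eq, PreTensor.unroll_kill_eq] at this

end Instances

/-! ### Every unrolling is a concrete instance -/

section Copies

variable {S E B : Type*} [DecidableEq B] {anc : B → Set B} {M : Set B} {A : B} {fr : Fr E B}

namespace PreTensor

/-- The total number of copies of !-boxes that are made when an expression is unrolled. -/
def copies (n : Count B) : PreTensor S E B → Env B → ℕ
  | one, _ => 0
  | idt _ _, _ => 0
  | node _ _, _ => 0
  | box G A, ρ => ∑ i ∈ Finset.range (n A ρ), (1 + G.copies n (Function.update ρ A (i + 1)))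
  | prod G H, ρ => G.copies n ρ + H.copies n ρ

theorem copies_map {n n' : Count B} {f : E → E} {g : B → B} {t : Env B → Env B}
    {h : E × Env B → E × Env B} {I : Env B → Prop} {K : B → Prop}
    (hs : Simulates n n' f g t h I K) (G : PreTensor S E B)
    (hb : ∀ C ∈ G.boxes, K C) (ρ : Env B) (hρ : I ρ) :
    (G.map f g).copies n' (t ρ) = G.copies n ρ := by
  induction G generalizing ρ with
  | one => rfl
  | idt a b => rfl
  | node φ e => rfl
  | box G A ih =>
    have hA : K A := hb A (by simp [boxes])
    simp only [copies, PreTensor.map, hs.count A hA ρ hρ]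
    refine Finset.sum_congr rfl fun i hi => ?_
    rw [Finset.mem_range] at hi
    rw [← hs.update A hA ρ hρ i hi,
      ih (fun C hC => hb C (by simp [boxes, hC])) _ (hs.inv A hA ρ hρ i hi)]
  | prod G H ihG ihH =>
    simp only [copies, PreTensor.map]
    rw [ihG (fun C hC => hb C (by simp [boxes, hC])) ρ hρ,
      ihH (fun C hC => hb C (by simp [boxes, hC])) ρ hρ]

theorem copies_kill_le (n : Count B) (G : PreTensor S E B) (ρ : Env B) :
    (G.kill A).copies (fun C ρ => if C = A then 0 else n C ρ) ρ ≤ G.copies n ρ := by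
  unfold kill
  induction G generalizing ρ with
  | one => simp [op, copies]
  | idt a b => simp [op, copies]
  | node φ e => simp [op, copies]
  | box G C ih =>
    by_cases hC : C = A
    · simp [op, hC, copies]
    · simp only [op, if_neg hC, copies]
      exact Finset.sum_le_sum fun i _ => Nat.add_le_add_left (ih _) 1
  | prod G H ihG ihH => exact Nat.add_le_add (ihG ρ) (ihH ρ)

/-- Expanding a top-level !-box `A` uses up one of its copies. -/
theorem copies_exp (hfr : ∀ C ∈ M, fr.box C ∉ M) {n n₁ n' : Count B}
    (hc : CopyCount anc M A fr.box n n₁) (hn₁ : n₁.Local (copyAnc anc M A fr.box))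
    (hd : DropCount (copyAnc anc M A fr.box) Set.univ (fr.box A) n₁ n') (hA : A ∈ M)
    (hanc : anc A = ∅) (G : PreTensor S E B) (r : List B) (hAr : A ∉ r)
    (hG : G.Layered anc r) (hr : ∀ C ∈ r, C ∈ M) (hM : ∀ C ∈ G.boxNames, C ∈ M)
    (ρ : Env B) (hρ : OutsideEnv anc M A ρ) :
    (G.exp A fr).copies n' ρ + (if A ∈ G.boxes then 1 else 0) ≤ G.copies n ρ := by
  have hfA : fr.box A ∉ M := hfr A hA
  have hout : ∀ C, Proper anc M C → ∀ ρ, n' C ρ = n₁ C ρ := by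
    intro C hC ρ
    have h2 : Proper (copyAnc anc M A fr.box) Set.univ C := by
      refine ⟨trivial, ?_, fun D hD => ⟨trivial, ?_⟩⟩
      · rw [copyAnc_of_mem hC.1]; exact hC.2.1
      · rw [copyAnc_of_mem hC.1] at hD ⊢
        rw [copyAnc_of_mem (hC.2.2 D hD).1]; exact (hC.2.2 D hD).2
    refine hd.outside C h2 (by rintro rfl; exact hfA hC.1) ?_ ρ
    rw [copyAnc_of_mem hC.1]
    exact fun h => hfA (hC.2.2 _ h).1
  have hsame : Simulates (E := E) n₁ n' id id id id (fun _ => True) (Proper anc M) :=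
    ⟨fun _ _ _ => rfl, fun C hC ρ _ => hout C hC ρ, by simp, fun _ _ _ _ _ _ => rfl⟩
  unfold exp
  induction G generalizing r ρ with
  | one => simp [op, copies, boxes]
  | idt a b => simp [op, copies, boxes]
  | node φ e => simp [op, copies, boxes]
  | box G C ih =>
    have hCM : C ∈ M := hM C (by simp [boxNames])
    have hr' : ∀ D ∈ C :: r, D ∈ M := by simpa [hCM] using hr
    have hCP : Proper anc M C := hG.1.proper hr' C (by simp)
    by_cases hC : C = A
    · subst hC
      have hi := hG.inner hM hr
      have hu : ∀ i, n₁ C (Function.update ρ C i) = n₁ C ρ := fun i =>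
        hn₁.copy hCM hCP.2.1 ρ i
      have h1 : ∀ i < n₁ C ρ, G.copies n' (Function.update ρ C (i + 1)) =
          G.copies n (Function.update ρ C (i + 1)) := by
        intro i hlt
        have e1 := copies_map hsame G (fun D hD => (hi.1 D hD).1) (Function.update ρ C (i + 1))
          trivial
        have e2 := copies_map (hc.simulates_old hn₁ hCM) G
          (fun D hD => ⟨(hi.1 D hD).1, (hi.1 D hD).2.1, (hi.1 D hD).2.2.1⟩)
          (Function.update ρ C (i + 1)) (by rw [hu, Function.update_self]; omega)
        rw [map_id] at e1 e2
        exact e1.trans e2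
      have h2 : (G.fresh fr).copies n' ρ =
          G.copies n (Function.update ρ C (n₁ C ρ + 0 + 1)) := by
        have e1 := copies_map (hd.simulates (E := E)) (G.fresh fr) (fun D' hD' => by
          rw [fresh, boxes_map] at hD'
          obtain ⟨D, hD, rfl⟩ := List.mem_map.1 hD'
          simp only [hD, if_true]
          exact fun h => (hi.1 D hD).2.1 (fr.box.injective h))
          (Function.update ρ (fr.box C) 1) (by simp)
        have e2 := copies_map (hc.simulates_new hfr hn₁ hCM
          (fun D => if D ∈ G.boxes then fr.box D else D)) G
          (fun D hD => ⟨⟨(hi.1 D hD).1, (hi.1 D hD).2.1, (hi.1 D hD).2.2.1⟩,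
            (map_fresh_eq_copyName hG).1 D hD⟩)
          (Function.update ρ C (n₁ C ρ + 0 + 1)) (by rw [hu, Function.update_self]; omega)
        rw [hρ.copyEnv_start hfr hn₁ hCP 0] at e2
        rw [map_id] at e1
        rw [← e2, fresh, zero_add]
        rw [fresh] at e1
        rw [← e1]
        simp [← hρ (fr.box C) (.inl hfA)]
      simp only [op, if_true, copies, boxes, List.mem_cons, true_or, hout C hCP, hc.base hCP,
        hd.one, Finset.sum_range_succ, h2]
      rw [Finset.sum_congr rfl fun i hi => by rw [h1 i (by simpa using hi)]]
      simp only [add_zero]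
      omega
    · have hAC : A ∉ anc C := fun h => hAr (hG.1.2.1 A h).1
      have hAG : A ∉ (box G C).boxes := by
        simp only [boxes, List.mem_cons, not_or]
        refine ⟨Ne.symm hC, fun h => ?_⟩
        obtain ⟨s, -, hs, -⟩ := hG.2.2.2.box_ctx A h
        have := hs C (by simp)
        simp [hanc] at this
      simp only [op, if_neg hC, copies, if_neg hAG, add_zero, hout C hCP,
        hc.outside C hCP hC hAC ρ]
      refine Finset.sum_le_sum fun i hi => Nat.add_le_add_left ?_ 1
      refine le_trans (Nat.le_add_right _ _) (ih (C :: r) (by simp [hAr, Ne.symm hC]) hG.2.2.2 hr'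
        (fun D hD => hM D (by simp [boxNames, hD])) _
        (hc.agreeOutside.inv C hCP hC hAC ρ hρ i ?_))
      rw [hc.outside C hCP hC hAC ρ]
      simpa using hi
  | prod G H ihG ihH =>
    have h1 := ihG r hAr hG.1 hr (fun C hC => hM C (by simp [boxNames, hC])) ρ hρ
    have h2 := ihH r hAr hG.2 hr (fun C hC => hM C (by simp [boxNames, hC])) ρ hρ
    simp only [op, copies, boxes, List.mem_append]
    split_ifs at h1 h2 ⊢ <;> first | omega | (exfalso; tauto)

theorem _root_.BangTensor.EdgeTerm.boxNames_kill (e : EdgeTerm E B) :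
    (e.op A (fun _ => .eps) (fun _ => .eps)).boxNames.length ≤
      (e.boxNames.filter (· ≠ A)).length := by
  induction e with
  | eps => simp [EdgeTerm.op, EdgeTerm.boxNames]
  | edge d => simp [EdgeTerm.op, EdgeTerm.boxNames]
  | clock e C ih =>
    by_cases hC : C = A
    · simp [EdgeTerm.op, EdgeTerm.boxNames, hC]
    · simpa [EdgeTerm.op, EdgeTerm.boxNames, hC] using ih
  | anti e C ih =>
    by_cases hC : C = A
    · simp [EdgeTerm.op, EdgeTerm.boxNames, hC]
    · simpa [EdgeTerm.op, EdgeTerm.boxNames, hC] using ih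
  | cat e f ihe ihf =>
    simp only [EdgeTerm.op, EdgeTerm.boxNames, List.length_append, List.filter_append]
    omega

theorem boxNames_kill (G : PreTensor S E B) :
    (G.kill A).boxNames.length ≤ (G.boxNames.filter (· ≠ A)).length := by
  unfold kill
  induction G with
  | one => simp [op, boxNames]
  | idt a b => simp [op, boxNames]
  | node φ e => exact EdgeTerm.boxNames_kill e
  | box G C ih =>
    by_cases hC : C = A
    · simp [op, boxNames, hC]
    · simpa [op, boxNames, hC] using ih
  | prod G H ihG ihH =>
    simp only [op, boxNames, List.length_append, List.filter_append]
    omega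

theorem GroupsInBoxes.kill {G : PreTensor S E B} (hG : G.Layered anc []) (hg : G.GroupsInBoxes) :
    (G.kill A).GroupsInBoxes := by
  intro o ho X hX
  obtain ⟨h1, h2, h3⟩ := occ_kill G o ho
  refine boxes_kill hG X (hg o h1 X hX) (by rintro rfl; exact h2 hX) fun hAX => ?_
  have := (hG.occ_ctx trivial o h1).1.anc_mem (List.mem_append_left _ hX) hAX
  simp only [List.mem_append, List.not_mem_nil, or_false] at this
  tauto

theorem GroupsInBoxes.exp {G : PreTensor S E B} (hfr : ∀ C ∈ M, fr.box C ∉ M) (hA : A ∈ M)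
    (hG : G.Layered anc []) (hM : ∀ C ∈ G.boxNames, C ∈ M) (hg : G.GroupsInBoxes) :
    (G.exp A fr).GroupsInBoxes := by
  have hfA : fr.box A ≠ A := fun h => hfr A hA (h.symm ▸ hA)
  have hcopy := hG.copy (A := A) hfr (by simp) (by simp) hM
  intro o ho X hX
  rw [G.exp_eq_drop_copy hfA fun h => hfr A hA (hM _ h)] at ho ⊢
  rw [occ_drop hcopy trivial] at ho
  obtain ⟨o₁, h1, rfl⟩ := List.mem_map.1 ho
  rw [List.mem_filter] at hX
  rw [boxes_drop hcopy, List.mem_filter]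
  refine ⟨?_, hX.2⟩
  obtain ⟨o₂, h2, h3 | h3⟩ := occ_copy hG o₁ h1
  · exact (boxes_copy hG (by simp) X (hg o₂ h2 X (h3 ▸ hX.1))).1
  · have := hX.1
    rw [h3] at this
    obtain ⟨X', hX', rfl⟩ := List.mem_map.1 this
    exact (boxes_copy hG (by simp) X' (hg o₂ h2 X' hX')).2

omit [DecidableEq B] in
theorem Layered.exists_top {G : PreTensor S E B} (hG : G.Layered anc []) (hb : G.boxes ≠ []) :
    ∃ A ∈ G.boxes, anc A = ∅ := by
  induction G with
  | one => simp [boxes] at hb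
  | idt a b => simp [boxes] at hb
  | node φ e => simp [boxes] at hb
  | box G A ih =>
    refine ⟨A, by simp [boxes], Set.eq_empty_of_forall_notMem fun D hD => ?_⟩
    simpa using (hG.1.2.1 D hD).1
  | prod G H ihG ihH =>
    by_cases h : G.boxes = []
    · obtain ⟨A, hA, h'⟩ := ihH hG.2 (by simpa [boxes, h] using hb)
      exact ⟨A, by simp [boxes, hA], h'⟩
    · obtain ⟨A, hA, h'⟩ := ihG hG.1 h
      exact ⟨A, by simp [boxes, hA], h'⟩

end PreTensor

open PreTensor

theorem exists_isFresh [DecidableEq E] [Infinite E] [Infinite B] (G H : PreTensor S E B) :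
    ∃ fr : Fr E B, IsFresh fr G H := by
  obtain ⟨f, hf⟩ := exists_perm_not_mem (G.edges ++ H.edges).toFinset
  obtain ⟨g, hg⟩ := exists_perm_not_mem (G.boxNames ++ H.boxNames).toFinset
  exact ⟨⟨f, g⟩, by simpa only [List.mem_toFinset] using hf,
    by simpa only [List.mem_toFinset] using hg⟩

/-- Every unrolling of an equation is a concrete instance: expand a top-level !-box as long as it has
copies left, and then kill it. -/
theorem exists_inst [DecidableEq E] [Infinite E] [Infinite B] (G H : PreTensor S E B)
    (anc : B → Set B) (n : Count B) (hG : G.Layered anc []) (hH : H.Layered anc [])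
    (hgG : G.GroupsInBoxes) (hgH : H.GroupsInBoxes) (hn : n.Local anc) :
    ∃ X Y f, Inst G H X Y ∧ Realizes n f G H X Y := by
  -- an expansion uses up a copy; killing a !-box may not, but removes its name
  obtain ⟨m, hm⟩ : ∃ m, G.copies n 0 + H.copies n 0 = m := ⟨_, rfl⟩
  obtain ⟨k, hk⟩ : ∃ k, (G.boxNames ++ H.boxNames).length = k := ⟨_, rfl⟩
  induction m using Nat.strong_induction_on generalizing G H anc n k with
  | _ m ihm =>
  induction k using Nat.strong_induction_on generalizing G H anc n with
  | _ k ihk =>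
  -- killing a !-box without copies
  have hkill : ∀ A ∈ namesOf G H, (A ∈ G.boxes ++ H.boxes → ∀ ρ, n A ρ = 0) →
      ∃ X Y f, Inst G H X Y ∧ Realizes n f G H X Y := by
    intro A hA hA0
    set n₀ : Count B := fun C ρ => if C = A then 0 else n C ρ with hn₀
    have hun : ∀ K : PreTensor S E B, (A ∈ K.boxes → ∀ ρ, n A ρ = 0) → K.GroupsInBoxes →
        (K.kill A).unroll n₀ 0 = K.unroll n 0 := by
      intro K hK hg
      rw [unroll_kill (by simp [hn₀])]
      refine unroll_congr (K := fun C => C ∈ K.boxes) (fun C hC => ?_) K (fun _ h => h) hg 0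
      by_cases hCA : C = A
      · subst hCA; funext ρ; simp [hn₀, hK hC]
      · simp [hn₀, hCA]
    have huG := hun G (fun h => hA0 (List.mem_append_left _ h)) hgG
    have huH := hun H (fun h => hA0 (List.mem_append_right _ h)) hgH
    have hlen : ((G.kill A).boxNames ++ (H.kill A).boxNames).length < k := by
      rw [List.length_append]
      have h1 := boxNames_kill (A := A) G
      have h2 := boxNames_kill (A := A) H
      have h3 : ((G.boxNames ++ H.boxNames).filter (· ≠ A)).length <
          (G.boxNames ++ H.boxNames).length :=
        List.length_filter_lt_length_iff_exists.2 ⟨A, hA, by simp⟩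
      rw [List.filter_append, List.length_append, hk] at h3
      omega
    have hle := Nat.add_le_add (copies_kill_le (A := A) n G 0) (copies_kill_le (A := A) n H 0)
    rw [hm] at hle
    obtain ⟨X, Y, f, h1, h2⟩ : ∃ X Y f, Inst (G.kill A) (H.kill A) X Y ∧
        Realizes n₀ f (G.kill A) (H.kill A) X Y := by
      rcases hle.lt_or_eq with hlt | heq
      · exact ihm _ hlt _ _ anc n₀ (hG.kill (by simp)) (hH.kill (by simp)) (hgG.kill hG)
          (hgH.kill hH) hn.kill rfl _ rfl
      · exact ihk _ hlen _ _ anc n₀ (hG.kill (by simp)) (hH.kill (by simp)) (hgG.kill hG)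
          (hgH.kill hH) hn.kill heq rfl
    refine ⟨X, Y, f, .kill A h1, h2.left_boxNames, h2.right_boxNames, ?_, ?_, ?_⟩
    · rw [h2.left, huG]
    · rw [h2.right, huH]
    · rw [← huG, ← huH]; exact h2.injOn
  by_cases hb : ∃ A ∈ namesOf G H, A ∉ G.boxes ++ H.boxes
  · obtain ⟨A, hA, hA'⟩ := hb
    exact hkill A hA fun h => absurd h hA'
  push Not at hb
  by_cases h0 : G.boxes ++ H.boxes = []
  · have h1 : ∀ C, C ∉ G.boxNames ++ H.boxNames := fun C hC => by
      have := hb C hC; simp [h0] at this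
    have h2 : G.boxNames ++ H.boxNames = [] := List.eq_nil_iff_forall_not_mem.2 h1
    rw [List.append_eq_nil_iff] at h2
    exact ⟨G, H, _, .done h2.1 h2.2, .done h2.1 h2.2 n⟩
  · obtain ⟨A, hA, hanc⟩ : ∃ A ∈ G.boxes ++ H.boxes, anc A = ∅ := by
      obtain ⟨A, hA, h⟩ := Layered.exists_top (G := G.prod H) ⟨hG, hH⟩ h0
      exact ⟨A, hA, h⟩
    have hAM : A ∈ namesOf G H := by
      rcases List.mem_append.1 hA with h | h
      exacts [List.mem_append_left _ (boxes_subset_boxNames A h),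
        List.mem_append_right _ (boxes_subset_boxNames A h)]
    have hn0 : ∀ ρ, n A ρ = n A 0 := fun ρ => hn _ _ _ (by simp [hanc])
    rcases hk0 : n A 0 with _ | j
    · exact hkill A hAM fun _ ρ => (hn0 ρ).trans hk0
    · obtain ⟨fr, hfr⟩ := exists_isFresh G H
      have hf : ∀ C ∈ namesOf G H, fr.box C ∉ namesOf G H := hfr.2
      obtain ⟨n₁, hn₁, hc, -, h1⟩ := exists_copyCount_split hf hn hAM hanc hk0
      obtain ⟨hn', hd⟩ := DropCount.of_count (M := Set.univ) hn₁ h1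
      set n' : Count B := fun C ρ => n₁ C (Function.update ρ (fr.box A) 1)
      have hGM : ∀ C ∈ G.boxNames, C ∈ namesOf G H := fun C hC => List.mem_append_left _ hC
      have hHM : ∀ C ∈ H.boxNames, C ∈ namesOf G H := fun C hC => List.mem_append_right _ hC
      have hcG := copies_exp hf hc hn₁ hd hAM hanc G [] (by simp) hG (by simp) hGM 0 fun _ _ => rfl
      have hcH := copies_exp hf hc hn₁ hd hAM hanc H [] (by simp) hH (by simp) hHM 0 fun _ _ => rfl
      have hlt : (G.exp A fr).copies n' 0 + (H.exp A fr).copies n' 0 < m := by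
        rcases List.mem_append.1 hA with h | h
        · rw [if_pos h] at hcG; omega
        · rw [if_pos h] at hcH; omega
      obtain ⟨X, Y, f, h2, h3⟩ := ihm _ hlt (G.exp A fr) (H.exp A fr) _ n'
        (layered_exp hG hfr hAM hGM) (layered_exp hH hfr hAM hHM) (hgG.exp hf hAM hG hGM)
        (hgH.exp hf hAM hH hHM) hn' rfl _ rfl
      obtain ⟨h4, h5, h6⟩ := unroll_exp hG hH hfr hAM hn hn₁ hc hd
      exact ⟨X, Y, _, .exp A fr hfr h2, h3.of_rename h4 h5 h6⟩

end Copies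

/-! ### Equational reasoning with concrete expressions -/

section Concrete

variable {S E B : Type*}

theorem EdgeTerm.boxNames_map (f : E → E) (g : B → B) (e : EdgeTerm E B) :
    (e.map f g).boxNames = e.boxNames.map g := by
  induction e with
  | eps => rfl
  | edge d => rfl
  | clock e A ih => simp [boxNames, EdgeTerm.map, ih]
  | anti e A ih => simp [boxNames, EdgeTerm.map, ih]
  | cat e f ihe ihf => simp [boxNames, EdgeTerm.map, ihe, ihf]

theorem EdgeTerm.map_map (f f' : E → E) (g g' : B → B) (e : EdgeTerm E B) :
    (e.map f g).map f' g' = e.map (f' ∘ f) (g' ∘ g) := by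
  induction e with
  | eps => rfl
  | edge d => cases d <;> rfl
  | clock e A ih => simp [EdgeTerm.map, ih]
  | anti e A ih => simp [EdgeTerm.map, ih]
  | cat e f ihe ihf => simp [EdgeTerm.map, ihe, ihf]

theorem EdgeTerm.map_congr {f f' : E → E} (g : B → B) (e : EdgeTerm E B)
    (h : ∀ p ∈ e.occ, f p.1.name = f' p.1.name) : e.map f g = e.map f' g := by
  induction e with
  | eps => rfl
  | edge d =>
    have := h (d, []) (by simp [occ])
    cases d <;> simpa [EdgeTerm.map, DirEdge.map, DirEdge.name] using this
  | clock e A ih =>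
    simp only [EdgeTerm.map]
    rw [ih fun p hp => h (p.1, p.2 ++ [A]) (List.mem_map.2 ⟨p, hp, rfl⟩)]
  | anti e A ih =>
    simp only [EdgeTerm.map]
    rw [ih fun p hp => h (p.1, p.2 ++ [A]) (List.mem_map.2 ⟨p, hp, rfl⟩)]
  | cat e f ihe ihf =>
    simp only [EdgeTerm.map]
    rw [ihe fun p hp => h p (by simp [occ, hp]), ihf fun p hp => h p (by simp [occ, hp])]

namespace PreTensor

theorem boxNames_map (f : E → E) (g : B → B) (G : PreTensor S E B) :
    (G.map f g).boxNames = G.boxNames.map g := by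
  induction G with
  | one => rfl
  | idt a b => rfl
  | node φ e => exact EdgeTerm.boxNames_map f g e
  | box G A ih => simp [boxNames, PreTensor.map, ih]
  | prod G H ihG ihH => simp [boxNames, PreTensor.map, ihG, ihH]

theorem map_map (f f' : E → E) (g g' : B → B) (G : PreTensor S E B) :
    (G.map f g).map f' g' = G.map (f' ∘ f) (g' ∘ g) := by
  induction G with
  | one => rfl
  | idt a b => rfl
  | node φ e => simp [PreTensor.map, EdgeTerm.map_map]
  | box G A ih => simp [PreTensor.map, ih]
  | prod G H ihG ihH => simp [PreTensor.map, ihG, ihH]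

theorem map_congr_occ {f f' : E → E} (g : B → B) (G : PreTensor S E B)
    (h : ∀ o ∈ G.occ, f o.dir.name = f' o.dir.name) : G.map f g = G.map f' g := by
  induction G with
  | one => rfl
  | idt a b =>
    have h1 := h ⟨.out a, [], []⟩ (by simp [occ])
    have h2 := h ⟨.inp b, [], []⟩ (by simp [occ])
    simp only [DirEdge.name] at h1 h2
    simp [PreTensor.map, h1, h2]
  | node φ e =>
    simp only [PreTensor.map]
    rw [EdgeTerm.map_congr g e fun p hp => h ⟨p.1, p.2, []⟩ (List.mem_map.2 ⟨p, hp, rfl⟩)]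
  | box G A ih =>
    simp only [PreTensor.map]
    rw [ih fun o ho => h ⟨o.dir, o.ectx, o.nctx ++ [A]⟩ (List.mem_map.2 ⟨o, ho, rfl⟩)]
  | prod G H ihG ihH =>
    simp only [PreTensor.map]
    rw [ihG fun o ho => h o (by simp [occ, ho]), ihH fun o ho => h o (by simp [occ, ho])]

theorem map_congr {f f' : E → E} (g : B → B) (G : PreTensor S E B)
    (h : ∀ a ∈ G.edges, f a = f' a) : G.map f g = G.map f' g :=
  map_congr_occ g G fun _ ho => h _ (List.mem_map_of_mem (List.mem_map_of_mem ho))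

theorem dirs_map (f : E → E) (g : B → B) (G : PreTensor S E B) :
    (G.map f g).dirs = G.dirs.map (DirEdge.map f) := by
  simp [dirs, PreTensor.occ_map, Function.comp_def]

@[simp] theorem dirs_prod (G H : PreTensor S E B) : (prod G H).dirs = G.dirs ++ H.dirs := by
  simp [dirs, occ]

theorem isConcrete_of_nodup {X : PreTensor S E B} (hX : X.boxNames = []) (hd : X.dirs.Nodup) :
    X.IsConcrete := by
  have h1 : X.boxes = [] := List.eq_nil_iff_forall_not_mem.2 fun C hC => by
    have := boxes_subset_boxNames C hC; simp [hX] at this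
  have h2 : ∀ o ∈ X.occ, o.ectx = [] := fun o ho => List.eq_nil_iff_forall_not_mem.2
    fun C hC => by have := ectx_subset_boxNames o ho C hC; simp [hX] at this
  have h3 : ∀ o ∈ X.occ, o.nctx = [] := fun o ho => List.eq_nil_iff_forall_not_mem.2
    fun C hC => by have := nctx_subset_boxes o ho C hC; simp [h1] at this
  refine ⟨⟨hd, by simp [h1], ?_, ?_, ?_, ?_, ?_⟩, hX⟩
  · intro o ho; simp [h2 o ho]
  · intro o ho; simp [h2 o ho]
  · intro o ho; simp [h2 o ho]
  · intro o ho; simp [h2 o ho]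
  · intro a i hi o ho _ _
    exact ⟨[], [], by simp [h2 o ho, h3 i hi], by simp [h2 i hi, h3 o ho]⟩

theorem IsConcrete.nodup {X : PreTensor S E B} (hX : X.IsConcrete) : X.dirs.Nodup :=
  hX.1.edges_nodup

end PreTensor

section Net

variable [DecidableEq B]

/-- The list of the edges of an edgeterm without edge groups. -/
def EdgeTerm.flat (e : EdgeTerm E B) : List (DirEdge E) :=
  (e.unroll (fun _ _ => 0) 0).map (DirEdge.rename Prod.fst)

/-- The edgeterm that lists the given edges. -/
def EdgeTerm.ofList : List (DirEdge E) → EdgeTerm E B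
  | [] => eps
  | d :: l => cat (edge d) (ofList l)

omit [DecidableEq B] in
theorem EdgeTerm.ofList_append (l l' : List (DirEdge E)) :
    (cat (ofList l) (ofList l') : EdgeTerm E B).Equiv (ofList (l ++ l')) := by
  induction l with
  | nil => exact .eps_cat _
  | cons d l ih => exact .trans (.symm (.assoc _ _ _)) (.cat (.refl _) ih)

theorem EdgeTerm.equiv_ofList_flat (e : EdgeTerm E B) (he : e.boxNames = []) :
    e.Equiv (ofList e.flat) := by
  induction e with
  | eps => exact .refl _
  | edge d =>
    have : (edge d : EdgeTerm E B).flat = [d] := by cases d <;> rfl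
    rw [this]
    exact .symm (.cat_eps _)
  | clock e A ih => simp [boxNames] at he
  | anti e A ih => simp [boxNames] at he
  | cat e f ihe ihf =>
    simp only [boxNames, List.append_eq_nil_iff] at he
    have : (cat e f).flat = e.flat ++ f.flat := by simp [flat, unroll]
    rw [this]
    exact .trans (.cat (ihe he.1) (ihf he.2)) (ofList_append _ _)

theorem EdgeTerm.occ_eq_flat (e : EdgeTerm E B) (he : e.boxNames = []) :
    e.occ.map Prod.fst = e.flat := by
  induction e with
  | eps => rfl
  | edge d => cases d <;> rfl
  | clock e A ih => simp [boxNames] at he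
  | anti e A ih => simp [boxNames] at he
  | cat e f ihe ihf =>
    simp only [boxNames, List.append_eq_nil_iff] at he
    have : (cat e f).flat = e.flat ++ f.flat := by simp [flat, unroll]
    simp [this, occ, ihe he.1, ihf he.2]

omit [DecidableEq B] in
theorem EdgeTerm.occ_ofList (l : List (DirEdge E)) :
    (ofList l : EdgeTerm E B).occ.map Prod.fst = l := by
  induction l with
  | nil => rfl
  | cons d l ih => simp [ofList, occ, ih]

omit [DecidableEq B] in
theorem EdgeTerm.boxNames_ofList (l : List (DirEdge E)) :
    (ofList l : EdgeTerm E B).boxNames = [] := by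
  induction l with
  | nil => rfl
  | cons d l ih => simp [ofList, boxNames, ih]

/-- A factor as an expression. -/
def Factor.toTensor : Factor S E → PreTensor S E B
  | node φ l => .node φ (EdgeTerm.ofList l)
  | idt a b => .idt a b

namespace PreTensor

/-- The product of a list of factors. -/
def ofList : List (Factor S E) → PreTensor S E B
  | [] => one
  | x :: l => prod x.toTensor (ofList l)

@[simp] theorem net_idt (a b : E) : (idt a b : PreTensor S E B).net = {.idt a b} := rfl

@[simp] theorem net_node (φ : S) (e : EdgeTerm E B) : (node φ e).net = {.node φ e.flat} := rfl

@[simp] theorem net_prod (G H : PreTensor S E B) : (prod G H).net = G.net + H.net := by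
  simp [net, unroll]

theorem net_map (σ : E → E) (G : PreTensor S E B) : (G.map σ id).net = G.net.rename σ := by
  have hs : Simulates (B := B) (E := E) (fun _ _ => 0) (fun _ _ => 0) σ id id
      (fun x => (σ x.1, x.2)) (fun _ => True) (fun _ => True) :=
    ⟨fun _ _ _ => rfl, by simp, by simp, by simp⟩
  have := unroll_map hs G (by simp) (by simp) 0 trivial
  rw [net, show (0 : Env B) = id 0 from rfl, this, net, Net.rename_rename, Net.rename_rename]
  rfl

theorem coe_dirs (G : PreTensor S E B) (hG : G.boxNames = []) :
    (G.dirs : Multiset (DirEdge E)) = G.net.dirs := by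
  induction G with
  | one => rfl
  | idt a b => simp [dirs, occ, Factor.dirs]
  | node φ e =>
    simp [dirs, occ, Factor.dirs, Function.comp_def, ← EdgeTerm.occ_eq_flat e hG]
  | box G A ih => simp [boxNames] at hG
  | prod G H ihG ihH =>
    simp only [boxNames, List.append_eq_nil_iff] at hG
    simp [← ihG hG.1, ← ihH hG.2]

omit [DecidableEq B] in
theorem boxNames_ofList (l : List (Factor S E)) : (ofList l : PreTensor S E B).boxNames = [] := by
  induction l with
  | nil => rfl
  | cons x l ih => cases x <;> simp [ofList, boxNames, ih, Factor.toTensor, EdgeTerm.boxNames_ofList]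

omit [DecidableEq B] in
theorem dirs_ofList (l : List (Factor S E)) :
    (ofList l : PreTensor S E B).dirs = l.flatMap Factor.dirs := by
  induction l with
  | nil => rfl
  | cons x l ih =>
    simp only [ofList, dirs_prod, ih, List.flatMap_cons]
    congr 1
    cases x with
    | node φ l => simp [dirs, occ, Factor.toTensor, Factor.dirs, Function.comp_def,
        EdgeTerm.occ_ofList]
    | idt a b => simp [dirs, occ, Factor.toTensor, Factor.dirs]

theorem net_ofList (l : List (Factor S E)) : (ofList l : PreTensor S E B).net = (l : Net S E) := by
  have hflat : ∀ l : List (DirEdge E), (EdgeTerm.ofList l : EdgeTerm E B).flat = l := fun l => by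
    rw [← EdgeTerm.occ_eq_flat _ (EdgeTerm.boxNames_ofList l), EdgeTerm.occ_ofList]
  induction l with
  | nil => rfl
  | cons x l ih =>
    simp only [ofList, net_prod, ih, ← Multiset.cons_coe, ← Multiset.singleton_add]
    congr 1
    cases x <;> simp [Factor.toTensor, hflat]

variable [DecidableEq E]

omit [DecidableEq B] [DecidableEq E] in
theorem isConcrete_prod {G H : PreTensor S E B} (hG : G.boxNames = []) (hH : H.boxNames = [])
    (hd : (G.dirs ++ H.dirs).Nodup) : (prod G H).IsConcrete :=
  isConcrete_of_nodup (by simp [boxNames, hG, hH]) (by simpa using hd)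

omit [DecidableEq B] in
theorem Equiv.prod_congr {G G' H H' : PreTensor S E B} (h1 : G.Equiv G') (h2 : H.Equiv H')
    (hG : G.boxNames = []) (hG' : G'.boxNames = []) (hH : H.boxNames = []) (hH' : H'.boxNames = [])
    (p1 : G.dirs.Perm G'.dirs) (p2 : H.dirs.Perm H'.dirs) (hd : (G.dirs ++ H.dirs).Nodup) :
    (G.prod H).Equiv (G'.prod H') := by
  have hd' : (G'.dirs ++ H.dirs).Nodup := ((p1.append_right _).nodup_iff).1 hd
  have hd'' : (G'.dirs ++ H'.dirs).Nodup := ((p2.append_left _).nodup_iff).1 hd'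
  refine .trans (.prod H h1 (isConcrete_prod hG hH hd).1 (isConcrete_prod hG' hH hd').1) ?_
  refine .trans (.comm _ _) (.trans (.prod G' h2 ?_ ?_) (.comm _ _))
  · exact (isConcrete_prod hH hG' (List.nodup_append_comm.1 hd')).1
  · exact (isConcrete_prod hH' hG' (List.nodup_append_comm.1 hd'')).1

omit [DecidableEq B] in
theorem ofList_append (l l' : List (Factor S E))
    (hd : ((l ++ l').flatMap Factor.dirs).Nodup) :
    ((ofList l).prod (ofList l') : PreTensor S E B).Equiv (ofList (l ++ l')) := by
  induction l with
  | nil => exact .trans (.comm _ _) (.unit _)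
  | cons x l ih =>
    have hx : (x.toTensor : PreTensor S E B).boxNames = [] := by
      have := boxNames_ofList (B := B) [x]; simpa [ofList, boxNames] using this
    have hxd : (x.toTensor : PreTensor S E B).dirs = x.dirs := by
      have := dirs_ofList (B := B) [x]; simpa [ofList, dirs, occ] using this
    have hd' : ((l ++ l').flatMap Factor.dirs).Nodup := by
      simp only [List.cons_append, List.flatMap_cons] at hd
      exact (List.nodup_append.1 hd).2.1
    refine .trans (.assoc _ _ _) (Equiv.prod_congr (.refl _) (ih hd') hx hx
      (by simp [boxNames, boxNames_ofList]) (boxNames_ofList _) (.refl _) ?_ ?_)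
    · simp [dirs_ofList]
    · simpa [dirs_ofList, hxd] using hd

omit [DecidableEq B] in
theorem equiv_ofList_of_perm {l l' : List (Factor S E)} (h : l.Perm l')
    (hd : (l.flatMap Factor.dirs).Nodup) :
    (ofList l : PreTensor S E B).Equiv (ofList l') := by
  have htail : ∀ (x : Factor S E) {l l' : List (Factor S E)}, l.Perm l' →
      ((x :: l).flatMap Factor.dirs).Nodup → (ofList l : PreTensor S E B).Equiv (ofList l') →
      (ofList (x :: l) : PreTensor S E B).Equiv (ofList (x :: l')) := by
    intro x l l' h hd ih
    have hx : (x.toTensor : PreTensor S E B).boxNames = [] := by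
      have := boxNames_ofList (B := B) [x]; simpa [ofList, boxNames] using this
    have hxd : (x.toTensor : PreTensor S E B).dirs = x.dirs := by
      have := dirs_ofList (B := B) [x]; simpa [ofList, dirs, occ] using this
    refine Equiv.prod_congr (.refl _) ih hx hx (boxNames_ofList _) (boxNames_ofList _) (.refl _)
      ?_ ?_
    · simpa [dirs_ofList] using h.flatMap_right _
    · simpa [dirs_ofList, hxd] using hd
  induction h with
  | nil => exact .refl _
  | cons x h ih =>
    refine htail x h hd (ih ?_)
    rw [List.flatMap_cons] at hd
    exact (List.nodup_append.1 hd).2.1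
  | swap x y l =>
    -- move the first two factors out, exchange them, and move them back
    have e1 := ofList_append (B := B) [y, x] l hd
    have e2 := ofList_append (B := B) [x, y] l
      (((List.Perm.swap x y l).flatMap_right _).nodup_iff.1 hd)
    have hd2 : ([y, x].flatMap Factor.dirs ++ l.flatMap Factor.dirs).Nodup := by
      simpa [List.flatMap_cons] using hd
    refine .trans (.symm e1) (.trans (Equiv.prod_congr ?_ (.refl _) (boxNames_ofList _)
      (boxNames_ofList _) (boxNames_ofList _) (boxNames_ofList _) ?_ (.refl _) ?_) e2)
    · have e3 := ofList_append (B := B) [y] [x] (List.nodup_append.1 hd2).1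
      have e4 := ofList_append (B := B) [x] [y]
        (((List.Perm.swap x y []).flatMap_right _).nodup_iff.1 (List.nodup_append.1 hd2).1)
      exact .trans (.symm e3) (.trans (.comm _ _) e4)
    · simpa [dirs_ofList] using (List.Perm.swap x y []).flatMap_right Factor.dirs
    · simpa [dirs_ofList] using hd2
  | trans h1 h2 ih1 ih2 =>
    exact .trans (ih1 hd) (ih2 ((h1.flatMap_right _).nodup_iff.1 hd))

theorem exists_equiv_ofList (G : PreTensor S E B) (hG : G.boxNames = []) (hd : G.dirs.Nodup) :
    ∃ l : List (Factor S E), (l : Net S E) = G.net ∧ G.Equiv (ofList l) := by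
  induction G with
  | one => exact ⟨[], rfl, .refl _⟩
  | idt a b => exact ⟨[.idt a b], rfl, .symm (.unit _)⟩
  | node φ e =>
    exact ⟨[.node φ e.flat], rfl,
      .trans (.node φ (EdgeTerm.equiv_ofList_flat e hG)) (.symm (.unit _))⟩
  | box G A ih => simp [boxNames] at hG
  | prod G H ihG ihH =>
    simp only [boxNames, List.append_eq_nil_iff] at hG
    rw [dirs_prod] at hd
    have hd' := List.nodup_append.1 hd
    obtain ⟨l, h1, h2⟩ := ihG hG.1 hd'.1
    obtain ⟨l', h3, h4⟩ := ihH hG.2 hd'.2.1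
    have p : ∀ (G : PreTensor S E B) (l : List (Factor S E)), G.boxNames = [] → (l : Net S E) = G.net →
        G.dirs.Perm (ofList l : PreTensor S E B).dirs := fun G l hG h => by
      rw [← Multiset.coe_eq_coe, coe_dirs G hG, ← h, coe_dirs _ (boxNames_ofList l), net_ofList]
    have p1 := p G l hG.1 h1
    have p2 := p H l' hG.2 h3
    refine ⟨l ++ l', by rw [← Multiset.coe_add, h1, h3, net_prod], .trans (Equiv.prod_congr h2 h4
      hG.1 (boxNames_ofList _) hG.2 (boxNames_ofList _) p1 p2 hd) (ofList_append l l' ?_)⟩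
    have := (p1.append p2).nodup_iff.1 hd
    simpa [dirs_ofList] using this

/-- Concrete expressions with the same net are equivalent. -/
theorem equiv_of_net_eq {G H : PreTensor S E B} (hG : G.IsConcrete) (hH : H.IsConcrete)
    (h : G.net = H.net) : G.Equiv H := by
  obtain ⟨l, h1, h2⟩ := exists_equiv_ofList G hG.2 hG.nodup
  obtain ⟨l', h3, h4⟩ := exists_equiv_ofList H hH.2 hH.nodup
  refine .trans h2 (.trans (equiv_ofList_of_perm (Multiset.coe_eq_coe.1 ?_) ?_) (.symm h4))
  · rw [h1, h3, h]
  · have : (ofList l : PreTensor S E B).dirs.Perm G.dirs := by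
      rw [← Multiset.coe_eq_coe, coe_dirs G hG.2, ← h1, coe_dirs _ (boxNames_ofList l), net_ofList]
    rw [dirs_ofList] at this
    exact this.nodup_iff.2 hG.nodup

end PreTensor
end Net
end Concrete

/-! ### Renaming edges in derived equations -/

section DerivesRename

variable {S E B : Type*}

namespace PreTensor

theorem mem_dirs_map {f : E → E} {g : B → B} {X : PreTensor S E B} {d : DirEdge E} :
    d ∈ (X.map f g).dirs ↔ ∃ d' ∈ X.dirs, d'.map f = d := by
  simp [dirs_map]

theorem eq_of_map_eq {f : E → E} {g : B → B} {X : PreTensor S E B} (hX : (X.map f g).dirs.Nodup)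
    {d d' : DirEdge E} (hd : d ∈ X.dirs) (hd' : d' ∈ X.dirs) (h : d.map f = d'.map f) : d = d' := by
  rw [dirs_map] at hX
  exact List.inj_on_of_nodup_map hX hd hd' h

theorem _root_.BangTensor.DirEdge.flip_map (f : E → E) (d : DirEdge E) :
    (d.map f).flip = d.flip.map f := by
  cases d <;> rfl

/-- The free edges of a renamed expression are determined by the free edges: a renaming without
clashes may join two free edges to a bound one, but does nothing else to the boundary. -/
theorem free_map {f : E → E} {g : B → B} {X : PreTensor S E B} (hX : (X.map f g).dirs.Nodup)
    (d : DirEdge E) : (X.map f g).Free d ↔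
      (∃ d', X.Free d' ∧ d'.map f = d) ∧ ¬ ∃ d', X.Free d' ∧ d'.map f = d.flip := by
  constructor
  · rintro ⟨h1, h2⟩
    obtain ⟨d', hd', rfl⟩ := mem_dirs_map.1 h1
    refine ⟨⟨d', ⟨hd', fun h => h2 ?_⟩, rfl⟩, ?_⟩
    · rw [DirEdge.flip_map]
      exact mem_dirs_map.2 ⟨_, h, rfl⟩
    · rintro ⟨d'', h3, h4⟩
      exact h2 (mem_dirs_map.2 ⟨d'', h3.1, h4⟩)
  · rintro ⟨⟨d', hd', rfl⟩, h⟩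
    refine ⟨mem_dirs_map.2 ⟨d', hd'.1, rfl⟩, fun h2 => ?_⟩
    obtain ⟨d'', h3, h4⟩ := mem_dirs_map.1 h2
    have h5 : d''.flip ∈ X.dirs := by
      by_contra h5
      exact h ⟨d'', ⟨h3, h5⟩, h4⟩
    have h6 : d' = d''.flip := eq_of_map_eq hX hd'.1 h5 (by
      rw [← DirEdge.flip_map, h4, DirEdge.flip_flip])
    refine hd'.2 ?_
    rwa [h6, DirEdge.flip_flip]

theorem isConcrete_map {f : E → E} {X : PreTensor S E B} (hX : X.boxNames = [])
    (h : (X.map f id).dirs.Nodup) : (X.map f id).IsConcrete :=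
  isConcrete_of_nodup (by simp [boxNames_map, hX]) h

variable [DecidableEq E] {P : Set (PreTensor S E B × PreTensor S E B)}

theorem not_mem_dirs_of_renameEdge {a b : E} {X : PreTensor S E B}
    (hX : (X.renameEdge a b).dirs.Nodup) (hab : b ≠ a) {d d' : DirEdge E} (hd : d ∈ X.dirs)
    (ha : d = .inp a ∧ d' = .inp b ∨ d = .out a ∧ d' = .out b) : d' ∉ X.dirs := by
  intro h
  rcases ha with ⟨rfl, rfl⟩ | ⟨rfl, rfl⟩
  · have := eq_of_map_eq hX hd h (by simp [DirEdge.map, hab])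
    simp [hab.symm] at this
  · have := eq_of_map_eq hX hd h (by simp [DirEdge.map, hab])
    simp [hab.symm] at this

/-- A name that is not the name of a free edge can be changed. -/
theorem equiv_renameEdge {a b : E} {X : PreTensor S E B} (h1 : ¬ X.Free (.inp a))
    (h2 : ¬ X.Free (.out a)) (hab : b ≠ a) (hX' : (X.renameEdge a b).dirs.Nodup) :
    X.Equiv (X.renameEdge a b) := by
  by_cases ha : .inp a ∈ X.dirs ∨ .out a ∈ X.dirs
  · have h3 : .inp a ∈ X.dirs ∧ .out a ∈ X.dirs := by
      simp only [Free, DirEdge.flip] at h1 h2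
      tauto
    refine .bound X a b h3.1 h3.2 fun hb => ?_
    obtain ⟨d, hd, hdb⟩ := List.mem_map.1 hb
    cases d with
    | inp c =>
      obtain rfl : c = b := hdb
      exact not_mem_dirs_of_renameEdge hX' hab h3.1 (.inl ⟨rfl, rfl⟩) hd
    | out c =>
      obtain rfl : c = b := hdb
      exact not_mem_dirs_of_renameEdge hX' hab h3.2 (.inr ⟨rfl, rfl⟩) hd
  · have : X.renameEdge a b = X := by
      refine (map_congr id X fun c hc => ?_).trans (map_id X)
      refine Function.update_of_ne ?_ _ _
      rintro rfl
      obtain ⟨d, hd, rfl⟩ := List.mem_map.1 hc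
      cases d <;> simp_all [DirEdge.name]
    rw [this]
    exact .refl _

/-- A free edge is renamed by plugging in an identity and contracting it. -/
theorem Derives.renameEdge {X Y : PreTensor S E B} (h : Derives P X Y) (hX : X.IsConcrete)
    (hY : Y.IsConcrete) (hf : ∀ d, X.Free d ↔ Y.Free d) {a b : E}
    (hX' : (X.renameEdge a b).dirs.Nodup) (hY' : (Y.renameEdge a b).dirs.Nodup) :
    Derives P (X.renameEdge a b) (Y.renameEdge a b) := by
  by_cases hab : b = a
  · subst hab
    have hb : Function.update id b b = id := Function.update_eq_self b id
    simpa [PreTensor.renameEdge, hb, map_id] using h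
  have hXc := isConcrete_map hX.2 hX'
  have hYc := isConcrete_map hY.2 hY'
  by_cases h1 : X.Free (.inp a)
  · have hc : ∀ Z : PreTensor S E B, Z.IsConcrete → (Z.renameEdge a b).dirs.Nodup →
        Z.Free (.inp a) → (Z.prod (.idt a b)).IsConcrete := by
      intro Z hZ hZ' hZf
      refine isConcrete_prod hZ.2 rfl (List.nodup_append.2 ⟨hZ.nodup, by simp [dirs, occ], ?_⟩)
      have h4 := not_mem_dirs_of_renameEdge hZ' hab hZf.1 (.inl ⟨rfl, rfl⟩)
      have h5 : .out a ∉ Z.dirs := hZf.2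
      simp only [dirs, occ, List.map_cons, List.map_nil, List.mem_cons, List.not_mem_nil, or_false]
      rintro d hd d' (rfl | rfl) rfl
      exacts [h5 hd, h4 hd]
    have hcX := hc X hX hX' h1
    have hcY := hc Y hY hY' ((hf _).1 h1)
    exact .trans (.symm (.equiv hcX hXc (.contract_inp X b a h1.1 hcX.1)))
      (.trans (.prod _ h hcX hcY) (.equiv hcY hYc (.contract_inp Y b a ((hf _).1 h1).1 hcY.1)))
  by_cases h2 : X.Free (.out a)
  · have hc : ∀ Z : PreTensor S E B, Z.IsConcrete → (Z.renameEdge a b).dirs.Nodup →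
        Z.Free (.out a) → (Z.prod (.idt b a)).IsConcrete := by
      intro Z hZ hZ' hZf
      refine isConcrete_prod hZ.2 rfl (List.nodup_append.2 ⟨hZ.nodup, by simp [dirs, occ], ?_⟩)
      have h4 := not_mem_dirs_of_renameEdge hZ' hab hZf.1 (.inr ⟨rfl, rfl⟩)
      have h5 : .inp a ∉ Z.dirs := hZf.2
      simp only [dirs, occ, List.map_cons, List.map_nil, List.mem_cons, List.not_mem_nil, or_false]
      rintro d hd d' (rfl | rfl) rfl
      exacts [h4 hd, h5 hd]
    have hcX := hc X hX hX' h2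
    have hcY := hc Y hY hY' ((hf _).1 h2)
    exact .trans (.symm (.equiv hcX hXc (.contract_out X b a h2.1 hcX.1)))
      (.trans (.prod _ h hcX hcY) (.equiv hcY hYc (.contract_out Y b a ((hf _).1 h2).1 hcY.1)))
  exact .trans (.symm (.equiv hX hXc (equiv_renameEdge h1 h2 hab hX')))
    (.trans h (.equiv hY hYc (equiv_renameEdge (by rwa [← hf]) (by rwa [← hf]) hab hY')))

/-- Names can be renamed one after another if no new name is an old one. -/
theorem Derives.rename_of_disjoint (L : List E) (hL : L.Nodup) (σ : E → E)
    (h1 : ∀ a ∈ L, σ a ∉ L) (h2 : ∀ a ∉ L, σ a = a) {X Y : PreTensor S E B} (h : Derives P X Y)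
    (hX : X.IsConcrete) (hY : Y.IsConcrete) (hf : ∀ d, X.Free d ↔ Y.Free d)
    (hX' : (X.map σ id).dirs.Nodup) (hY' : (Y.map σ id).dirs.Nodup) :
    Derives P (X.map σ id) (Y.map σ id) := by
  induction L generalizing σ X Y with
  | nil =>
    obtain rfl : σ = id := funext fun a => h2 a (by simp)
    simpa [map_id] using h
  | cons a L ih =>
    have hσ : Function.update σ a a ∘ Function.update id a (σ a) = σ := by
      funext x
      by_cases hx : x = a
      · subst hx
        have h3 := h1 x (by simp)
        have h4 : σ x ≠ x := fun h => h3 (by simp [h])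
        simpa [h4] using h2 _ h3
      · simp [hx]
    have hm : ∀ Z : PreTensor S E B,
        (Z.renameEdge a (σ a)).map (Function.update σ a a) id = Z.map σ id := fun Z => by
      rw [PreTensor.renameEdge, map_map, hσ, Function.comp_id]
    have hd : ∀ Z : PreTensor S E B, (Z.map σ id).dirs.Nodup →
        (Z.renameEdge a (σ a)).dirs.Nodup := fun Z hZ => by
      rw [← hm, dirs_map] at hZ
      exact hZ.of_map _
    rw [List.nodup_cons] at hL
    rw [← hm X, ← hm Y]
    refine ih hL.2 _ ?_ ?_ (h.renameEdge hX hY hf (hd X hX') (hd Y hY'))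
      (isConcrete_map hX.2 (hd X hX')) (isConcrete_map hY.2 (hd Y hY')) ?_ (by rwa [hm]) (by rwa [hm])
    · intro c hc
      have hca : c ≠ a := fun h => hL.1 (h ▸ hc)
      rw [Function.update_of_ne hca]
      exact fun h => h1 c (by simp [hc]) (by simp [h])
    · intro c hc
      by_cases hca : c = a
      · simp [hca]
      · rw [Function.update_of_ne hca]
        exact h2 c (by simp [hca, hc])
    · intro d
      rw [PreTensor.renameEdge, PreTensor.renameEdge, free_map (hd X hX'), free_map (hd Y hY')]
      simp only [hf]

/-- Derived equations can be renamed along any map that does not identify two edges. -/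
theorem Derives.rename [Infinite E] {X Y : PreTensor S E B} (h : Derives P X Y)
    (hX : X.IsConcrete) (hY : Y.IsConcrete) (hf : ∀ d, X.Free d ↔ Y.Free d) (σ : E → E)
    (hX' : (X.map σ id).dirs.Nodup) (hY' : (Y.map σ id).dirs.Nodup) :
    Derives P (X.map σ id) (Y.map σ id) := by
  set L := (X.edges ++ Y.edges).dedup with hL
  obtain ⟨e, he⟩ := exists_perm_not_mem (L ++ L.map σ).toFinset
  simp only [List.mem_toFinset, List.mem_append] at he
  -- rename to fresh names first, and then to the final names
  set σ₁ : E → E := fun x => if x ∈ L then e x else x with hσ₁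
  set σ₂ : E → E := fun y => if e.symm y ∈ L then σ (e.symm y) else y with hσ₂
  have hm : ∀ Z : PreTensor S E B, (∀ a ∈ Z.edges, a ∈ L) →
      (Z.map σ₁ id).map σ₂ id = Z.map σ id := fun Z hZ => by
    rw [map_map]
    refine map_congr _ Z fun a ha => ?_
    simp [hσ₁, hσ₂, hZ a ha]
  have hXL : ∀ a ∈ X.edges, a ∈ L := fun a ha => by simp [hL, ha]
  have hYL : ∀ a ∈ Y.edges, a ∈ L := fun a ha => by simp [hL, ha]
  have hX1 : (X.map σ₁ id).dirs.Nodup := by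
    rw [← hm X hXL, dirs_map] at hX'
    exact hX'.of_map _
  have hY1 : (Y.map σ₁ id).dirs.Nodup := by
    rw [← hm Y hYL, dirs_map] at hY'
    exact hY'.of_map _
  have h1 : Derives P (X.map σ₁ id) (Y.map σ₁ id) := by
    refine h.rename_of_disjoint L (List.nodup_dedup _) σ₁ ?_ ?_ hX hY hf hX1 hY1
    · intro a ha hb
      simp only [hσ₁, ha, if_true] at hb
      exact he a (.inl ha) (.inl hb)
    · intro a ha
      simp [hσ₁, ha]
  rw [← hm X hXL, ← hm Y hYL]
  refine h1.rename_of_disjoint (L.map e) ((List.nodup_dedup _).map e.injective) σ₂ ?_ ?_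
    (isConcrete_map hX.2 hX1) (isConcrete_map hY.2 hY1) ?_ (by rwa [hm X hXL]) (by rwa [hm Y hYL])
  · intro b hb hc
    obtain ⟨x, hx, rfl⟩ := List.mem_map.1 hb
    obtain ⟨z, hz, hzx⟩ := List.mem_map.1 hc
    simp only [hσ₂, Equiv.symm_apply_apply, hx, if_true] at hzx
    exact he z (.inl hz) (.inr (List.mem_map.2 ⟨x, hx, hzx.symm⟩))
  · intro b hb
    have : e.symm b ∉ L := fun h => hb (List.mem_map.2 ⟨_, h, by simp⟩)
    simp [hσ₂, this]
  · intro d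
    rw [free_map hX1, free_map hY1]
    simp only [hf]

end PreTensor
end DerivesRename

/-! ### Tensor expressions are layered -/

section Tensor

variable {S E B : Type*}

namespace PreTensor

/-- The !-boxes of an expression, each with the list of the !-boxes around it, from the inside
out. -/
def boxOcc : PreTensor S E B → List (B × List B)
  | one => []
  | idt _ _ => []
  | node _ _ => []
  | box G A => (A, []) :: G.boxOcc.map fun p => (p.1, p.2 ++ [A])
  | prod G H => G.boxOcc ++ H.boxOcc

theorem map_fst_boxOcc (G : PreTensor S E B) : G.boxOcc.map Prod.fst = G.boxes := by
  induction G with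
  | one => rfl
  | idt a b => rfl
  | node φ e => rfl
  | box G A ih => simp [boxOcc, boxes, ← ih]
  | prod G H ihG ihH => simp [boxOcc, boxes, ihG, ihH]

theorem mem_boxes_iff {G : PreTensor S E B} {C : B} : C ∈ G.boxes ↔ ∃ r, (C, r) ∈ G.boxOcc := by
  simp [← map_fst_boxOcc]

theorem mem_topBoxes {G : PreTensor S E B} {C : B} : C ∈ G.topBoxes ↔ (C, []) ∈ G.boxOcc := by
  induction G with
  | one => simp [topBoxes, boxOcc]
  | idt a b => simp [topBoxes, boxOcc]
  | node φ e => simp [topBoxes, boxOcc]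
  | box G A ih => simp [topBoxes, boxOcc]
  | prod G H ihG ihH => simp [topBoxes, boxOcc, ihG, ihH]

theorem nested_iff_boxOcc {G : PreTensor S E B} {C D : B} :
    G.Nested C D ↔ ∃ r, (C, D :: r) ∈ G.boxOcc := by
  induction G with
  | one => simp [Nested, boxOcc]
  | idt a b => simp [Nested, boxOcc]
  | node φ e => simp [Nested, boxOcc]
  | box G A ih =>
    simp only [Nested, boxOcc, mem_topBoxes, ih, List.mem_cons, Prod.mk.injEq, reduceCtorEq,
      and_false, List.mem_map, Prod.exists, false_or]
    constructor
    · rintro (⟨rfl, h⟩ | ⟨r, h⟩)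
      · exact ⟨[], C, [], h, rfl, rfl⟩
      · exact ⟨r ++ [A], C, D :: r, h, rfl, rfl⟩
    · rintro ⟨r, X, s, h, rfl, hs⟩
      cases s with
      | nil =>
        simp only [List.nil_append, List.cons.injEq] at hs
        exact .inl ⟨hs.1, h⟩
      | cons D' s =>
        simp only [List.cons_append, List.cons.injEq] at hs
        exact .inr ⟨s, by rwa [← hs.1]⟩
  | prod G H ihG ihH => simp [Nested, boxOcc, ihG, ihH, exists_or]

theorem boxOcc_parent {G : PreTensor S E B} {C D : B} {r : List B}
    (h : (C, D :: r) ∈ G.boxOcc) : (D, r) ∈ G.boxOcc := by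
  induction G generalizing r with
  | one => simp [boxOcc] at h
  | idt a b => simp [boxOcc] at h
  | node φ e => simp [boxOcc] at h
  | box G A ih =>
    simp only [boxOcc, List.mem_cons, Prod.mk.injEq, reduceCtorEq,
      and_false, List.mem_map, Prod.exists, false_or] at h ⊢
    obtain ⟨X, s, h, rfl, hs⟩ := h
    cases s with
    | nil =>
      simp only [List.nil_append, List.cons.injEq] at hs
      exact .inl ⟨hs.1.symm, hs.2.symm⟩
    | cons D' s =>
      simp only [List.cons_append, List.cons.injEq] at hs
      obtain ⟨rfl, rfl⟩ := hs
      exact .inr ⟨D', s, ih h, rfl, rfl⟩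
  | prod G H ihG ihH =>
    simp only [boxOcc, List.mem_append] at h ⊢
    exact h.imp ihG ihH

theorem boxOcc_of_append {G : PreTensor S E B} {C D : B} {s r : List B}
    (h : (C, s ++ D :: r) ∈ G.boxOcc) : (D, r) ∈ G.boxOcc := by
  induction s generalizing C with
  | nil => exact boxOcc_parent h
  | cons X s ih => exact ih (boxOcc_parent h)

theorem boxOcc_unique {G : PreTensor S E B} (hG : G.boxes.Nodup) {C : B} {r s : List B}
    (h : (C, r) ∈ G.boxOcc) (h' : (C, s) ∈ G.boxOcc) : r = s := by
  rw [← map_fst_boxOcc] at hG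
  have := List.inj_on_of_nodup_map hG h h' rfl
  exact (Prod.mk.inj this).2

/-- The !-boxes around the !-box `C` in `G`. -/
def ancestors (G : PreTensor S E B) (C : B) : Set B := {D | Relation.TransGen G.Nested C D}

theorem mem_ancestors {G : PreTensor S E B} (hG : G.boxes.Nodup) {C D : B} {r : List B}
    (h : (C, r) ∈ G.boxOcc) : D ∈ G.ancestors C ↔ D ∈ r := by
  constructor
  · intro hD
    change Relation.TransGen G.Nested C D at hD
    induction hD using Relation.TransGen.head_induction_on generalizing r with
    | single hN =>
      obtain ⟨s, hs⟩ := nested_iff_boxOcc.1 hN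
      simp [boxOcc_unique hG h hs]
    | head hN _ ih =>
      obtain ⟨s, hs⟩ := nested_iff_boxOcc.1 hN
      rw [boxOcc_unique hG h hs]
      exact List.mem_cons_of_mem _ (ih (boxOcc_parent hs))
  · intro hD
    induction r generalizing C with
    | nil => simp at hD
    | cons E' r ih =>
      have hN : G.Nested C E' := nested_iff_boxOcc.2 ⟨r, h⟩
      rcases List.mem_cons.1 hD with rfl | hD
      · exact .single hN
      · exact .head hN (ih (boxOcc_parent h) hD)

theorem ancestors_subset {G : PreTensor S E B} {C D : B} (h : D ∈ G.ancestors C) :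
    G.ancestors D ⊆ G.ancestors C := fun _ h' => Relation.TransGen.trans h h'

theorem mem_boxes_of_mem_ancestors {G : PreTensor S E B} {C D : B} (h : D ∈ G.ancestors C) :
    C ∈ G.boxes ∧ D ∈ G.boxes := by
  change Relation.TransGen G.Nested C D at h
  have key : ∀ {X Y}, G.Nested X Y → X ∈ G.boxes ∧ Y ∈ G.boxes := fun h => by
    obtain ⟨s, hs⟩ := nested_iff_boxOcc.1 h
    exact ⟨mem_boxes_iff.2 ⟨_, hs⟩, mem_boxes_iff.2 ⟨_, boxOcc_parent hs⟩⟩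
  induction h using Relation.TransGen.head_induction_on with
  | single hN => exact key hN
  | head hN _ ih => exact ⟨(key hN).1, ih.2⟩

theorem upClosed_boxOcc {G : PreTensor S E B} (hG : G.boxes.Nodup) {C : B} {r : List B}
    (h : (C, r) ∈ G.boxOcc) : UpClosed G.ancestors (C :: r) := by
  induction r generalizing C with
  | nil =>
    exact ⟨by simp, fun D hD => absurd ((mem_ancestors hG h).1 hD) (by simp), trivial⟩
  | cons D r ih =>
    refine ⟨fun hC => ?_, fun X hX => ⟨(mem_ancestors hG h).1 hX, ancestors_subset hX⟩,
      ih (boxOcc_parent h)⟩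
    -- a !-box around itself would have two different lists of !-boxes around it
    obtain ⟨s, t, hst⟩ := List.append_of_mem hC
    rw [hst] at h
    have := congrArg List.length (boxOcc_unique hG h (boxOcc_of_append h))
    simp at this
    omega

theorem not_mem_ancestors {G : PreTensor S E B} (hG : G.boxes.Nodup) {C : B} :
    C ∉ G.ancestors C := fun h => by
  obtain ⟨r, hr⟩ := mem_boxes_iff.1 (mem_boxes_of_mem_ancestors h).1
  exact (upClosed_boxOcc hG hr).1 ((mem_ancestors hG hr).1 h)

/-- The node context of an edge is an innermost !-box followed by the !-boxes around it. -/
theorem nctx_boxOcc {G : PreTensor S E B} : ∀ o ∈ G.occ, ∀ A r, o.nctx = A :: r →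
    (A, r) ∈ G.boxOcc := by
  induction G with
  | one => simp [occ]
  | idt a b => simp [occ]
  | node φ e =>
    intro o ho A r h
    obtain ⟨p, -, rfl⟩ := List.mem_map.1 ho
    simp at h
  | box G C ih =>
    intro _ ho A r h
    obtain ⟨o, ho', rfl⟩ := List.mem_map.1 ho
    simp only [boxOcc, List.mem_cons, Prod.mk.injEq, List.mem_map, Prod.exists]
    cases hn : o.nctx with
    | nil => simp_all
    | cons D s =>
      rw [hn] at h
      simp only [List.cons_append, List.cons.injEq] at h
      exact .inr ⟨D, s, ih o ho' D s hn, h.1, h.2⟩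
  | prod G H ihG ihH =>
    intro o ho A r h
    simp only [occ, boxOcc, List.mem_append] at ho ⊢
    exact ho.imp (fun ho => ihG o ho A r h) (fun ho => ihH o ho A r h)

theorem upClosed_nctx {G : PreTensor S E B} (hG : G.boxes.Nodup) : ∀ o ∈ G.occ,
    UpClosed G.ancestors o.nctx := by
  intro o ho
  cases h : o.nctx with
  | nil => trivial
  | cons A r => exact upClosed_boxOcc hG (nctx_boxOcc o ho A r h)

/-- The defining conditions on edge contexts make contexts of edges closed under ancestors. -/
theorem IsTensor.upClosed_ctx {G : PreTensor S E B} (hG : G.IsTensor) : ∀ o ∈ G.occ,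
    UpClosed G.ancestors o.ctx := by
  intro o ho
  have hn := upClosed_nctx hG.boxes_nodup o ho
  have key : ∀ l : List B, l.Disjoint o.nctx → l.IsChain G.Nested →
      (∀ A ∈ l.getLast?, ∀ C, G.Nested A C → C ∈ o.nctx) →
      UpClosed G.ancestors (l ++ o.nctx) ∧ ∀ C ∈ l.tail, ∀ A ∈ l.head?, C ∈ G.ancestors A := by
    intro l hd hc hl
    induction l with
    | nil => simpa using hn
    | cons C l ih =>
      have hd' := (List.disjoint_cons_left.1 hd)
      have ih := ih hd'.2 (by
        cases l with
        | nil => simp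
        | cons => exact (List.isChain_cons_cons.1 hc).2) (fun A hA => hl A (by
          cases l with
          | nil => simp at hA
          | cons => simpa using hA))
      have hanc : ∀ X ∈ l, X ∈ G.ancestors C := by
        intro X hX
        cases l with
        | nil => simp at hX
        | cons D l =>
          have hCD : D ∈ G.ancestors C := .single (List.isChain_cons_cons.1 hc).1
          rcases List.mem_cons.1 hX with rfl | hX
          · exact hCD
          · exact ancestors_subset hCD (ih.2 X (by simpa using hX) D (by simp))
      refine ⟨⟨?_, fun D hD => ⟨?_, ancestors_subset hD⟩, ih.1⟩, fun X hX A hA => ?_⟩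
      · intro h
        rcases List.mem_append.1 h with h | h
        · exact not_mem_ancestors hG.boxes_nodup (hanc C h)
        · exact hd'.1 h
      · obtain ⟨F, hF, hFD⟩ := Relation.TransGen.head'_iff.1 hD
        have hmem : F ∈ l ++ o.nctx := by
          cases l with
          | nil => exact hl C (by simp) F hF
          | cons D' l =>
            obtain ⟨s, hs⟩ := nested_iff_boxOcc.1 hF
            obtain ⟨t, ht⟩ := nested_iff_boxOcc.1 (List.isChain_cons_cons.1 hc).1
            have := boxOcc_unique hG.boxes_nodup hs ht
            simp only [List.cons.injEq] at this
            simp [this.1]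
        rcases Relation.reflTransGen_iff_eq_or_transGen.1 hFD with rfl | h
        · exact hmem
        · exact ih.1.anc_mem hmem h
      · simp only [List.head?_cons, Option.mem_def, Option.some.injEq] at hA
        exact hA ▸ hanc X hX
  exact (key _ (hG.ctx_disjoint o ho) (hG.ectx_chain o ho) (hG.ectx_last o ho)).1

theorem IsTensor.pairwise_ectx {G : PreTensor S E B} (hG : G.IsTensor) : ∀ o ∈ G.occ,
    o.ectx.Pairwise fun C D => D ∈ G.ancestors C := by
  intro o ho
  have h : o.ectx.IsChain (Relation.TransGen G.Nested) :=
    (hG.ectx_chain o ho).imp fun _ _ h => .single h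
  have h' := List.isChain_iff_pairwise.1 h
  exact h'

theorem IsTensor.groupsInBoxes {G : PreTensor S E B} (hG : G.IsTensor) : G.GroupsInBoxes :=
  hG.ectx_mem

/-- A part of an expression is layered if the contexts of its edges and !-boxes are as expected. -/
theorem layered_of_contexts {anc : B → Set B} (G : PreTensor S E B) (r : List B)
    (hb : G.boxes.Nodup)
    (ho : ∀ o ∈ G.occ, UpClosed anc (o.ectx ++ (o.nctx ++ r)) ∧
      o.ectx.Pairwise fun C D => D ∈ anc C)
    (hc : ∀ p ∈ G.boxOcc, UpClosed anc (p.1 :: (p.2 ++ r)) ∧ ∀ D ∈ p.2 ++ r, D ∈ anc p.1)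
    (he : ∀ o ∈ G.occ, ∀ C ∈ o.ectx, ∀ A ∈ G.boxes, A ∈ anc C → C ∈ G.boxes) :
    G.Layered anc r := by
  induction G generalizing r with
  | one => trivial
  | idt a b => trivial
  | node φ e =>
    intro p hp
    simpa using ho ⟨p.1, p.2, []⟩ (List.mem_map.2 ⟨p, hp, rfl⟩)
  | box G A ih =>
    have hA := hc (A, []) (by simp [boxOcc])
    simp only [List.nil_append] at hA
    have hAA : A ∉ anc A := fun h => hA.1.1 (hA.1.2.1 A h).1
    rw [boxes, List.nodup_cons] at hb
    have hc' : ∀ p ∈ G.boxOcc, UpClosed anc (p.1 :: (p.2 ++ A :: r)) ∧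
        ∀ D ∈ p.2 ++ A :: r, D ∈ anc p.1 := fun p hp => by
      simpa using hc (p.1, p.2 ++ [A]) (by simp [boxOcc, hp])
    refine ⟨hA.1, hA.2, ?_, ih (A :: r) hb.2 ?_ hc' ?_⟩
    · intro o h C hC hCA
      have := he _ (List.mem_map.2 ⟨o, h, rfl⟩) C hC A (by simp [boxes]) hCA
      rcases List.mem_cons.1 this with rfl | h
      exacts [absurd hCA hAA, h]
    · intro o h
      simpa using ho _ (List.mem_map.2 ⟨o, h, rfl⟩)
    · intro o h C hC X hX hXC
      have := he _ (List.mem_map.2 ⟨o, h, rfl⟩) C hC X (by simp [boxes, hX]) hXC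
      rcases List.mem_cons.1 this with rfl | h
      · obtain ⟨s, hs⟩ := mem_boxes_iff.1 hX
        have h1 := hc' _ hs
        have h2 := hA.1.2.1 X hXC
        exact absurd (h2.2 (h1.2 C (by simp))) hAA
      · exact h
  | prod G H ihG ihH =>
    rw [boxes, List.nodup_append] at hb
    -- a group of a !-box of one factor cannot occur in a !-box of the other factor
    have key : ∀ G H : PreTensor S E B, (∀ p ∈ H.boxOcc, UpClosed anc (p.1 :: (p.2 ++ r))) →
        (∀ p ∈ G.boxOcc, UpClosed anc (p.1 :: (p.2 ++ r))) →
        (∀ X ∈ G.boxes, X ∉ H.boxes) → ∀ C ∈ H.boxes, ∀ X ∈ G.boxes, X ∉ anc C := by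
      intro G H hH hG hGH C hC X hX hXC
      obtain ⟨s, hs⟩ := mem_boxes_iff.1 hC
      obtain ⟨t, ht⟩ := mem_boxes_iff.1 hX
      rcases List.mem_append.1 ((hH _ hs).2.1 X hXC).1 with h | h
      · obtain ⟨s1, s2, rfl⟩ := List.append_of_mem h
        exact hGH X hX (mem_boxes_iff.2 ⟨_, boxOcc_of_append hs⟩)
      · exact (hG _ ht).1 (by simp [h])
    refine ⟨ihG r hb.1 (fun o h => ho o (by simp [occ, h])) (fun p h => hc p (by simp [boxOcc, h]))
      ?_, ihH r hb.2.1 (fun o h => ho o (by simp [occ, h]))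
      (fun p h => hc p (by simp [boxOcc, h])) ?_⟩
    · intro o h C hC X hX hXC
      have := he o (by simp [occ, h]) C hC X (by simp [boxes, hX]) hXC
      rcases List.mem_append.1 this with h | h
      · exact h
      · exact absurd hXC (key G H (fun p h => (hc p (by simp [boxOcc, h])).1)
          (fun p h => (hc p (by simp [boxOcc, h])).1) (fun X h1 h2 => hb.2.2 X h1 X h2 rfl) C h X hX)
    · intro o h C hC X hX hXC
      have := he o (by simp [occ, h]) C hC X (by simp [boxes, hX]) hXC
      rcases List.mem_append.1 this with h | h
      · exact absurd hXC (key H G (fun p h => (hc p (by simp [boxOcc, h])).1)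
          (fun p h => (hc p (by simp [boxOcc, h])).1) (fun X h1 h2 => hb.2.2 X h2 X h1 rfl) C h X hX)
      · exact h

theorem IsTensor.layered {G : PreTensor S E B} (hG : G.IsTensor) : G.Layered G.ancestors [] := by
  refine layered_of_contexts G [] hG.boxes_nodup (fun o ho => ⟨?_, hG.pairwise_ectx o ho⟩)
    (fun p hp => ⟨?_, fun D hD => ?_⟩) (fun o ho C hC _ _ _ => hG.ectx_mem o ho C hC)
  · simpa [Occ.ctx] using hG.upClosed_ctx o ho
  · simpa using upClosed_boxOcc hG.boxes_nodup hp
  · exact (mem_ancestors hG.boxes_nodup hp).2 (by simpa using hD)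

theorem ancestors_congr {G H : PreTensor S E B} (h : ∀ A C, G.Nested A C ↔ H.Nested A C) :
    G.ancestors = H.ancestors := by
  have : G.Nested = H.Nested := by
    funext A C; exact propext (h A C)
  funext C
  rw [ancestors, ancestors, this]

theorem IsEquation.ancestors_eq {G H : PreTensor S E B} (h : G.IsEquation H) :
    G.ancestors = H.ancestors := ancestors_congr h.nested_iff

end PreTensor
end Tensor

/-! ### Unrolled equations follow from the concrete instances -/

section Core

variable {S E B : Type*} [DecidableEq B]

/-- A directed edge of a net is free if its opposite does not occur. -/
def Net.Free {F : Type*} (N : Net S F) (d : DirEdge F) : Prop := d ∈ N.dirs ∧ d.flip ∉ N.dirs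

namespace PreTensor

variable {G H X Y : PreTensor S E B} {n : Count B}

omit [DecidableEq B] in
theorem IsEquation.symm (h : G.IsEquation H) : H.IsEquation G where
  left := h.right
  right := h.left
  free_iff d := (h.free_iff d).symm
  boxes_iff A := (h.boxes_iff A).symm
  nested_iff A C := (h.nested_iff A C).symm
  ctx_eq o ho o' ho' hd hf := (h.ctx_eq o' ho' o ho hd.symm (by
    rw [← hd]; exact (h.free_iff _).2 hf)).symm

omit [DecidableEq B] in
/-- The two ends of a bound edge lie in the same !-boxes. -/
theorem IsTensor.ctx_perm (hG : G.IsTensor) {o o' : Occ E B} (ho : o ∈ G.occ) (ho' : o' ∈ G.occ)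
    (h : o'.dir = o.dir.flip) : o.ctx.Perm o'.ctx := by
  have key : ∀ a, ∀ i ∈ G.occ, ∀ o ∈ G.occ, i.dir = .inp a → o.dir = .out a →
      i.ctx.Perm o.ctx := by
    intro a i hi o ho h1 h2
    obtain ⟨es, bs, h3, h4⟩ := hG.bound a i hi o ho h1 h2
    rw [← Multiset.coe_eq_coe]
    have h3' := congrArg (fun l : List B => (l : Multiset B)) h3
    have h4' := congrArg (fun l : List B => (l : Multiset B)) h4
    simp only [← Multiset.coe_add, Occ.ctx] at h3' h4' ⊢
    refine add_left_cancel (a := (es : Multiset B) + bs) ?_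
    calc (es : Multiset B) + bs + (i.ectx + i.nctx) = (es + i.nctx) + (i.ectx + bs) := by abel
      _ = (o.ectx + bs) + (es + o.nctx) := by rw [h3', h4']
      _ = _ := by abel
  cases hd : o.dir with
  | inp a => exact key a o ho o' ho' hd (by rw [h, hd]; rfl)
  | out a => exact (key a o' ho' o ho (by rw [h, hd]; rfl) hd).symm

theorem IsTensor.mem_envs_ctx (hG : G.IsTensor) (hn : n.Local G.ancestors) {o : Occ E B}
    (ho : o ∈ G.occ) {ρ : Env B} : ρ ∈ envs n o.ctx.reverse 0 ↔
      (∀ C ∉ o.ctx, ρ C = 0) ∧ ∀ C ∈ o.ctx, 0 < ρ C ∧ ρ C ≤ n C ρ := by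
  rw [mem_envs (r := []) hn (by simpa using hG.upClosed_ctx o ho)]
  simp

omit [DecidableEq B] in
theorem mem_dirs_iff {d : DirEdge E} : d ∈ G.dirs ↔ ∃ o ∈ G.occ, o.dir = d := by simp [dirs]

/-- Both sides of an equation have the same boundary after unrolling. -/
theorem IsEquation.free_unroll (h : G.IsEquation H) (hn : n.Local G.ancestors)
    (d : DirEdge (E × Env B)) : (G.unroll n 0).Free d ↔ (H.unroll n 0).Free d := by
  have key : ∀ G H : PreTensor S E B, G.IsEquation H → n.Local G.ancestors →
      (G.unroll n 0).Free d → (H.unroll n 0).Free d := by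
    intro G H h hn hd
    obtain ⟨o, ho, ρ, hρ, rfl⟩ := mem_dirs_unroll.1 hd.1
    have hfree : G.Free o.dir := by
      refine ⟨mem_dirs_iff.2 ⟨o, ho, rfl⟩, fun hfl => hd.2 ?_⟩
      obtain ⟨o', ho', hoo⟩ := mem_dirs_iff.1 hfl
      have hp := h.left.ctx_perm ho ho' hoo
      refine mem_dirs_unroll.2 ⟨o', ho', ρ, ?_, by rw [DirEdge.flip_rename, hoo]⟩
      rw [h.left.mem_envs_ctx hn ho] at hρ
      rw [h.left.mem_envs_ctx hn ho']
      simpa only [hp.mem_iff] using hρ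
    have hfree' := (h.free_iff _).1 hfree
    obtain ⟨o', ho', hoo⟩ := mem_dirs_iff.1 hfree'.1
    refine ⟨mem_dirs_unroll.2 ⟨o', ho', ρ, ?_, by rw [hoo]⟩, fun hfl => hfree'.2 ?_⟩
    · rwa [← h.ctx_eq o ho o' ho' hoo.symm hfree]
    · obtain ⟨o'', ho'', ρ', -, hoo'⟩ := mem_dirs_unroll.1 hfl
      refine mem_dirs_iff.2 ⟨o'', ho'', ?_⟩
      have := congrArg (DirEdge.rename Prod.fst) hoo'
      rw [← DirEdge.flip_rename, DirEdge.rename_rename, DirEdge.rename_rename] at this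
      cases h1 : o.dir <;> cases h2 : o''.dir <;> simp_all [DirEdge.rename, DirEdge.flip]
  exact ⟨key G H h hn, key H G h.symm (by rwa [← h.ancestors_eq])⟩

theorem mem_dirs_of_net {F : Type*} {N : Net S F} {f : F → E} (hX : X.boxNames = [])
    (h : X.net = N.rename f) {d : DirEdge E} :
    d ∈ X.dirs ↔ ∃ d' ∈ N.dirs, d'.rename f = d := by
  rw [← Multiset.mem_coe, coe_dirs X hX, h, Net.dirs_rename, Multiset.mem_map]

theorem free_of_net {F : Type*} {N : Net S F} {f : F → E} (hX : X.boxNames = [])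
    (h : X.net = N.rename f) (hf : Set.InjOn f N.names) {d : DirEdge E} :
    X.Free d ↔ ∃ d', N.Free d' ∧ d'.rename f = d := by
  simp only [Free, Net.Free, mem_dirs_of_net hX h]
  constructor
  · rintro ⟨⟨d', h1, rfl⟩, h2⟩
    exact ⟨d', ⟨h1, fun h3 => h2 ⟨_, h3, by rw [DirEdge.flip_rename]⟩⟩, rfl⟩
  · rintro ⟨d', ⟨h1, h2⟩, rfl⟩
    refine ⟨⟨d', h1, rfl⟩, ?_⟩
    rintro ⟨d'', h3, h4⟩
    refine h2 ?_
    have h5 : f d''.name = f d'.name := by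
      have := congrArg DirEdge.name h4
      simpa using this
    have h6 := hf ⟨d'', h3, rfl⟩ ⟨d', h1, rfl⟩ h5
    have : d'' = d'.flip := by
      cases d' <;> cases d'' <;> simp_all [DirEdge.rename, DirEdge.flip, DirEdge.name]
    exact this ▸ h3

theorem IsConcrete.of_net_eq (hX : X.IsConcrete) (hY : Y.boxNames = []) (h : Y.net = X.net) :
    Y.IsConcrete := by
  refine isConcrete_of_nodup hY ?_
  rw [← Multiset.coe_nodup, coe_dirs Y hY, h, ← coe_dirs X hX.2]
  exact hX.nodup

variable [DecidableEq E] [Infinite E] [Infinite B]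

/-- The equation between the unrollings of both sides follows from the concrete instances, whatever
names the copies of the edges get: some concrete instance is the same up to the names, and the names
can be changed by equational reasoning. -/
theorem IsEquation.derives (h : G.IsEquation H)
    (hn : ∀ C ∈ G.boxes, ∀ ρ ρ', (∀ D ∈ G.ancestors C, ρ D = ρ' D) → n C ρ = n C ρ')
    (hX : X.IsConcrete) (hY : Y.IsConcrete) {f : E × Env B → E}
    (hXn : X.net = (G.unroll n 0).rename f) (hYn : Y.net = (H.unroll n 0).rename f) :
    Derives (G.sem H) X Y := by
  set n₀ : Count B := fun C ρ => if C ∈ G.boxes then n C ρ else 0 with hn₀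
  have hloc : n₀.Local G.ancestors := by
    intro C ρ ρ' hρ
    by_cases hC : C ∈ G.boxes
    · simp [hn₀, hC, hn C hC ρ ρ' hρ]
    · simp [hn₀, hC]
  have hcongr : ∀ Z : PreTensor S E B, Z.IsTensor → (∀ C, C ∈ Z.boxes → C ∈ G.boxes) →
      Z.unroll n 0 = Z.unroll n₀ 0 := fun Z hZ hb =>
    unroll_congr (K := (· ∈ G.boxes)) (fun C hC => by simp [hn₀, hC]) Z hb
      (fun o ho C hC => hb C (hZ.ectx_mem o ho C hC)) 0
  rw [hcongr G h.left fun _ => id] at hXn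
  rw [hcongr H h.right fun C => (h.boxes_iff C).2] at hYn
  obtain ⟨X₀, Y₀, f₀, hi, hr⟩ := exists_inst G H G.ancestors n₀ h.left.layered
    (h.ancestors_eq ▸ h.right.layered) h.left.groupsInBoxes h.right.groupsInBoxes hloc
  set s := (G.unroll n₀ 0).names ∪ (H.unroll n₀ 0).names with hs
  obtain ⟨σ, hσ⟩ : ∃ σ : E → E, ∀ x ∈ s, σ (f₀ x) = f x := by
    classical
    refine ⟨fun y => if hy : ∃ x ∈ s, f₀ x = y then f hy.choose else y, fun x hx => ?_⟩
    have hy : ∃ x' ∈ s, f₀ x' = f₀ x := ⟨x, hx, rfl⟩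
    simp only [hy, dif_pos]
    rw [hr.injOn hy.choose_spec.1 hx hy.choose_spec.2]
  have hXσ : (X₀.map σ id).net = X.net := by
    rw [net_map, hr.left, Net.rename_rename, hXn]
    exact Net.rename_congr fun x hx => hσ x (.inl hx)
  have hYσ : (Y₀.map σ id).net = Y.net := by
    rw [net_map, hr.right, Net.rename_rename, hYn]
    exact Net.rename_congr fun x hx => hσ x (.inr hx)
  have hXc : (X₀.map σ id).IsConcrete := hX.of_net_eq (by simp [boxNames_map, hr.left_boxNames]) hXσ
  have hYc : (Y₀.map σ id).IsConcrete :=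
    hY.of_net_eq (by simp [boxNames_map, hr.right_boxNames]) hYσ
  have hX₀ : X₀.IsConcrete := isConcrete_of_nodup hr.left_boxNames <| by
    have := hXc.nodup
    rw [dirs_map] at this
    exact this.of_map _
  have hY₀ : Y₀.IsConcrete := isConcrete_of_nodup hr.right_boxNames <| by
    have := hYc.nodup
    rw [dirs_map] at this
    exact this.of_map _
  have hfree : ∀ d, X₀.Free d ↔ Y₀.Free d := by
    intro d
    rw [free_of_net hr.left_boxNames hr.left (hr.injOn.mono Set.subset_union_left),
      free_of_net hr.right_boxNames hr.right (hr.injOn.mono Set.subset_union_right)]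
    simp only [h.free_unroll hloc]
  have hd : Derives (G.sem H) (X₀.map σ id) (Y₀.map σ id) :=
    Derives.rename (.ax hi) hX₀ hY₀ hfree σ hXc.nodup hYc.nodup
  exact .trans (.equiv hX hXc (equiv_of_net_eq hX hXc hXσ.symm))
    (.trans hd (.equiv hYc hY (equiv_of_net_eq hYc hY hYσ)))

end PreTensor
end Core

/-! ### Derivability of equations between nets -/

section NetDerives

variable {S E B : Type*} [DecidableEq B]

theorem Net.dirs_rename_nodup {F : Type*} {N : Net S F} {f : F → E} (hf : Set.InjOn f N.names)
    (hN : N.dirs.Nodup) : (N.rename f).dirs.Nodup := by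
  rw [Net.dirs_rename]
  refine hN.map_on fun d hd d' hd' h => ?_
  have h1 : f d.name = f d'.name := by simpa using congrArg DirEdge.name h
  have h2 := hf ⟨d, hd, rfl⟩ ⟨d', hd', rfl⟩ h1
  cases d <;> cases d' <;> simp_all [DirEdge.rename, DirEdge.name]

namespace PreTensor

theorem IsTensor.nodup_unroll {G : PreTensor S E B} (hG : G.IsTensor) (n : Count B) (ρ : Env B) :
    (G.unroll n ρ).dirs.Nodup :=
  nodup_dirs_unroll hG.edges_nodup (fun o ho => (hG.upClosed_ctx o ho).nodup) ρ

theorem exists_isConcrete {N : Net S E} (hN : N.dirs.Nodup) :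
    ∃ X : PreTensor S E B, X.IsConcrete ∧ X.net = N := by
  have h1 : (ofList N.toList : PreTensor S E B).net = N := by rw [net_ofList, Multiset.coe_toList]
  refine ⟨ofList N.toList, isConcrete_of_nodup (boxNames_ofList _) ?_, h1⟩
  rw [← Multiset.coe_nodup, coe_dirs _ (boxNames_ofList _), h1]
  exact hN

theorem isConcrete_of_net {X : PreTensor S E B} (hX : X.boxNames = []) (h : X.net.dirs.Nodup) :
    X.IsConcrete :=
  isConcrete_of_nodup hX (by rwa [← Multiset.coe_nodup, coe_dirs X hX])

variable [DecidableEq E] {P : Set (PreTensor S E B × PreTensor S E B)} {N N' N'' K : Net S E}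

/-- All equations between concrete expressions with the given nets can be derived. -/
def NetDerives (P : Set (PreTensor S E B × PreTensor S E B)) (N N' : Net S E) : Prop :=
  ∀ X Y : PreTensor S E B, X.IsConcrete → Y.IsConcrete → X.net = N → Y.net = N' → Derives P X Y

theorem NetDerives.trans (h : NetDerives P N N') (h' : NetDerives P N' N'')
    (hd : N'.dirs.Nodup) : NetDerives P N N'' := by
  intro X Y hX hY h1 h2
  obtain ⟨Z, hZ, h3⟩ := exists_isConcrete (B := B) hd
  exact .trans (h X Z hX hZ h1 h3) (h' Z Y hZ hY h3 h2)

theorem NetDerives.add (h : NetDerives P N N') (hd : (N + K).dirs.Nodup)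
    (hd' : (N' + K).dirs.Nodup) : NetDerives P (N + K) (N' + K) := by
  intro X Y hX hY h1 h2
  simp only [Net.dirs_add] at hd hd'
  have hd := Multiset.nodup_add.1 hd
  have hd' := Multiset.nodup_add.1 hd'
  obtain ⟨X₁, hX₁, h3⟩ := exists_isConcrete (B := B) hd.1
  obtain ⟨Y₁, hY₁, h4⟩ := exists_isConcrete (B := B) hd'.1
  obtain ⟨Z, hZ, h5⟩ := exists_isConcrete (B := B) hd.2.1
  have h6 : (X₁.prod Z).net = X.net := by rw [net_prod, h3, h5, h1]
  have h7 : (Y₁.prod Z).net = Y.net := by rw [net_prod, h4, h5, h2]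
  have h8 : (X₁.prod Z).IsConcrete := hX.of_net_eq (by simp [boxNames, hX₁.2, hZ.2]) h6
  have h9 : (Y₁.prod Z).IsConcrete := hY.of_net_eq (by simp [boxNames, hY₁.2, hZ.2]) h7
  exact .trans (.equiv hX h8 (equiv_of_net_eq hX h8 h6.symm))
    (.trans (.prod Z (h X₁ Y₁ hX₁ hY₁ h3 h4) h8 h9) (.equiv h9 hY (equiv_of_net_eq h9 hY h7)))

/-- The terms of a sum can be exchanged one after another, if no mixed sum uses an edge twice. -/
theorem NetDerives.sum (k : ℕ) {F F' : ℕ → Net S E} (h : ∀ i < k, NetDerives P (F i) (F' i))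
    (hd : ∀ c : ℕ → Bool, (∑ i ∈ Finset.range k, (bif c i then F i else F' i) + K).dirs.Nodup) :
    NetDerives P (∑ i ∈ Finset.range k, F i + K) (∑ i ∈ Finset.range k, F' i + K) := by
  induction k generalizing K with
  | zero =>
    intro X Y hX hY h1 h2
    exact .equiv hX hY (equiv_of_net_eq hX hY (by simp_all))
  | succ k ih =>
    have hd1 : ∀ (c : ℕ → Bool) (b : Bool), (∑ i ∈ Finset.range k, (bif c i then F i else F' i) +
        ((bif b then F k else F' k) + K)).dirs.Nodup := by
      intro c b
      have := hd (Function.update c k b)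
      rw [Finset.sum_range_succ, Function.update_self, add_assoc] at this
      convert this using 3
      refine Finset.sum_congr rfl fun i hi => ?_
      rw [Function.update_of_ne (Finset.mem_range.1 hi).ne]
    have h1 := ih (K := F k + K) (fun i hi => h i (by omega)) fun c => hd1 c true
    rw [Finset.sum_range_succ, Finset.sum_range_succ, add_assoc, add_assoc]
    refine h1.trans ?_ (by simpa using hd1 (fun _ => false) true)
    rw [add_left_comm _ (F k), add_left_comm _ (F' k)]
    refine (h k (by omega)).add ?_ ?_
    · rw [← add_left_comm]; simpa using hd1 (fun _ => false) true
    · rw [← add_left_comm]; simpa using hd1 (fun _ => false) false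

/-- It is enough to derive the unrolled equations. -/
theorem follows_of_netDerives {T T' : PreTensor S E B} {anc : B → Set B} (hT : T.Layered anc [])
    (hT' : T'.Layered anc []) (hd : ∀ n : Count B, n.Local anc → (T.unroll n 0).dirs.Nodup)
    (hd' : ∀ n : Count B, n.Local anc → (T'.unroll n 0).dirs.Nodup)
    (h : ∀ (n : Count B) (f : E × Env B → E), n.Local anc →
      Set.InjOn f ((T.unroll n 0).names ∪ (T'.unroll n 0).names) →
      NetDerives P ((T.unroll n 0).rename f) ((T'.unroll n 0).rename f)) :
    Follows (T.sem T') P := by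
  rintro ⟨X, Y⟩ hXY
  obtain ⟨n, f, hn, hr⟩ := Inst.realizes hXY anc hT hT'
  refine h n f hn hr.injOn X Y (isConcrete_of_net hr.left_boxNames ?_)
    (isConcrete_of_net hr.right_boxNames ?_) hr.left hr.right
  · rw [hr.left]
    exact Net.dirs_rename_nodup (hr.injOn.mono Set.subset_union_left) (hd n hn)
  · rw [hr.right]
    exact Net.dirs_rename_nodup (hr.injOn.mono Set.subset_union_right) (hd' n hn)

theorem IsTensor.follows_of_netDerives {T T' : PreTensor S E B} (hT : T.IsTensor)
    (hT' : T'.IsTensor) (hN : ∀ C D, T.Nested C D ↔ T'.Nested C D)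
    (h : ∀ (n : Count B) (f : E × Env B → E), n.Local T.ancestors →
      Set.InjOn f ((T.unroll n 0).names ∪ (T'.unroll n 0).names) →
      NetDerives P ((T.unroll n 0).rename f) ((T'.unroll n 0).rename f)) :
    Follows (T.sem T') P :=
  PreTensor.follows_of_netDerives hT.layered (ancestors_congr hN ▸ hT'.layered)
    (fun n _ => hT.nodup_unroll n 0) (fun n _ => hT'.nodup_unroll n 0) h

variable {G H : PreTensor S E B} [Infinite E] [Infinite B]

theorem IsEquation.netDerives (h : G.IsEquation H) {n : Count B}
    (hn : ∀ C ∈ G.boxes, ∀ ρ ρ', (∀ D ∈ G.ancestors C, ρ D = ρ' D) → n C ρ = n C ρ')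
    (f : E × Env B → E) :
    NetDerives (G.sem H) ((G.unroll n 0).rename f) ((H.unroll n 0).rename f) :=
  fun _ _ hX hY hXn hYn => h.derives hn hX hY hXn hYn

end PreTensor
end NetDerives

/-! ### The rules for the operations -/

section Operations

namespace PreTensor

variable {S E B : Type*} [DecidableEq E] [DecidableEq B] [Infinite E] [Infinite B]
  {G H : PreTensor S E B}

omit [Infinite E] [Infinite B] in
theorem follows_exp (A : B) {fr : Fr E B} (hfr : G.IsFresh fr H) :
    Follows ((G.exp A fr).sem (H.exp A fr)) (G.sem H) :=
  fun _ h => .ax (.exp A fr hfr h)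

omit [Infinite E] [Infinite B] in
theorem follows_kill (A : B) : Follows ((G.kill A).sem (H.kill A)) (G.sem H) :=
  fun _ h => .ax (.kill A h)

theorem IsEquation.follows_drop (h : G.IsEquation H) (A : B) :
    Follows ((G.drop A).sem (H.drop A)) (G.sem H) := by
  have hG := h.left.layered
  have hH := h.ancestors_eq ▸ h.right.layered
  have hd : ∀ Z : PreTensor S E B, Z.IsTensor → ∀ n : Count B,
      ((Z.drop A).unroll n 0).dirs.Nodup := by
    intro Z hZ n
    have ho := occ_drop (A := A) hZ.layered trivial
    refine nodup_dirs_unroll ?_ ?_ 0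
    · rw [dirs, ho, List.map_map]
      exact hZ.edges_nodup
    · rw [ho]
      simp only [List.mem_map, forall_exists_index, and_imp, forall_apply_eq_imp_iff₂, Occ.ctx,
        ← List.filter_append]
      exact fun o ho => (hZ.upClosed_ctx o ho).nodup.filter _
  refine follows_of_netDerives (hG.drop (A := A)) (hH.drop (A := A)) (fun n _ => hd G h.left n)
    (fun n _ => hd H h.right n) fun n' f hn' _ => ?_
  obtain ⟨n, hn, hc⟩ := exists_dropCount (M := Set.univ) hn'
  rw [unroll_drop hc G hG (by simp), unroll_drop hc H hH (by simp), Net.rename_rename,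
    Net.rename_rename]
  exact h.netDerives (fun C _ => hn C) _

theorem IsEquation.follows_copy (h : G.IsEquation H) (A : B) {fr : Fr E B}
    (hfr : G.IsFresh fr H) : Follows ((G.copy A fr).sem (H.copy A fr)) (G.sem H) := by
  have hG := h.left.layered
  have hH := h.ancestors_eq ▸ h.right.layered
  have hf : ∀ C ∈ namesOf G H, fr.box C ∉ namesOf G H := hfr.2
  have hGM : ∀ C ∈ G.boxNames, C ∈ namesOf G H := fun C hC => List.mem_append_left _ hC
  have hHM : ∀ C ∈ H.boxNames, C ∈ namesOf G H := fun C hC => List.mem_append_right _ hC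
  refine follows_of_netDerives (hG.copy (A := A) hf (by simp) (by simp) hGM)
    (hH.copy (A := A) hf (by simp) (by simp) hHM) ?_ ?_ fun n' f hn' _ => ?_
  · intro n' hn'
    obtain ⟨n, hn, hc⟩ := exists_copyCount hf hn'
    rw [unroll_copy hf hc hn' G hG hGM]
    exact Net.dirs_rename_nodup ((injOn_copyEdge hG hH hfr hn hn').mono Set.subset_union_left)
      (h.left.nodup_unroll n 0)
  · intro n' hn'
    obtain ⟨n, hn, hc⟩ := exists_copyCount hf hn'
    rw [unroll_copy hf hc hn' H hH hHM]
    exact Net.dirs_rename_nodup ((injOn_copyEdge hG hH hfr hn hn').mono Set.subset_union_right)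
      (h.right.nodup_unroll n 0)
  · obtain ⟨n, hn, hc⟩ := exists_copyCount hf hn'
    rw [unroll_copy hf hc hn' G hG hGM, unroll_copy hf hc hn' H hH hHM, Net.rename_rename,
      Net.rename_rename]
    exact h.netDerives (fun C _ => hn C) _

end PreTensor
end Operations

/-! ### The rules for renaming -/

section Renaming

namespace PreTensor

variable {S E B : Type*} {G H : PreTensor S E B}

theorem boxOcc_map (f : E → E) (g : B → B) (G : PreTensor S E B) :
    (G.map f g).boxOcc = G.boxOcc.map fun p => (g p.1, p.2.map g) := by
  induction G with
  | one => rfl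
  | idt a b => rfl
  | node φ e => rfl
  | box G A ih => simp [boxOcc, PreTensor.map, ih]
  | prod G H ihG ihH => simp [boxOcc, PreTensor.map, ihG, ihH]

theorem nested_map {f : E → E} {g : B → B} {X Y : B} :
    (G.map f g).Nested X Y ↔ ∃ C D, G.Nested C D ∧ g C = X ∧ g D = Y := by
  simp only [nested_iff_boxOcc, boxOcc_map, List.mem_map, Prod.mk.injEq, Prod.exists]
  constructor
  · rintro ⟨r, C, s, h, rfl, h2⟩
    cases s with
    | nil => simp at h2
    | cons D s =>
      simp only [List.map_cons, List.cons.injEq] at h2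
      exact ⟨C, D, ⟨s, h⟩, rfl, h2.1⟩
  · rintro ⟨C, D, ⟨s, h⟩, rfl, rfl⟩
    exact ⟨s.map g, C, D :: s, h, rfl, by simp⟩

theorem IsEquation.nested_map_iff (h : G.IsEquation H) {f : E → E} {g : B → B} (C D : B) :
    (G.map f g).Nested C D ↔ (H.map f g).Nested C D := by
  simp only [nested_map, h.nested_iff]

variable [DecidableEq E] [DecidableEq B] [Infinite E] [Infinite B]

theorem IsEquation.follows_renameEdge (h : G.IsEquation H) (a b : E)
    (hG : (G.renameEdge a b).IsTensor) (hH : (H.renameEdge a b).IsTensor) :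
    Follows ((G.renameEdge a b).sem (H.renameEdge a b)) (G.sem H) := by
  have hanc : (G.renameEdge a b).ancestors = G.ancestors :=
    ancestors_congr fun C D => by simp [renameEdge, nested_map]
  refine hG.follows_of_netDerives hH h.nested_map_iff fun n f hn _ => ?_
  rw [hanc] at hn
  have hs : Simulates n n (Function.update id a b) id id (fun x => (Function.update id a b x.1, x.2))
      (fun _ => True) (fun _ => True) :=
    ⟨fun _ _ _ => rfl, fun _ _ _ _ => rfl, by simp, fun _ _ _ _ _ _ => rfl⟩
  have h1 := unroll_map hs G (by simp) (by simp) 0 trivial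
  have h2 := unroll_map hs H (by simp) (by simp) 0 trivial
  simp only [id] at h1 h2
  rw [renameEdge, renameEdge, h1, h2, Net.rename_rename, Net.rename_rename]
  exact h.netDerives (fun C _ => hn C) _

/-- The renamed equation unrolls like the equation, in environments with `A` and `C` exchanged. -/
theorem IsEquation.follows_renameBox (h : G.IsEquation H) {A C : B} (hA : A ∈ G.boxes)
    (hG : (G.renameBox A C).IsTensor) (hH : (H.renameBox A C).IsTensor) :
    Follows ((G.renameBox A C).sem (H.renameBox A C)) (G.sem H) := by
  -- on the names that occur, the substitution is a transposition
  have hswap : ∀ X ∈ G.boxes, Function.update id A C X = Equiv.swap A C X := by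
    intro X hX
    by_cases hXA : X = A
    · simp [hXA]
    · by_cases hXC : X = C
      · have := hG.boxes_nodup
        rw [renameBox, boxes_map] at this
        subst hXC
        exact absurd (List.inj_on_of_nodup_map this hX hA (by simp [hXA])) hXA
      · simp [hXA, Equiv.swap_apply_of_ne_of_ne hXA hXC]
  have hanc : ∀ X D, D ∈ (G.renameBox A C).ancestors X →
      Equiv.swap A C D ∈ G.ancestors (Equiv.swap A C X) := by
    intro X D hD
    refine Relation.TransGen.lift (Equiv.swap A C) (fun X Y hXY => ?_) _ _ hD
    change G.Nested _ _
    obtain ⟨X, Y, hN, rfl, rfl⟩ := nested_map.1 hXY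
    have hb := mem_boxes_of_mem_ancestors (G := G) (.single hN)
    rw [hswap X hb.1, hswap Y hb.2]
    simpa using hN
  refine hG.follows_of_netDerives hH h.nested_map_iff fun n f hn _ => ?_
  have hs : Simulates (fun X ρ => n (Function.update id A C X) (ρ ∘ Equiv.swap A C)) n
      (id : E → E) (Function.update id A C) (fun ρ => ρ ∘ Equiv.swap A C)
      (fun x => (x.1, x.2 ∘ Equiv.swap A C)) (fun _ => True) (· ∈ G.boxes) := by
    refine ⟨fun _ _ _ => rfl, fun _ _ _ _ => rfl, by simp, fun X hX ρ _ i _ => ?_⟩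
    rw [Function.update_comp_equiv, hswap X hX, Equiv.symm_swap]
  have h1 := unroll_map hs G (fun _ => id) h.left.ectx_mem 0 trivial
  have h2 := unroll_map hs H (fun X => (h.boxes_iff X).2)
    (fun o ho X hX => (h.boxes_iff X).2 (h.right.ectx_mem o ho X hX)) 0 trivial
  have h0 : (0 : Env B) ∘ Equiv.swap A C = 0 := rfl
  simp only [h0] at h1 h2
  rw [renameBox, renameBox, h1, h2, Net.rename_rename, Net.rename_rename]
  refine h.netDerives (n := fun X ρ => n (Function.update id A C X) (ρ ∘ Equiv.swap A C))
    (fun X hX ρ ρ' hρ => hn _ _ _ fun D hD => ?_) _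
  have := hanc _ D hD
  rw [hswap X hX, Equiv.swap_apply_self] at this
  exact hρ _ this

end PreTensor
end Renaming

/-! ### The rules for products, !-boxes and weakening -/

section Contexts

namespace PreTensor

variable {S E B : Type*} {G H K T : PreTensor S E B} {A : B}

/-- A !-box keeps its ancestors if an expression is extended elsewhere. -/
theorem ancestors_eq_of_boxOcc (hG : G.boxes.Nodup) (hT : T.boxes.Nodup) {C : B} {r : List B}
    (h : (C, r) ∈ G.boxOcc) (h' : (C, r) ∈ T.boxOcc) : T.ancestors C = G.ancestors C := by
  ext D
  rw [mem_ancestors hT h', mem_ancestors hG h]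

theorem IsEquation.topBoxes_iff (h : G.IsEquation H) (C : B) :
    C ∈ G.topBoxes ↔ C ∈ H.topBoxes := by
  have key : ∀ G : PreTensor S E B, G.IsTensor →
      (C ∈ G.topBoxes ↔ C ∈ G.boxes ∧ ∀ D, ¬ G.Nested C D) := by
    intro G hG
    simp only [mem_topBoxes, mem_boxes_iff, nested_iff_boxOcc, not_exists]
    constructor
    · intro hC
      refine ⟨⟨_, hC⟩, fun D r hr => ?_⟩
      have := boxOcc_unique hG.boxes_nodup hC hr
      simp at this
    · rintro ⟨⟨r, hr⟩, h⟩
      cases r with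
      | nil => exact hr
      | cons D r => exact absurd hr (h D r)
  rw [key G h.left, key H h.right, h.boxes_iff]
  simp only [h.nested_iff]

variable [DecidableEq B] [DecidableEq E] [Infinite E] [Infinite B]

theorem IsEquation.follows_prod (h : G.IsEquation H) (hG : (G.prod K).IsTensor)
    (hH : (H.prod K).IsTensor) : Follows ((G.prod K).sem (H.prod K)) (G.sem H) := by
  refine hG.follows_of_netDerives hH (fun C D => ?_) fun n f hn hf => ?_
  · simp only [Nested, h.nested_iff]
  · have h1 := Net.dirs_rename_nodup (hf.mono Set.subset_union_left) (hG.nodup_unroll n 0)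
    have h2 := Net.dirs_rename_nodup (hf.mono Set.subset_union_right) (hH.nodup_unroll n 0)
    simp only [unroll, Net.rename_add] at h1 h2 ⊢
    refine (h.netDerives (fun C hC ρ ρ' hρ => hn C ρ ρ' fun D hD => hρ D ?_) f).add h1 h2
    obtain ⟨r, hr⟩ := mem_boxes_iff.1 hC
    rwa [ancestors_eq_of_boxOcc h.left.boxes_nodup hG.boxes_nodup hr (by simp [boxOcc, hr])] at hD

/-- The copies of the contents of a !-box are exchanged one after another; each of them is an
unrolling of the contents with counts of its own. -/
theorem IsEquation.follows_box (h : G.IsEquation H) (hG : (G.box A).IsTensor)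
    (hH : (H.box A).IsTensor) : Follows ((G.box A).sem (H.box A)) (G.sem H) := by
  refine hG.follows_of_netDerives hH (fun C D => ?_) fun n f hn hf => ?_
  · simp only [Nested, h.nested_iff, h.topBoxes_iff]
  have hAG : A ∉ G.boxes := (List.nodup_cons.1 hG.boxes_nodup).1
  have hcopy : ∀ Z : PreTensor S E B, Z.IsTensor → A ∉ Z.boxes → ∀ i : ℕ,
      Z.unroll n (Function.update 0 A (i + 1)) =
        (Z.unroll (fun C ρ => n C (Function.update ρ A (i + 1))) 0).rename
          fun x => (x.1, Function.update x.2 A (i + 1)) := by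
    intro Z hZ hA i
    have hs : Simulates (fun C ρ => n C (Function.update ρ A (i + 1))) n (id : E → E) id
        (fun ρ => Function.update ρ A (i + 1)) (fun x => (x.1, Function.update x.2 A (i + 1)))
        (fun _ => True) (· ≠ A) :=
      ⟨fun _ _ _ => rfl, fun _ _ _ _ => rfl, by simp, fun C hC ρ _ j _ => by
        rw [Function.update_comm hC]; rfl⟩
    have := unroll_map hs Z (fun C hC => by rintro rfl; exact hA hC)
      (fun o ho C hC => by rintro rfl; exact hA (hZ.ectx_mem o ho C hC)) 0 trivial
    rwa [map_id] at this
  have hindex : ∀ Z : PreTensor S E B, Z.IsTensor → A ∉ Z.boxes → ∀ i : ℕ,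
      ∀ x ∈ (Z.unroll n (Function.update 0 A (i + 1))).names, x.2 A = i + 1 := by
    intro Z hZ hA i x hx
    obtain ⟨o, ho, -, hx⟩ := mem_names_unroll.1 hx
    rw [eq_of_mem_envs hx, Function.update_self]
    simp only [List.mem_reverse, Occ.ctx, List.mem_append, not_or]
    exact ⟨fun h => hA (hZ.ectx_mem o ho A h), fun h => hA (nctx_subset_boxes o ho A h)⟩
  set F : ℕ → Net S E := fun i => (G.unroll n (Function.update 0 A (i + 1))).rename f with hF
  set F' : ℕ → Net S E := fun i => (H.unroll n (Function.update 0 A (i + 1))).rename f with hF'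
  have hAH : A ∉ H.boxes := (List.nodup_cons.1 hH.boxes_nodup).1
  -- both families consist of renamed nets whose names are those of the copy with the given index
  have hfam : ∀ (c : Bool) (i : ℕ), ∃ N : Net S (E × Env B), (bif c then F i else F' i) = N.rename f ∧
      N.dirs.Nodup ∧ (∀ x ∈ N.names, x.2 A = i + 1) ∧ (i < n A 0 →
        N.names ⊆ (unroll n (G.box A) 0).names ∪ (unroll n (H.box A) 0).names) := by
    have hsub : ∀ (Z : PreTensor S E B) (i : ℕ), i < n A 0 →
        (Z.unroll n (Function.update 0 A (i + 1))).names ⊆ ((Z.box A).unroll n 0).names := by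
      rintro Z i hi x ⟨d, hd, rfl⟩
      refine ⟨d, ?_, rfl⟩
      rw [unroll, Net.dirs_sum, Multiset.mem_sum]
      exact ⟨i, Finset.mem_range.2 hi, hd⟩
    rintro (_ | _) i
    · exact ⟨_, rfl, h.right.nodup_unroll _ _, hindex H h.right hAH i,
        fun hi => (hsub H i hi).trans Set.subset_union_right⟩
    · exact ⟨_, rfl, h.left.nodup_unroll _ _, hindex G h.left hAG i,
        fun hi => (hsub G i hi).trans Set.subset_union_left⟩
  have key : NetDerives (G.sem H) (∑ i ∈ Finset.range (n A 0), F i + 0)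
      (∑ i ∈ Finset.range (n A 0), F' i + 0) := by
    refine NetDerives.sum (n A 0) (fun i _ => ?_) fun c => ?_
    · simp only [hF, hF', hcopy G h.left hAG, hcopy H h.right hAH, Net.rename_rename]
      refine h.netDerives (n := fun C ρ => n C (Function.update ρ A (i + 1)))
        (fun C hC ρ ρ' hρ => hn C _ _ fun D hD => ?_) _
      by_cases hDA : D = A
      · simp [hDA]
      · rw [Function.update_of_ne hDA, Function.update_of_ne hDA]
        obtain ⟨r, hr⟩ := mem_boxes_iff.1 hC
        rw [mem_ancestors (r := r ++ [A]) hG.boxes_nodup (by simp [boxOcc, hr])] at hD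
        refine hρ D ((mem_ancestors h.left.boxes_nodup hr).2 ?_)
        simpa [hDA] using hD
    · rw [add_zero, Net.dirs_sum]
      refine nodup_sum_range (fun i hi => ?_) fun i hi j hj => ?_
      · obtain ⟨N, h1, h2, -, h4⟩ := hfam (c i) i
        rw [h1]
        exact Net.dirs_rename_nodup (hf.mono (h4 hi)) h2
      · obtain ⟨N, h1, -, h3, h4⟩ := hfam (c i) i
        obtain ⟨N', h1', -, h3', h4'⟩ := hfam (c j) j
        rw [h1, h1', Multiset.disjoint_left]
        intro d hd hd'
        rw [Net.dirs_rename, Multiset.mem_map] at hd hd'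
        obtain ⟨e, he, rfl⟩ := hd
        obtain ⟨e', he', hee⟩ := hd'
        have h5 : e.name ∈ N'.names := ⟨e, he, rfl⟩
        have h6 : e'.name ∈ N.names := ⟨e', he', rfl⟩
        have h7 := hf (h4 hi h6) (h4' (by omega) h5) (by
          simpa using congrArg DirEdge.name hee)
        have h8 := h3 _ h6
        rw [h7, h3' _ h5] at h8
        omega
  simpa only [add_zero, hF, hF', unroll, Net.rename_sum] using key

end PreTensor
end Contexts

section Weaken

namespace PreTensor

variable {S E B : Type*} [DecidableEq B] {G H K : PreTensor S E B} {A : B}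

theorem weaken_of_not_mem (G : PreTensor S E B) (hA : A ∉ G.boxes) : weaken A K G = G := by
  induction G with
  | one => rfl
  | idt a b => rfl
  | node φ e => rfl
  | box G C ih =>
    simp only [boxes, List.mem_cons, not_or] at hA
    simp [weaken, Ne.symm hA.1, ih hA.2]
  | prod G H ihG ihH =>
    simp only [boxes, List.mem_append, not_or] at hA
    simp [weaken, ihG hA.1, ihH hA.2]

theorem topBoxes_weaken (G : PreTensor S E B) : (weaken A K G).topBoxes = G.topBoxes := by
  induction G with
  | one => rfl
  | idt a b => rfl
  | node φ e => rfl
  | box G C ih => by_cases hC : C = A <;> simp [weaken, hC, topBoxes]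
  | prod G H ihG ihH => simp [weaken, topBoxes, ihG, ihH]

theorem nested_weaken (G : PreTensor S E B) (X Y : B) : (weaken A K G).Nested X Y ↔
    G.Nested X Y ∨ A ∈ G.boxes ∧ (K.Nested X Y ∨ A = Y ∧ X ∈ K.topBoxes) := by
  induction G with
  | one => simp [weaken, Nested, boxes]
  | idt a b => simp [weaken, Nested, boxes]
  | node φ e => simp [weaken, Nested, boxes]
  | box G C ih =>
    by_cases hC : C = A
    · simp only [weaken, hC, if_true, Nested, topBoxes, boxes, List.mem_append, List.mem_cons,
        true_or, true_and]
      tauto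
    · simp only [weaken, hC, if_false, Nested, topBoxes_weaken, boxes, List.mem_cons,
        Ne.symm hC, false_or, ih, or_assoc]
  | prod G H ihG ihH =>
    simp only [weaken, Nested, boxes, List.mem_append, ihG, ihH, or_and_right]
    rw [or_or_or_comm]

theorem boxOcc_weaken (G : PreTensor S E B) : ∀ p ∈ G.boxOcc, p ∈ (weaken A K G).boxOcc := by
  induction G with
  | one => simp [boxOcc]
  | idt a b => simp [boxOcc]
  | node φ e => simp [boxOcc]
  | box G C ih =>
    intro p hp
    simp only [boxOcc, List.mem_cons, List.mem_map] at hp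
    by_cases hC : C = A
    · simp only [weaken, hC, if_true, boxOcc, List.mem_cons, List.mem_map, List.mem_append]
      subst hC
      exact hp.imp id fun ⟨q, hq, h⟩ => ⟨q, .inl hq, h⟩
    · simp only [weaken, hC, if_false, boxOcc, List.mem_cons, List.mem_map]
      exact hp.imp id fun ⟨q, hq, h⟩ => ⟨q, ih q hq, h⟩
  | prod G H ihG ihH =>
    intro p hp
    simp only [weaken, boxOcc, List.mem_append] at hp ⊢
    exact hp.imp (ihG p) (ihH p)

/-- Weakening adds one copy of `K` for every copy of `A`. -/
theorem unroll_weaken (n : Count B) (G : PreTensor S E B) (hG : G.boxes.Nodup) {q : List B}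
    (hq : (A, q) ∈ G.boxOcc) (ρ : Env B) : (weaken A K G).unroll n ρ =
      G.unroll n ρ + ((envs n (A :: q).reverse ρ).map (K.unroll n)).sum := by
  induction G generalizing q ρ with
  | one => simp [boxOcc] at hq
  | idt a b => simp [boxOcc] at hq
  | node φ e => simp [boxOcc] at hq
  | box G C ih =>
    rw [boxes, List.nodup_cons] at hG
    simp only [boxOcc, List.mem_cons, Prod.mk.injEq, List.mem_map, Prod.exists] at hq
    have hsum : ∀ (s : Finset ℕ) (m : ℕ → Multiset (Env B)), ((∑ i ∈ s, m i).map (K.unroll n)).sum =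
        ∑ i ∈ s, ((m i).map (K.unroll n)).sum := fun s m => by
      rw [← Multiset.coe_mapAddMonoidHom, map_sum, ← Multiset.coe_sumAddMonoidHom, map_sum]
    rcases hq with ⟨rfl, rfl⟩ | ⟨X, q, hq, rfl, rfl⟩
    · simp [weaken, unroll, envs, hsum, Finset.sum_add_distrib]
    · have hC : C ≠ X := fun h => hG.1 (h ▸ mem_boxes_iff.2 ⟨_, hq⟩)
      have hr : (X :: (q ++ [C])).reverse = C :: (X :: q).reverse := by simp
      rw [hr]
      simp only [weaken, hC, if_false, unroll, envs, hsum, ← Finset.sum_add_distrib]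
      exact Finset.sum_congr rfl fun i _ => ih hG.2 hq _
  | prod G H ihG ihH =>
    rw [boxes, List.nodup_append] at hG
    simp only [boxOcc, List.mem_append] at hq
    rcases hq with hq | hq
    · have hA : A ∉ H.boxes := fun h => hG.2.2 A (mem_boxes_iff.2 ⟨_, hq⟩) A h rfl
      simp only [weaken, unroll, ihG hG.1 hq, weaken_of_not_mem H hA]
      abel
    · have hA : A ∉ G.boxes := fun h => hG.2.2 A h A (mem_boxes_iff.2 ⟨_, hq⟩) rfl
      simp only [weaken, unroll, ihH hG.2.1 hq, weaken_of_not_mem G hA]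
      abel

variable [DecidableEq E] [Infinite E] [Infinite B]

/-- The copies of `K` that are added are the same on both sides. -/
theorem IsEquation.follows_weaken (h : G.IsEquation H) (hG : (weaken A K G).IsTensor)
    (hH : (weaken A K H).IsTensor) :
    Follows ((weaken A K G).sem (weaken A K H)) (G.sem H) := by
  by_cases hAG : A ∈ G.boxes
  swap
  · rw [weaken_of_not_mem G hAG, weaken_of_not_mem H fun hA => hAG ((h.boxes_iff A).2 hA)]
    exact fun _ h => .ax h
  have hN : ∀ X Y, (weaken A K G).Nested X Y ↔ (weaken A K H).Nested X Y := fun X Y => by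
    simp only [nested_weaken, h.nested_iff, h.boxes_iff]
  have hanc := ancestors_congr hN
  refine hG.follows_of_netDerives hH hN fun n f hn hf => ?_
  obtain ⟨q, hq⟩ := mem_boxes_iff.1 hAG
  obtain ⟨q', hq'⟩ := mem_boxes_iff.1 ((h.boxes_iff A).1 hAG)
  have hu := upClosed_boxOcc hG.boxes_nodup (boxOcc_weaken (K := K) G _ hq)
  have hu' := upClosed_boxOcc hH.boxes_nodup (boxOcc_weaken (K := K) H _ hq')
  rw [← hanc] at hu'
  have hqq : ∀ C, C ∈ q ↔ C ∈ q' := fun C => by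
    rw [← mem_ancestors h.left.boxes_nodup hq, ← mem_ancestors h.right.boxes_nodup hq',
      h.ancestors_eq]
  -- the two sides may list the !-boxes around `A` differently, but have the same copies of `A`
  have henvs : envs n (A :: q).reverse 0 = envs n (A :: q').reverse 0 := by
    refine Multiset.Nodup.ext (nodup_envs (List.nodup_reverse.2 hu.nodup) 0)
      (nodup_envs (List.nodup_reverse.2 hu'.nodup) 0) |>.2 fun ρ => ?_
    rw [mem_envs (r := []) hn (by simpa using hu), mem_envs (r := []) hn (by simpa using hu')]
    simp [hqq]
  have h1 := Net.dirs_rename_nodup (hf.mono Set.subset_union_left) (hG.nodup_unroll n 0)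
  have h2 := Net.dirs_rename_nodup (hf.mono Set.subset_union_right) (hH.nodup_unroll n 0)
  rw [unroll_weaken n G h.left.boxes_nodup hq, Net.rename_add] at h1 ⊢
  rw [unroll_weaken n H h.right.boxes_nodup hq', Net.rename_add, ← henvs] at h2 ⊢
  refine (h.netDerives (fun C hC ρ ρ' hρ => hn C ρ ρ' fun D hD => hρ D ?_) f).add h1 h2
  obtain ⟨r, hr⟩ := mem_boxes_iff.1 hC
  rwa [ancestors_eq_of_boxOcc h.left.boxes_nodup hG.boxes_nodup hr (boxOcc_weaken G _ hr)] at hD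

end PreTensor
end Weaken

end BangTensor


theorem mainTheorem1 {S E B : Type*} [DecidableEq E] [DecidableEq B] [Infinite E] [Infinite B]
    (G H : PreTensor S E B) (hGH : G.IsEquation H) :
    -- (Prod)
    (∀ K : PreTensor S E B, (G.prod K).IsTensor → (H.prod K).IsTensor →
      PreTensor.Follows ((G.prod K).sem (H.prod K)) (G.sem H)) ∧
    -- (Box)
    (∀ A : B, (G.box A).IsTensor → (H.box A).IsTensor →
      PreTensor.Follows ((G.box A).sem (H.box A)) (G.sem H)) ∧
    -- (Weaken)
    (∀ (A : B) (K : PreTensor S E B),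
      (PreTensor.weaken A K G).IsTensor → (PreTensor.weaken A K H).IsTensor →
      PreTensor.Follows ((PreTensor.weaken A K G).sem (PreTensor.weaken A K H)) (G.sem H)) ∧
    -- (Exp)
    (∀ (A : B) (fr : Fr E B), G.IsFresh fr H →
      PreTensor.Follows ((G.exp A fr).sem (H.exp A fr)) (G.sem H)) ∧
    -- (Kill)
    (∀ A : B, PreTensor.Follows ((G.kill A).sem (H.kill A)) (G.sem H)) ∧
    -- (Copy)
    (∀ (A : B) (fr : Fr E B), G.IsFresh fr H →
      PreTensor.Follows ((G.copy A fr).sem (H.copy A fr)) (G.sem H)) ∧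
    -- (Drop)
    (∀ A : B, PreTensor.Follows ((G.drop A).sem (H.drop A)) (G.sem H)) ∧
    -- (EdgeRename)
    (∀ a b : E, (G.Free (.inp a) ∨ G.Free (.out a)) →
      (G.renameEdge a b).IsTensor → (H.renameEdge a b).IsTensor →
      PreTensor.Follows ((G.renameEdge a b).sem (H.renameEdge a b)) (G.sem H)) ∧
    -- (BoxRename)
    (∀ A C : B, A ∈ G.boxes →
      (G.renameBox A C).IsTensor → (H.renameBox A C).IsTensor →
      PreTensor.Follows ((G.renameBox A C).sem (H.renameBox A C)) (G.sem H)) := by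
  exact ⟨fun _ h h' => hGH.follows_prod h h', fun _ h h' => hGH.follows_box h h',
    fun _ _ h h' => hGH.follows_weaken h h', fun A _ hfr => PreTensor.follows_exp A hfr,
    fun A => PreTensor.follows_kill A, fun A _ hfr => hGH.follows_copy A hfr,
    fun A => hGH.follows_drop A, fun a b _ h h' => hGH.follows_renameEdge a b h h',
    fun _ _ hA h h' => hGH.follows_renameBox hA h h'⟩
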